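/- **Theorem ($L^2$ convergence of Linear-CTD).** There is a universal constant $c>0$ with the following property. *Setting.* Let $\mathcal S,\mathcal A$ be Polish spaces, $\gamma\in(0,1)$, $\mathcal P(\cdot,\cdot\mid s,a)$ a Markov kernel giving the joint law of (reward, next state) with rewards in $[0,1]$, $\pi(\cdot\mid s)$ a policy, and $\mu_\pi$ a stationary distribution of the induced state chain. Write $\mathbb E_{s,r,s'}$ for the expectation under $s\sim\mu_\pi$, $a\sim\pi(\cdot\mid s)$, $(r,s')\sim\mathcal P(\cdot,\cdot\mid s,a)$. Let $\phi:\mathcal S\to\mathbb R^d$ be measurable with $\|\phi(s)\|\le 1$ for all $s$, let $\Sigma_\phi=\mathbb E_{s\sim\mu_\pi}[\phi(s)\phi(s)^\top]$, and assume that its smallest eigenvalue $\lambda_{\min}$ is positive. Let $K\in\mathbb N$ with $K\ge(1-\gamma)^{-1}$, $\iota_K=(K(1-\gamma))^{-1}$ and $x_k=k\iota_K$ for $0\le k\le K$. *Parametrization and distances.* For $\theta=(\theta(0)^\top,\dots,\theta(K-1)^\top)^\top\in\mathbb R^{dK}$, with matrix form $\Theta=(\theta(0),\dots,\theta(K-1))\in\mathbb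 R^{d\times K}$, let $\eta_\theta(s)=\sum_{k=0}^K\big(F_k(s;\theta)-F_{k-1}(s;\theta)\big)\delta_{x_k}$, where $F_k(s;\theta)=\phi(s)^\top\theta(k)+\frac{k+1}{K+1}$ for $0\le k<K$, $F_{-1}=0$ and $F_K=1$. For signed measures $\nu$ put $F_\nu(x)=\nu([0,x])$; let $W_1$ and $\ell_2$ be the $L^1$ and $L^2$ distances of $F_\nu$ on $[0,(1-\gamma)^{-1}]$, and let $W_{1,\mu_\pi}(\eta,\eta')=(\mathbb E_{s\sim\mu_\pi}[W_1(\eta(s),\eta'(s))^2])^{1/2}$, and likewise $\ell_{2,\mu_\pi}$. *Target.* Let $[\mathcal T^\pi\eta](s)=\mathbb E[(x\mapsto r+\gamma x)_\#\eta(s')\mid s]$ be the distributional Bellman operator on families of signed measures. There is exactly one $\theta^\star\in\mathbb R^{dK}$ that solves the linear-categorical projected Bellman equation, that is, for which $\eta_{\theta^\star}$ minimizes $\ell_{2,\mu_\pi}(\mathcal T^\pi\eta_{\theta^\star},\eta_{\theta})$ over $\theta\in\mathbb R^{dK}$. *Algorithm.* Let $C\in\mathbb R^{K\times K}$ be the lower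 triangular all-ones matrix, $g_j(r)=\big((1-|(r+\gamma x_j-x_k)/\iota_K|)_+\big)_{k=0}^{K-1}$ for $0\le j\le K$, and $\tilde G(r)$ the $K\times K$ matrix with columns $g_j(r)-g_K(r)$, $0\le j\le K-1$. Let $(s_t,a_t,r_t,s_t')_{t\ge1}$ be i.i.d. with $s_t\sim\mu_\pi$, $a_t\sim\pi(\cdot\mid s_t)$, $(r_t,s_t')\sim\mathcal P(\cdot,\cdot\mid s_t,a_t)$. From a deterministic $\theta_0\in\mathbb R^{dK}$ and with constant step size $\alpha\in(0,(1-\sqrt\gamma)/76)$, Linear-CTD iterates $$\Theta_t=\Theta_{t-1}-\alpha\,\phi(s_t)\Big[\phi(s_t)^\top\Theta_{t-1}-\phi(s_t')^\top\Theta_{t-1}\big(C\tilde G(r_t)C^{-1}\big)^\top-\tfrac1{K+1}\Big(\sum_{j=0}^Kg_j(r_t)-\mathbf 1_K\Big)^\top C^\top\Big],\qquad t\ge1.$$ For even $T\ge2$ let $\bar\theta_T=(T/2+1)^{-1}\sum_{t=T/2}^T\theta_t$. *Conclusion.* For every such $\alpha$, $\theta_0$ and $T$, $$\begin{aligned}\mathbb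 E^{1/2}\big[W_{1,\mu_\pi}(\eta_{\theta^\star},\eta_{\bar\theta_T})^2\big]\le c\,\Bigg\{&\frac{\|\theta^\star\|_{V_1}+1}{\sqrt T(1-\gamma)\sqrt{\lambda_{\min}}}\Big(1+\sqrt{\tfrac{\alpha}{(1-\gamma)\lambda_{\min}}}\Big)+\frac{\|\theta^\star\|_{V_1}+1}{T\sqrt\alpha(1-\gamma)^{3/2}\lambda_{\min}}\\&+\frac{\big(1-\frac12\alpha(1-\sqrt\gamma)\lambda_{\min}\big)^{T/2}}{T\sqrt\alpha(1-\gamma)\sqrt{\lambda_{\min}}}\Big(\frac1{\sqrt\alpha}+\frac1{\sqrt{(1-\gamma)\lambda_{\min}}}\Big)\|\theta_0-\theta^\star\|_{V_2}\Bigg\},\end{aligned}$$ where $\|\theta\|_{V_1}=\frac{1}{\sqrt K(1-\gamma)}\sqrt{\theta^\top(I_K\otimes\Sigma_\phi)\theta}$ and $\|\theta\|_{V_2}=\frac1{\sqrt K(1-\gamma)}\|\theta\|$ with the Euclidean norm. The constant $c$ depends on nothing, in particular not on $K$. -/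

import Mathlib

open MeasureTheory ProbabilityTheory Set
open scoped ENNReal Kronecker Matrix

noncomputable section

namespace LinearCTD

/-! ### Signed measures on the return range and distances between them -/

/-- The cumulative distribution function `F_ν(x) = ν([0, x])` of a signed measure on the real line. -/
def cdf (ν : SignedMeasure ℝ) (x : ℝ) : ℝ := ν (Icc 0 x)

/-- The `1`-Wasserstein distance: the `L¹` distance of the CDFs on `[0, (1 - γ)⁻¹]`. -/
def W1 (γ : ℝ) (ν ν' : SignedMeasure ℝ) : ℝ≥0∞ :=
  ∫⁻ x in Icc 0 (1 - γ)⁻¹, ‖cdf ν x - cdf ν' x‖ₑ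

/-- The Cramér distance: the `L²` distance of the CDFs on `[0, (1 - γ)⁻¹]`. -/
def cramer (γ : ℝ) (ν ν' : SignedMeasure ℝ) : ℝ≥0∞ :=
  (∫⁻ x in Icc 0 (1 - γ)⁻¹, ‖cdf ν x - cdf ν' x‖ₑ ^ 2) ^ (1 / 2 : ℝ)

variable {S A : Type*} [MeasurableSpace S] [MeasurableSpace A]

/-- The `μ`-weighted `1`-Wasserstein distance between two families of signed measures. -/
def W1w (γ : ℝ) (μ : Measure S) (η η' : S → SignedMeasure ℝ) : ℝ≥0∞ :=
  (∫⁻ s, W1 γ (η s) (η' s) ^ 2 ∂μ) ^ (1 / 2 : ℝ)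

/-- The `μ`-weighted Cramér distance between two families of signed measures. -/
def cramerw (γ : ℝ) (μ : Measure S) (η η' : S → SignedMeasure ℝ) : ℝ≥0∞ :=
  (∫⁻ s, cramer γ (η s) (η' s) ^ 2 ∂μ) ^ (1 / 2 : ℝ)

/-! ### The Markov decision process under a policy -/

/-- The joint law of (reward, next state) given the current state, when the action is drawn from
the policy `π` and (reward, next state) from the transition kernel `P`. -/
def rewardStep (P : Kernel (S × A) (ℝ × S)) (π : Kernel S A) : Kernel S (ℝ × S) :=
  P ∘ₖ (Kernel.id ×ₖ π)

/-- The law of one sample `((s, a), (r, s'))` of the generative model: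
`s ∼ μ`, `a ∼ π(· | s)`, `(r, s') ∼ P(·, · | s, a)`. -/
def sampleLaw (P : Kernel (S × A) (ℝ × S)) (π : Kernel S A) (μ : Measure S) :
    Measure ((S × A) × (ℝ × S)) :=
  (μ ⊗ₘ π) ⊗ₘ P

/-- `ζ` is the image of `η` under the distributional Bellman operator: for every state `s`, the
signed measure `ζ(s)` is the expectation of the push-forward of `η(s')` under `x ↦ r + γ x`. -/
def IsBellmanImage (γ : ℝ) (P : Kernel (S × A) (ℝ × S)) (π : Kernel S A)
    (η ζ : S → SignedMeasure ℝ) : Prop :=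
  ∀ s : S, ∀ B : Set ℝ, MeasurableSet B →
    Integrable (fun y : ℝ × S => (η y.2).map (fun x => y.1 + γ * x) B) (rewardStep P π s) ∧
    ζ s B = ∫ y, (η y.2).map (fun x => y.1 + γ * x) B ∂(rewardStep P π s)

/-! ### The linear-categorical parametrization -/

/-- The gap `ι_K = (K (1 - γ))⁻¹` between adjacent support points. -/
def gap (γ : ℝ) (K : ℕ) : ℝ := (K * (1 - γ))⁻¹

/-- The support points `x_k = k ι_K`, for `k = 0, …, K`. -/
def supportPt (γ : ℝ) (K k : ℕ) : ℝ := k * gap γ K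

variable {d K : ℕ}

/-- The CDF values `F_k(s; Θ) = φ(s)ᵀ θ(k) + (k + 1) / (K + 1)` for `k < K`, and `F_K = 1`, where
`θ(k)` is the `k`-th column of `Θ`. -/
def cdfVal (φ : S → EuclideanSpace ℝ (Fin d)) (Θ : Matrix (Fin d) (Fin K) ℝ) (s : S) (k : ℕ) : ℝ :=
  if h : k < K then ((φ s).ofLp ᵥ* Θ) ⟨k, h⟩ + ((k : ℝ) + 1) / ((K : ℝ) + 1) else 1

/-- The signed masses `p_k(s; Θ) = F_k(s; Θ) - F_{k-1}(s; Θ)`, with `F_{-1} = 0`. -/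
def pmfVal (φ : S → EuclideanSpace ℝ (Fin d)) (Θ : Matrix (Fin d) (Fin K) ℝ) (s : S) : ℕ → ℝ
  | 0 => cdfVal φ Θ s 0
  | k + 1 => cdfVal φ Θ s (k + 1) - cdfVal φ Θ s k

/-- The family `η_θ(s) = ∑_{k=0}^K p_k(s; Θ) δ_{x_k}`, where `θ = vec(Θ)`. -/
def etaOf (γ : ℝ) (φ : S → EuclideanSpace ℝ (Fin d)) (Θ : Matrix (Fin d) (Fin K) ℝ) (s : S) :
    SignedMeasure ℝ :=
  ∑ k ∈ Finset.range (K + 1), VectorMeasure.dirac (supportPt γ K k) (pmfVal φ Θ s k)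

/-- `η_θ` solves the linear-categorical projected Bellman equation: among all families `η_θ'` of
the parametrization, it is one at minimal `μ`-weighted Cramér distance from its own image under
the distributional Bellman operator. -/
def IsProjectedFixedPoint (γ : ℝ) (P : Kernel (S × A) (ℝ × S)) (π : Kernel S A) (μ : Measure S)
    (φ : S → EuclideanSpace ℝ (Fin d)) (Θ : Matrix (Fin d) (Fin K) ℝ) : Prop :=
  ∃ ζ : S → SignedMeasure ℝ, IsBellmanImage γ P π (etaOf γ φ Θ) ζ ∧
    ∀ Θ' : Matrix (Fin d) (Fin K) ℝ,
      cramerw γ μ ζ (etaOf γ φ Θ) ≤ cramerw γ μ ζ (etaOf γ φ Θ')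

/-! ### The feature covariance and norms -/

/-- The covariance matrix `Σ_φ = E_{s ∼ μ}[φ(s) φ(s)ᵀ]`. -/
def featCov (μ : Measure S) (φ : S → EuclideanSpace ℝ (Fin d)) : Matrix (Fin d) (Fin d) ℝ :=
  Matrix.of fun i j => ∫ s, φ s i * φ s j ∂μ

lemma featCov_isHermitian (μ : Measure S) (φ : S → EuclideanSpace ℝ (Fin d)) :
    (featCov μ φ).IsHermitian := by
  ext i j
  simp [featCov, mul_comm]

/-- The smallest eigenvalue of `Σ_φ`. -/
def lambdaMin (μ : Measure S) (φ : S → EuclideanSpace ℝ (Fin d)) : ℝ :=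
  ⨅ i, (featCov_isHermitian μ φ).eigenvalues i

/-- The seminorm `‖u‖_B = (uᵀ B u)^{1/2}` of a positive semidefinite matrix `B`. -/
def matNorm {n : Type*} [Fintype n] (B : Matrix n n ℝ) (u : n → ℝ) : ℝ :=
  Real.sqrt (u ⬝ᵥ (B *ᵥ u))

/-- `‖θ‖_{V₁} = (√K (1 - γ))⁻¹ ‖θ‖_{I_K ⊗ Σ_φ}`, where `θ = vec(Θ)`. -/
def normV1 (γ : ℝ) (μ : Measure S) (φ : S → EuclideanSpace ℝ (Fin d))
    (Θ : Matrix (Fin d) (Fin K) ℝ) : ℝ :=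
  1 / (Real.sqrt K * (1 - γ)) * matNorm ((1 : Matrix (Fin K) (Fin K) ℝ) ⊗ₖ featCov μ φ) Θ.vec

/-- `‖θ‖_{V₂} = (√K (1 - γ))⁻¹ ‖θ‖`, where `θ = vec(Θ)`. -/
def normV2 (γ : ℝ) (Θ : Matrix (Fin d) (Fin K) ℝ) : ℝ :=
  1 / (Real.sqrt K * (1 - γ)) * ‖WithLp.toLp 2 Θ.vec‖

/-! ### The algorithm -/

/-- The lower triangular all-ones matrix `C`. -/
def cumMat (K : ℕ) : Matrix (Fin K) (Fin K) ℝ := Matrix.of fun i j => if j ≤ i then 1 else 0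

/-- The vector `g_j(r)`, with entries `(1 - |(r + γ x_j - x_k) / ι_K|)₊` for `k = 0, …, K - 1`. -/
def gVec (γ : ℝ) (K : ℕ) (r : ℝ) (j : ℕ) : Fin K → ℝ := fun k =>
  max (1 - |(r + γ * supportPt γ K j - supportPt γ K k) / gap γ K|) 0

/-- The matrix `G̃(r)`, whose `j`-th column is `g_j(r) - g_K(r)`. -/
def gTilde (γ : ℝ) (K : ℕ) (r : ℝ) : Matrix (Fin K) (Fin K) ℝ :=
  Matrix.of fun i j => gVec γ K r j i - gVec γ K r K i

/-- One update of Linear-CTD with step size `α` from the sample `((s, a), (r, s'))`: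
`Θ - α φ(s) [φ(s)ᵀ Θ - φ(s')ᵀ Θ (C G̃(r) C⁻¹)ᵀ - (K + 1)⁻¹ (∑_{j=0}^K g_j(r) - 1)ᵀ Cᵀ]`. -/
def update (γ α : ℝ) (φ : S → EuclideanSpace ℝ (Fin d)) (x : (S × A) × (ℝ × S))
    (Θ : Matrix (Fin d) (Fin K) ℝ) : Matrix (Fin d) (Fin K) ℝ :=
  Θ - α • Matrix.vecMulVec (φ x.1.1).ofLp
    ((φ x.1.1).ofLp ᵥ* Θ
      - (φ x.2.2).ofLp ᵥ* (Θ * (cumMat K * gTilde γ K x.2.1 * (cumMat K)⁻¹)ᵀ)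
      - ((K : ℝ) + 1)⁻¹ •
        (((∑ j ∈ Finset.range (K + 1), gVec γ K x.2.1 j) - 1) ᵥ* (cumMat K)ᵀ))

/-- The Linear-CTD iterates started at `Θ₀`; the step from time `t` to time `t + 1` uses the
sample `x t`. -/
def iterate (γ α : ℝ) (φ : S → EuclideanSpace ℝ (Fin d)) (x : ℕ → (S × A) × (ℝ × S))
    (Θ₀ : Matrix (Fin d) (Fin K) ℝ) : ℕ → Matrix (Fin d) (Fin K) ℝ
  | 0 => Θ₀
  | t + 1 => update γ α φ (x t) (iterate γ α φ x Θ₀ t)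

/-- The tail average `(T / 2 + 1)⁻¹ ∑_{t = T/2}^T Θ_t`, used for even `T`. -/
def tailAverage (γ α : ℝ) (φ : S → EuclideanSpace ℝ (Fin d)) (x : ℕ → (S × A) × (ℝ × S))
    (Θ₀ : Matrix (Fin d) (Fin K) ℝ) (T : ℕ) : Matrix (Fin d) (Fin K) ℝ :=
  ((T : ℝ) / 2 + 1)⁻¹ • ∑ t ∈ Finset.Icc (T / 2) T, iterate γ α φ x Θ₀ t

end LinearCTD

end

open LinearCTD

/-!
The iteration is stochastic approximation for an affine random field whose mean is strongly monotone
in the seminorm `‖Θ‖²_Σ = E_{s ∼ μ} ‖φ(s)ᵀΘ‖²`, with constants that do not depend on `K`.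

*The Bellman matrix.* In units of the gap `ι_K`, the point `r + γ x_j` sits at
`u_j = r K (1 - γ) + γ j`, and the vector `C g_j(r)` has entries `min(1, k + 1 - u_j)₊`. Hence
`W(r) = C G̃(r) C⁻¹` has the nonnegative entries `min(1, k + 1 - u_j)₊ - min(1, k + 1 - u_{j+1})₊`,
with row sums at most `1` and column sums `γ`, and Schur's test gives `‖W(r) u‖² ≤ γ ‖u‖²`
(`sum_sq_bellmanMat_mulVec_le`). The constant part of the update is the change of the uniform
distribution under one projected backup, which is at most `1 - γ` in each coordinate
(`abs_bellmanOffset_le`); this is why no further power of `(1 - γ)⁻¹` enters the noise level.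

*The fixed point.* On each cell `[x_k, x_{k+1})` the CDF of `η_θ(s)` is constant, so the squared
Cramér distance from a Bellman image to `η_θ'(s)` is a term independent of `θ'` plus the squared
Euclidean distance of CDF vectors to the cell averages (`cramer_sq_bellmanImage`). First-order
optimality turns the projected Bellman equation into `E[φ(s) ⊗ residual] = 0`
(`isProjectedFixedPoint_iff_integral_tdField`), a linear equation. By stationarity of `μ` and the
contraction of `W`, its linear part satisfies
`⟨θ, mean θ⟩ ≥ (1 - √γ) ‖θ‖²_Σ ≥ (1 - √γ) λ_min ‖θ‖²` (`featSq_le_inner_meanTd`), hence it is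
bijective.

*The error.* Let `Δ_t` be the centred iterates and `h` the random field. The second moment
of `h(x, Δ)` is at most `8 ‖Δ‖²_Σ + 2σ²`, so for `8α ≤ 1 - √γ` the expectation of `‖Δ_t‖²`
contracts up to noise, and `∑_t E ‖Δ_t‖²_Σ` is controlled by telescoping. Summing the recursion over
the averaging window gives `α mean(∑_t Δ_t) = Δ_m - Δ_n - α ∑_t (martingale differences)`;
inverting the mean field in the seminorm `‖·‖_Σ` yields `NoisyField.integral_q_average_le`. Finally
`W₁² ≤ ‖φ(s)ᵀ(Θ - Θ')‖² / (K (1 - γ)²)` by the Cauchy–Schwarz inequality (`W1w_sq_le`), and the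
normalization `1 / (√K (1 - γ))` is that of `‖·‖_{V₁}` and `‖·‖_{V₂}`.
-/

noncomputable section

namespace LinearCTD

/-! ### The unit ramp and the projected Bellman matrix -/

/-- The ramp `t ↦ min(1, t)₊`. -/
def ramp (t : ℝ) : ℝ := max 0 (min 1 t)

lemma ramp_mono : Monotone ramp := fun _ _ h => max_le_max le_rfl (min_le_min le_rfl h)

lemma ramp_nonneg (t : ℝ) : 0 ≤ ramp t := le_max_left _ _

lemma ramp_le_one (t : ℝ) : ramp t ≤ 1 := max_le zero_le_one (min_le_left _ _)

@[fun_prop]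
lemma continuous_ramp : Continuous ramp := by unfold ramp; fun_prop

lemma sum_ramp_sub (w : ℝ) (N : ℕ) :
    ∑ j ∈ Finset.range N, ramp (w - j) = max 0 (min (N : ℝ) w) := by
  induction N with
  | zero => simp
  | succ N ih =>
    rw [Finset.sum_range_succ, ih]
    have hN : (0 : ℝ) ≤ N := N.cast_nonneg
    push_cast
    unfold ramp
    grind

lemma sum_ramp_add (u : ℝ) (hu : 0 ≤ u) (N : ℕ) :
    ∑ k ∈ Finset.range N, ramp (k + 1 - u) = max 0 (N - u) := by
  induction N with
  | zero => simpa using hu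
  | succ N ih =>
    rw [Finset.sum_range_succ, ih]
    have hN : (0 : ℝ) ≤ N := N.cast_nonneg
    push_cast
    unfold ramp
    grind

/-- Summing the hat functions centred at `0, …, k` gives a descending ramp, on the positive
half-line. -/
lemma sum_hat (u : ℝ) (hu : 0 ≤ u) (k : ℕ) :
    ∑ i ∈ Finset.range (k + 1), max (1 - |u - i|) 0 = ramp (k + 1 - u) := by
  induction k with
  | zero => unfold ramp; simp; grind
  | succ k ih =>
    rw [Finset.sum_range_succ, ih]
    have hN : (0 : ℝ) ≤ k := k.cast_nonneg
    push_cast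
    unfold ramp
    grind

/-- Summation by parts, with `f` extended by `0` to the left of `0`. -/
lemma sum_diff_mul (f c : ℕ → ℝ) (n : ℕ) :
    f 0 * c 0 + ∑ j ∈ Finset.range n, (f (j + 1) - f j) * c (j + 1)
      = ∑ j ∈ Finset.range n, f j * (c j - c (j + 1)) + f n * c n := by
  induction n with
  | zero => simp
  | succ n ih =>
    rw [Finset.sum_range_succ, ← add_assoc, ih, Finset.sum_range_succ]
    ring

/-- The location `(r + γ x_j) / ι_K` of the shifted and scaled support point, in units of the
gap. -/
def scaledPt (γ : ℝ) (K : ℕ) (r : ℝ) (j : ℕ) : ℝ := r * (K * (1 - γ)) + γ * j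

/-- The value on the cell `[x_k, x_{k+1})` of the cumulative distribution function of the
categorical projection of `δ_{r + γ x_j}`. -/
def projCdf (γ : ℝ) (K : ℕ) (r : ℝ) (j k : ℕ) : ℝ := ramp (k + 1 - scaledPt γ K r j)

/-- The matrix of `F ↦ ` "CDF of the categorical projection of the push-forward under
`x ↦ r + γ x`", acting on differences of CDF vectors. It is `C G̃(r) C⁻¹` in closed form. -/
def bellmanMat (γ : ℝ) (K : ℕ) (r : ℝ) : Matrix (Fin K) (Fin K) ℝ :=
  Matrix.of fun k j => projCdf γ K r j k - projCdf γ K r (j + 1) k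

/-- What one Bellman backup adds, after projection, to the CDF vector of the uniform distribution
on the support points. -/
def bellmanOffset (γ : ℝ) (K : ℕ) (r : ℝ) : Fin K → ℝ := fun k =>
  ((K : ℝ) + 1)⁻¹ * (∑ j ∈ Finset.range (K + 1), projCdf γ K r j k - (k + 1))

variable {γ : ℝ} {K : ℕ} {r : ℝ}

lemma scaledPt_nonneg (hγ : γ ∈ Ioo (0 : ℝ) 1) (hr : r ∈ Icc (0 : ℝ) 1) (j : ℕ) :
    0 ≤ scaledPt γ K r j := by
  have := hγ.1; have := hγ.2; have := hr.1
  have h1 : 0 ≤ 1 - γ := by linarith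
  unfold scaledPt
  positivity

lemma scaledPt_le (hγ : γ ∈ Ioo (0 : ℝ) 1) (hr : r ∈ Icc (0 : ℝ) 1) {j : ℕ} (hj : j ≤ K) :
    scaledPt γ K r j ≤ K := by
  have h1 : 0 ≤ 1 - γ := by linarith [hγ.2]
  have h2 : r * (K * (1 - γ)) ≤ 1 * (K * (1 - γ)) := by gcongr; exact hr.2
  have h3 : γ * j ≤ γ * K := by
    have := hγ.1
    gcongr
  unfold scaledPt
  linarith

lemma scaledPt_succ (γ : ℝ) (K : ℕ) (r : ℝ) (j : ℕ) :
    scaledPt γ K r (j + 1) = scaledPt γ K r j + γ := by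
  unfold scaledPt; push_cast; ring

lemma gap_pos (hγ : γ ∈ Ioo (0 : ℝ) 1) (hK : 0 < K) : 0 < gap γ K := by
  have : 0 < 1 - γ := by linarith [hγ.2]
  unfold gap
  positivity

lemma shift_div_gap (hγ : γ ∈ Ioo (0 : ℝ) 1) (hK : 0 < K) (r : ℝ) (j : ℕ) :
    (r + γ * supportPt γ K j) / gap γ K = scaledPt γ K r j := by
  have h : gap γ K ≠ 0 := (gap_pos hγ hK).ne'
  have h' : r / gap γ K = r * (K * (1 - γ)) := by simp [gap, div_eq_mul_inv]
  rw [add_div, h']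
  unfold scaledPt supportPt
  field_simp

lemma gVec_eq (hγ : γ ∈ Ioo (0 : ℝ) 1) (hK : 0 < K) (r : ℝ) (j : ℕ) (k : Fin K) :
    gVec γ K r j k = max (1 - |scaledPt γ K r j - k|) 0 := by
  have h : gap γ K ≠ 0 := (gap_pos hγ hK).ne'
  unfold gVec
  rw [sub_div, shift_div_gap hγ hK]
  unfold supportPt
  rw [mul_div_cancel_right₀ _ h]

lemma cumMat_mulVec_apply (f : ℕ → ℝ) (k : Fin K) :
    (cumMat K *ᵥ fun i => f i) k = ∑ i ∈ Finset.range (k + 1), f i := by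
  have : ∀ i : Fin K, cumMat K k i * f i = if (i : ℕ) < k + 1 then f i else 0 := by
    intro i
    simp only [cumMat, Matrix.of_apply, ite_mul, one_mul, zero_mul, Fin.le_def, Nat.lt_succ_iff]
  simp only [Matrix.mulVec, dotProduct, this]
  rw [Fin.sum_univ_eq_sum_range (fun i => if i < (k : ℕ) + 1 then f i else 0) K,
    ← Finset.sum_filter]
  congr 1
  ext i
  have := k.2
  simp only [Finset.mem_filter, Finset.mem_range]
  omega

lemma cumMat_mulVec_gVec (hγ : γ ∈ Ioo (0 : ℝ) 1) (hr : r ∈ Icc (0 : ℝ) 1) (j : ℕ) (k : Fin K) :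
    (cumMat K *ᵥ gVec γ K r j) k = projCdf γ K r j k := by
  have hK : 0 < K := k.pos
  have : gVec γ K r j = fun i : Fin K => max (1 - |scaledPt γ K r j - (i : ℕ)|) 0 := by
    ext i; exact gVec_eq hγ hK r j i
  rw [this, cumMat_mulVec_apply (fun i => max (1 - |scaledPt γ K r j - i|) 0) k,
    sum_hat _ (scaledPt_nonneg hγ hr j), projCdf]

lemma isUnit_det_cumMat (K : ℕ) : IsUnit (cumMat K).det := by
  have h : (cumMat K).det = 1 := by
    rw [Matrix.det_of_isLowerTriangular]
    · simp [cumMat]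
    · intro i j hij
      have : ¬ j ≤ i := not_le.mpr hij
      simp [cumMat, this]
  rw [h]; exact isUnit_one

lemma bellmanMat_mul_cumMat (hγ : γ ∈ Ioo (0 : ℝ) 1) (hr : r ∈ Icc (0 : ℝ) 1) :
    bellmanMat γ K r * cumMat K = cumMat K * gTilde γ K r := by
  ext k j
  have hR : (cumMat K * gTilde γ K r) k j = projCdf γ K r j k - projCdf γ K r K k := by
    rw [← cumMat_mulVec_gVec hγ hr, ← cumMat_mulVec_gVec hγ hr]
    simp [Matrix.mul_apply, Matrix.mulVec, dotProduct, gTilde, mul_sub]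
  rw [hR, Matrix.mul_apply]
  have : ∀ i : Fin K, bellmanMat γ K r k i * cumMat K i j
      = if (j : ℕ) ≤ i then projCdf γ K r i k - projCdf γ K r (i + 1) k else 0 := by
    intro i
    simp only [bellmanMat, cumMat, Matrix.of_apply, Fin.le_def, mul_ite, mul_one, mul_zero]
  simp only [this]
  rw [Fin.sum_univ_eq_sum_range
    (fun i => if (j : ℕ) ≤ i then projCdf γ K r i k - projCdf γ K r (i + 1) k else 0) K,
    ← Finset.sum_filter]
  have h2 : Finset.filter (fun i => (j : ℕ) ≤ i) (Finset.range K) = Finset.Ico (j : ℕ) K := by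
    ext i; simp only [Finset.mem_filter, Finset.mem_range, Finset.mem_Ico]; omega
  rw [h2, ← neg_inj, ← Finset.sum_neg_distrib, neg_sub]
  simp only [neg_sub]
  exact Finset.sum_Ico_sub (fun i => projCdf γ K r i k) j.2.le

lemma cumMat_mul_gTilde_mul_inv (hγ : γ ∈ Ioo (0 : ℝ) 1) (hr : r ∈ Icc (0 : ℝ) 1) :
    cumMat K * gTilde γ K r * (cumMat K)⁻¹ = bellmanMat γ K r := by
  rw [← bellmanMat_mul_cumMat hγ hr, Matrix.mul_nonsing_inv_cancel_right _ _ (isUnit_det_cumMat K)]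

lemma bellmanMat_nonneg (hγ : γ ∈ Ioo (0 : ℝ) 1) (r : ℝ) (k j : Fin K) :
    0 ≤ bellmanMat γ K r k j := by
  simp only [bellmanMat, Matrix.of_apply, sub_nonneg, projCdf]
  apply ramp_mono
  rw [scaledPt_succ]
  linarith [hγ.1]

lemma sum_row_bellmanMat_le (γ : ℝ) (r : ℝ) (k : Fin K) : ∑ j, bellmanMat γ K r k j ≤ 1 := by
  simp only [bellmanMat, Matrix.of_apply]
  rw [Fin.sum_univ_eq_sum_range (fun j => projCdf γ K r j k - projCdf γ K r (j + 1) k) K,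
    Finset.sum_range_sub']
  have h1 := ramp_le_one (k + 1 - scaledPt γ K r 0)
  have h2 := ramp_nonneg (k + 1 - scaledPt γ K r K)
  simp only [projCdf]
  linarith

lemma sum_projCdf (hγ : γ ∈ Ioo (0 : ℝ) 1) (hr : r ∈ Icc (0 : ℝ) 1) {j : ℕ} (hj : j ≤ K) :
    ∑ k : Fin K, projCdf γ K r j k = K - scaledPt γ K r j := by
  rw [Fin.sum_univ_eq_sum_range (fun k => projCdf γ K r j k) K]
  simp only [projCdf]
  rw [sum_ramp_add _ (scaledPt_nonneg hγ hr j), max_eq_right]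
  linarith [scaledPt_le hγ hr hj]

lemma sum_col_bellmanMat (hγ : γ ∈ Ioo (0 : ℝ) 1) (hr : r ∈ Icc (0 : ℝ) 1) (j : Fin K) :
    ∑ k, bellmanMat γ K r k j = γ := by
  simp only [bellmanMat, Matrix.of_apply]
  rw [Finset.sum_sub_distrib, sum_projCdf hγ hr j.2.le, sum_projCdf hγ hr (Nat.succ_le_of_lt j.2),
    scaledPt_succ]
  ring

/-- The Bellman backup contracts the Cramér distance by `√γ`, in coordinates: Schur's test for a
nonnegative matrix with row sums at most `1` and column sums `γ`. -/
lemma sum_sq_bellmanMat_mulVec_le (hγ : γ ∈ Ioo (0 : ℝ) 1) (hr : r ∈ Icc (0 : ℝ) 1)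
    (u : Fin K → ℝ) : ∑ k, ((bellmanMat γ K r *ᵥ u) k) ^ 2 ≤ γ * ∑ k, u k ^ 2 := by
  have h1 : ∀ k, ((bellmanMat γ K r *ᵥ u) k) ^ 2 ≤ ∑ j, bellmanMat γ K r k j * u j ^ 2 := by
    intro k
    have hcs := Finset.sum_sq_le_sum_mul_sum_of_sq_le_mul Finset.univ
      (r := fun j => bellmanMat γ K r k j * u j) (f := fun j => bellmanMat γ K r k j)
      (g := fun j => bellmanMat γ K r k j * u j ^ 2)
      (fun j _ => bellmanMat_nonneg hγ r k j)
      (fun j _ => mul_nonneg (bellmanMat_nonneg hγ r k j) (sq_nonneg _))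
      (fun j _ => by apply le_of_eq; ring)
    have hs : 0 ≤ ∑ j, bellmanMat γ K r k j * u j ^ 2 :=
      Finset.sum_nonneg fun j _ => mul_nonneg (bellmanMat_nonneg hγ r k j) (sq_nonneg _)
    calc ((bellmanMat γ K r *ᵥ u) k) ^ 2 = (∑ j, bellmanMat γ K r k j * u j) ^ 2 := by
          simp [Matrix.mulVec, dotProduct]
      _ ≤ _ := hcs
      _ ≤ 1 * ∑ j, bellmanMat γ K r k j * u j ^ 2 := by
          gcongr; exact sum_row_bellmanMat_le γ r k
      _ = _ := one_mul _
  calc ∑ k, ((bellmanMat γ K r *ᵥ u) k) ^ 2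
      ≤ ∑ k, ∑ j, bellmanMat γ K r k j * u j ^ 2 := Finset.sum_le_sum fun k _ => h1 k
    _ = ∑ j, (∑ k, bellmanMat γ K r k j) * u j ^ 2 := by
        rw [Finset.sum_comm]; simp only [Finset.sum_mul]
    _ = γ * ∑ k, u k ^ 2 := by
        simp only [sum_col_bellmanMat hγ hr, Finset.mul_sum]

/-- The Bellman backup moves the uniform distribution by `O(1 - γ)` only, uniformly in `K`: each
shifted point `γ j + r K (1 - γ)` is within `K (1 - γ)` of `j`. -/
lemma abs_bellmanOffset_le (hγ : γ ∈ Ioo (0 : ℝ) 1) (hr : r ∈ Icc (0 : ℝ) 1) (k : Fin K) :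
    |bellmanOffset γ K r k| ≤ 1 - γ := by
  have hγ0 := hγ.1
  have h1γ : 0 < 1 - γ := by linarith [hγ.2]
  have hk : ((k : ℕ) : ℝ) + 1 ≤ K := by exact_mod_cast k.2
  have hk0 : (0 : ℝ) ≤ (k : ℕ) := Nat.cast_nonneg _
  set D : ℝ := K * (1 - γ) with hD
  have hD0 : 0 ≤ D := by positivity
  have hrD : r * D ≤ 1 * D := by gcongr; exact hr.2
  have hrD0 : 0 ≤ r * D := mul_nonneg hr.1 hD0
  have hup : ∑ j ∈ Finset.range (K + 1), projCdf γ K r j k ≤ (k + 1) + D := by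
    calc ∑ j ∈ Finset.range (K + 1), projCdf γ K r j k
        ≤ ∑ j ∈ Finset.range (K + 1), ramp ((k + 1 + D) - j) := by
          refine Finset.sum_le_sum fun j hj => ramp_mono ?_
          have hjK : (j : ℝ) ≤ K := by
            exact_mod_cast Nat.lt_succ_iff.mp (Finset.mem_range.mp hj)
          have : (1 - γ) * j ≤ (1 - γ) * K := by gcongr
          simp only [scaledPt]
          rw [← hD]
          linarith
      _ = max 0 (min ((K + 1 : ℕ) : ℝ) (k + 1 + D)) := sum_ramp_sub _ _
      _ ≤ _ := max_le (by positivity) (min_le_right _ _)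
  have hlo : (k + 1) - D ≤ ∑ j ∈ Finset.range (K + 1), projCdf γ K r j k := by
    calc (k + 1 : ℝ) - D ≤ max 0 (min ((K + 1 : ℕ) : ℝ) (k + 1 - D)) := by
          refine le_max_of_le_right (le_min ?_ le_rfl)
          push_cast; linarith
      _ = ∑ j ∈ Finset.range (K + 1), ramp ((k + 1 - D) - j) := (sum_ramp_sub _ _).symm
      _ ≤ _ := by
          refine Finset.sum_le_sum fun j _ => ramp_mono ?_
          have : γ * j ≤ 1 * j := by gcongr; exact hγ.2.le
          simp only [scaledPt]
          rw [← hD]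
          linarith
  have habs : |∑ j ∈ Finset.range (K + 1), projCdf γ K r j k - (k + 1)| ≤ D :=
    abs_le.mpr ⟨by linarith, by linarith⟩
  unfold bellmanOffset
  rw [abs_mul, abs_of_nonneg (by positivity), inv_mul_le_iff₀ (by positivity)]
  refine habs.trans ?_
  rw [hD]
  nlinarith

/-! ### The temporal-difference residual -/

variable {S A : Type*} {d : ℕ}

/-- The vector `φ(s)ᵀΘ - φ(s')ᵀΘ W(r)ᵀ - b(r)`: the CDF vector predicted at `s` minus the CDF
vector of the projected one-sample Bellman target `(r, s')`. -/
def residual (γ : ℝ) (φ : S → EuclideanSpace ℝ (Fin d)) (s : S) (y : ℝ × S)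
    (Θ : Matrix (Fin d) (Fin K) ℝ) : Fin K → ℝ :=
  (φ s).ofLp ᵥ* Θ - bellmanMat γ K y.1 *ᵥ ((φ y.2).ofLp ᵥ* Θ) - bellmanOffset γ K y.1

lemma update_eq (hγ : γ ∈ Ioo (0 : ℝ) 1) (α : ℝ) (φ : S → EuclideanSpace ℝ (Fin d))
    (x : (S × A) × (ℝ × S)) (hx : x.2.1 ∈ Icc (0 : ℝ) 1) (Θ : Matrix (Fin d) (Fin K) ℝ) :
    update γ α φ x Θ
      = Θ - α • Matrix.vecMulVec (φ x.1.1).ofLp (residual γ φ x.1.1 x.2 Θ) := by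
  unfold update residual
  congr 4
  · rw [cumMat_mul_gTilde_mul_inv hγ hx, ← Matrix.vecMul_vecMul, Matrix.vecMul_transpose]
  · ext k
    rw [Matrix.vecMul_transpose, Matrix.mulVec_sub, Matrix.mulVec_sum]
    simp only [Pi.smul_apply, Pi.sub_apply, Finset.sum_apply, cumMat_mulVec_gVec hγ hx,
      smul_eq_mul, bellmanOffset]
    congr 2
    have := cumMat_mulVec_apply (K := K) (fun _ => (1 : ℝ)) k
    simpa [Pi.one_def] using this

lemma residual_add (γ : ℝ) (φ : S → EuclideanSpace ℝ (Fin d)) (s : S) (y : ℝ × S)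
    (Θ Δ : Matrix (Fin d) (Fin K) ℝ) :
    residual γ φ s y (Θ + Δ) = residual γ φ s y Θ
      + ((φ s).ofLp ᵥ* Δ - bellmanMat γ K y.1 *ᵥ ((φ y.2).ofLp ᵥ* Δ)) := by
  unfold residual
  rw [Matrix.vecMul_add, Matrix.vecMul_add, Matrix.mulVec_add]
  abel

/-! ### Recursions driven by independent samples -/

lemma integral_linear_comb {X : Type*} [MeasurableSpace X] {ν : Measure X} {f g k : X → ℝ}
    (hf : Integrable f ν) (hg : Integrable g ν) (hk : Integrable k ν) (b c : ℝ) :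
    ∫ x, (f x + b * g x + c * k x) ∂ν = ∫ x, f x ∂ν + b * ∫ x, g x ∂ν + c * ∫ x, k x ∂ν := by
  have h1 : Integrable (fun x => f x + b * g x) ν := hf.add (hg.const_mul b)
  rw [integral_add h1 (hk.const_mul c), integral_add hf (hg.const_mul b), integral_const_mul,
    integral_const_mul]

section Independence

variable {Ω X Z : Type*} [MeasurableSpace Ω] [MeasurableSpace X] [MeasurableSpace Z]
  {ρ : Measure Ω} {ν : Measure X} {ξ : ℕ → Ω → X}

lemma integral_comp_of_indepFun [IsProbabilityMeasure ρ] [IsProbabilityMeasure ν]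
    {z : Ω → Z} {ζ : Ω → X} (hz : AEMeasurable z ρ) (hζ : HasLaw ζ ν ρ) (hind : IndepFun z ζ ρ)
    {f : Z × X → ℝ} (hf : Measurable f) (hint : Integrable (fun ω => f (z ω, ζ ω)) ρ) :
    ∫ ω, f (z ω, ζ ω) ∂ρ = ∫ ω, ∫ x, f (z ω, x) ∂ν ∂ρ := by
  have hpair : AEMeasurable (fun ω => (z ω, ζ ω)) ρ := hz.prodMk hζ.aemeasurable
  have hmap := (indepFun_iff_map_prod_eq_prod_map_map hz hζ.aemeasurable).1 hind
  rw [hζ.map_eq] at hmap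
  have : IsProbabilityMeasure (ρ.map z) := Measure.isProbabilityMeasure_map hz
  have hi : Integrable f ((ρ.map z).prod ν) := by
    rw [← hmap]
    exact (integrable_map_measure hf.aestronglyMeasurable hpair).2 hint
  rw [← integral_map hpair hf.aestronglyMeasurable (f := f), hmap, integral_prod _ hi,
    integral_map hz]
  exact hf.stronglyMeasurable.integral_prod_right'.aestronglyMeasurable

omit [MeasurableSpace Ω] in
lemma exists_measurable_of_recursion {z : ℕ → Ω → Z} {step : ℕ → Z → X → Z} {z₀ : Z}
    (hstep : ∀ t, Measurable (Function.uncurry (step t))) (h0 : ∀ ω, z 0 ω = z₀)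
    (hz : ∀ t ω, z (t + 1) ω = step t (z t ω) (ξ t ω)) (t : ℕ) :
    ∃ g : (Finset.range t → X) → Z, Measurable g ∧ ∀ ω, z t ω = g fun i => ξ i ω := by
  induction t with
  | zero => exact ⟨fun _ => z₀, measurable_const, h0⟩
  | succ t ih =>
    obtain ⟨g, hg, hgz⟩ := ih
    refine ⟨fun p => step t
      (g fun i => p ⟨i, Finset.mem_range.2 ((Finset.mem_range.1 i.2).trans t.lt_succ_self)⟩)
      (p ⟨t, Finset.self_mem_range_succ t⟩), ?_, ?_⟩
    · refine (hstep t).comp (Measurable.prodMk (hg.comp ?_) (measurable_pi_apply _))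
      exact measurable_pi_lambda _ fun i => measurable_pi_apply _
    · intro ω
      rw [hz, hgz]

/-- The state of a recursion driven by independent samples is independent of the next sample. -/
lemma aemeasurable_and_indepFun_of_recursion {z : ℕ → Ω → Z} {step : ℕ → Z → X → Z} {z₀ : Z}
    (hstep : ∀ t, Measurable (Function.uncurry (step t))) (h0 : ∀ ω, z 0 ω = z₀)
    (hz : ∀ t ω, z (t + 1) ω = step t (z t ω) (ξ t ω))
    (hξ : ∀ t, AEMeasurable (ξ t) ρ) (hind : iIndepFun ξ ρ) (t : ℕ) :
    AEMeasurable (z t) ρ ∧ IndepFun (z t) (ξ t) ρ := by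
  obtain ⟨g, hg, hgz⟩ := exists_measurable_of_recursion (ξ := ξ) hstep h0 hz t
  have hzt : z t = g ∘ fun ω (i : Finset.range t) => ξ i ω := funext hgz
  constructor
  · rw [hzt]
    exact hg.comp_aemeasurable (aemeasurable_pi_lambda _ fun i => hξ i)
  · have hd : Disjoint (Finset.range t) {t} := by simp
    have h1 := (hind.indepFun_finset₀ (Finset.range t) {t} hd hξ).comp hg
      (measurable_pi_apply (⟨t, Finset.mem_singleton_self t⟩ : ({t} : Finset ℕ)))
    rw [hzt]
    exact h1

end Independence

/-! ### Constant step size stochastic approximation with tail averaging -/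

section StochasticApproximation

variable {E : Type*} [NormedAddCommGroup E] [InnerProductSpace ℝ E] [FiniteDimensional ℝ E]
  [MeasurableSpace E] [BorelSpace E]
variable {Ω X : Type*} [MeasurableSpace Ω] [MeasurableSpace X]

/-- A random affine field `h(x, ·)` on `E`, with `x` drawn from `ν`, whose mean field is linear
(`mean`) and `a`-monotone for the quadratic form `q`, and whose second moment is controlled by `q`
and by the noise level `σ2` at the origin. -/
structure NoisyField (ν : Measure X) (h : X → E → E) (mean : E →ₗ[ℝ] E) (q : E → ℝ)
    (a lam σ2 : ℝ) : Prop where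
  meas : Measurable (Function.uncurry h)
  bound : ∃ L : ℝ, ∀ x θ, ‖h x θ‖ ≤ L * (‖θ‖ + 1)
  mean_eq : ∀ θ, ∫ x, h x θ ∂ν = mean θ
  continuous_q : Continuous q
  q_le : ∀ θ, q θ ≤ ‖θ‖ ^ 2
  le_q : ∀ θ, lam * ‖θ‖ ^ 2 ≤ q θ
  drift : ∀ θ, a * q θ ≤ ∫ x, inner ℝ θ (h x θ) ∂ν
  second_moment : ∀ θ, ∫ x, ‖h x θ‖ ^ 2 ∂ν ≤ 8 * q θ + 2 * σ2

/-- The iterates `θ_{t+1} = θ_t - α h(x_t, θ_t)`. -/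
def saIterate (h : X → E → E) (α : ℝ) (θ₀ : E) (x : ℕ → X) : ℕ → E
  | 0 => θ₀
  | t + 1 => saIterate h α θ₀ x t - α • h (x t) (saIterate h α θ₀ x t)

/-- The accumulated noise `∑_{n₀ ≤ i < t} (h(x_i, θ_i) - mean(θ_i))` along the iterates. -/
def saNoise (h : X → E → E) (mean : E →ₗ[ℝ] E) (α : ℝ) (θ₀ : E) (x : ℕ → X) (n₀ t : ℕ) : E :=
  ∑ i ∈ Finset.Ico n₀ t, (h (x i) (saIterate h α θ₀ x i) - mean (saIterate h α θ₀ x i))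

variable {ν : Measure X} {h : X → E → E} {mean : E →ₗ[ℝ] E} {q : E → ℝ} {a lam σ2 : ℝ}

omit [FiniteDimensional ℝ E] [BorelSpace E] in
lemma NoisyField.exists_bound (H : NoisyField ν h mean q a lam σ2) :
    ∃ L : ℝ, 0 ≤ L ∧ ∀ x θ, ‖h x θ‖ ≤ L * (‖θ‖ + 1) := by
  obtain ⟨L, hL⟩ := H.bound
  refine ⟨|L|, abs_nonneg L, fun x θ => (hL x θ).trans ?_⟩
  have : 0 ≤ ‖θ‖ + 1 := by positivity
  gcongr
  exact le_abs_self L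

omit [FiniteDimensional ℝ E] [BorelSpace E] in
lemma NoisyField.measurable_right (H : NoisyField ν h mean q a lam σ2) (θ : E) :
    Measurable fun x => h x θ :=
  H.meas.comp (measurable_id.prodMk measurable_const)

lemma NoisyField.integrable_comp [IsProbabilityMeasure ν] (H : NoisyField ν h mean q a lam σ2)
    (θ : E) {F : Type*} [NormedAddCommGroup F] [SecondCountableTopology F]
    {g : E → F} (hg : Continuous g) : Integrable (fun x => g (h x θ)) ν := by
  obtain ⟨L, -, hL⟩ := H.exists_bound
  obtain ⟨C, hC⟩ := (isCompact_closedBall (0 : E) (L * (‖θ‖ + 1))).exists_bound_of_continuousOn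
    hg.continuousOn
  refine Integrable.of_bound (hg.comp_aestronglyMeasurable
    (H.measurable_right θ).aestronglyMeasurable) C (Filter.Eventually.of_forall fun x => ?_)
  exact hC _ (by simpa using hL x θ)

/-- One step decreases the conditional second moment, since the quadratic term `8 α² q` is at most
half of the drift `2 α a q`. -/
lemma NoisyField.integral_step_le [IsProbabilityMeasure ν] (H : NoisyField ν h mean q a lam σ2)
    {α : ℝ} (hα : 0 ≤ α) (haα : 8 * α ≤ a) (hlam : 0 ≤ lam) (θ : E) :
    ∫ x, ‖θ - α • h x θ‖ ^ 2 ∂ν ≤ ‖θ‖ ^ 2 - α * a * q θ + 2 * α ^ 2 * σ2 := by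
  have hq : 0 ≤ q θ := le_trans (by positivity) (H.le_q θ)
  have i1 : Integrable (fun x => inner ℝ θ (h x θ)) ν :=
    H.integrable_comp θ (g := fun y => inner ℝ θ y) (by fun_prop)
  have i2 : Integrable (fun x => ‖h x θ‖ ^ 2) ν :=
    H.integrable_comp θ (g := fun y => ‖y‖ ^ 2) (by fun_prop)
  have he : ∀ x, ‖θ - α • h x θ‖ ^ 2
      = ‖θ‖ ^ 2 + -(2 * α) * inner ℝ θ (h x θ) + α ^ 2 * ‖h x θ‖ ^ 2 := by
    intro x
    rw [norm_sub_sq_real, inner_smul_right, norm_smul, mul_pow, Real.norm_eq_abs, sq_abs]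
    ring
  simp only [he]
  rw [integral_linear_comb (integrable_const _) i1 i2]
  simp only [integral_const, probReal_univ, one_smul]
  have h1 := H.drift θ
  have h2 := H.second_moment θ
  have h3 : α ^ 2 * ∫ x, ‖h x θ‖ ^ 2 ∂ν ≤ α ^ 2 * (8 * q θ + 2 * σ2) := by gcongr
  have h4 : 2 * α * (a * q θ) ≤ 2 * α * ∫ x, inner ℝ θ (h x θ) ∂ν := by gcongr
  have h5 : α * (8 * α) * q θ ≤ α * a * q θ := by gcongr
  linarith

/-- One step of the accumulated noise: the increment has conditional mean zero, and its variance is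
at most the second moment of the field. -/
lemma NoisyField.integral_noise_le [IsProbabilityMeasure ν] (H : NoisyField ν h mean q a lam σ2)
    (θ s : E) :
    ∫ x, ‖s + (h x θ - mean θ)‖ ^ 2 ∂ν ≤ ‖s‖ ^ 2 + (8 * q θ + 2 * σ2) := by
  have i0 : Integrable (fun x => h x θ) ν := H.integrable_comp θ (g := fun y => y) (by fun_prop)
  have i1 : ∀ v : E, Integrable (fun x => inner ℝ v (h x θ)) ν := fun v =>
    H.integrable_comp θ (g := fun y => inner ℝ v y) (by fun_prop)
  have i2 : Integrable (fun x => ‖h x θ‖ ^ 2) ν :=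
    H.integrable_comp θ (g := fun y => ‖y‖ ^ 2) (by fun_prop)
  have he : ∀ x, ‖s + (h x θ - mean θ)‖ ^ 2
      = ‖s - mean θ‖ ^ 2 + 2 * inner ℝ (s - mean θ) (h x θ) + 1 * ‖h x θ‖ ^ 2 := by
    intro x
    rw [show s + (h x θ - mean θ) = (s - mean θ) + h x θ by abel, norm_add_sq_real, one_mul]
  simp only [he]
  rw [integral_linear_comb (integrable_const _) (i1 _) i2, integral_inner i0, H.mean_eq]
  simp only [integral_const, probReal_univ, one_smul]
  have h1 : ‖s - mean θ‖ ^ 2 + 2 * inner ℝ (s - mean θ) (mean θ) = ‖s‖ ^ 2 - ‖mean θ‖ ^ 2 := by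
    rw [norm_sub_sq_real, inner_sub_left, real_inner_self_eq_norm_sq]; ring
  have := H.second_moment θ
  nlinarith [sq_nonneg ‖mean θ‖]

/-- Monotonicity of the mean field makes it invertible in the norm induced by `q`. -/
lemma NoisyField.q_le_norm_mean [IsProbabilityMeasure ν] (H : NoisyField ν h mean q a lam σ2)
    (ha : 0 < a) (hlam : 0 < lam) (θ : E) : a ^ 2 * lam * q θ ≤ ‖mean θ‖ ^ 2 := by
  have i0 : Integrable (fun x => h x θ) ν := H.integrable_comp θ (g := fun y => y) (by fun_prop)
  have hq : 0 ≤ q θ := le_trans (by positivity) (H.le_q θ)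
  have h1 : a * q θ ≤ ‖θ‖ * ‖mean θ‖ := by
    have := H.drift θ
    rw [integral_inner i0, H.mean_eq] at this
    exact this.trans (real_inner_le_norm _ _)
  have h2 := H.le_q θ
  rcases hq.eq_or_lt with h0 | h0
  · rw [← h0]; simp only [mul_zero]; positivity
  · have h3 : (a * q θ) ^ 2 ≤ (‖θ‖ * ‖mean θ‖) ^ 2 := by gcongr
    have h4 : lam * (‖θ‖ * ‖mean θ‖) ^ 2 ≤ q θ * ‖mean θ‖ ^ 2 := by
      rw [mul_pow, ← mul_assoc]; gcongr
    have h5 : q θ * (a ^ 2 * lam * q θ) ≤ q θ * ‖mean θ‖ ^ 2 := by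
      calc q θ * (a ^ 2 * lam * q θ) = lam * (a * q θ) ^ 2 := by ring
        _ ≤ lam * (‖θ‖ * ‖mean θ‖) ^ 2 := by gcongr
        _ ≤ _ := h4
    exact le_of_mul_le_mul_left h5 h0

omit [FiniteDimensional ℝ E] [MeasurableSpace E] [BorelSpace E] [MeasurableSpace X] in
/-- The telescoped recursion over the window `[m, n)`. -/
lemma smul_sum_mean_saIterate (h : X → E → E) (mean : E →ₗ[ℝ] E) (α : ℝ) (θ₀ : E) (x : ℕ → X)
    {m n : ℕ} (hmn : m ≤ n) :
    α • mean (∑ t ∈ Finset.Ico m n, saIterate h α θ₀ x t)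
      = saIterate h α θ₀ x m - saIterate h α θ₀ x n - α • saNoise h mean α θ₀ x m n := by
  induction n, hmn using Nat.le_induction with
  | base => simp [saNoise]
  | succ n hmn ih =>
    have hn : saNoise h mean α θ₀ x m (n + 1) = saNoise h mean α θ₀ x m n
        + (h (x n) (saIterate h α θ₀ x n) - mean (saIterate h α θ₀ x n)) := by
      simp only [saNoise, Finset.sum_Ico_succ_top hmn]
    rw [Finset.sum_Ico_succ_top hmn, map_add, smul_add, ih, hn, saIterate]
    simp only [smul_add, smul_sub]
    abel

lemma NoisyField.saIterate_bound (H : NoisyField ν h mean q a lam σ2) (α : ℝ) (θ₀ : E) (t : ℕ) :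
    ∃ C : ℝ, ∀ x : ℕ → X, ‖saIterate h α θ₀ x t‖ ≤ C := by
  obtain ⟨L, hL0, hL⟩ := H.exists_bound
  induction t with
  | zero => exact ⟨‖θ₀‖, fun _ => le_rfl⟩
  | succ t ih =>
    obtain ⟨C, hC⟩ := ih
    refine ⟨C + |α| * (L * (C + 1)), fun x => ?_⟩
    calc ‖saIterate h α θ₀ x (t + 1)‖
        ≤ ‖saIterate h α θ₀ x t‖ + |α| * ‖h (x t) (saIterate h α θ₀ x t)‖ := by
          rw [saIterate]
          refine (norm_sub_le _ _).trans ?_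
          rw [norm_smul, Real.norm_eq_abs]
      _ ≤ _ := by
          have h1 := hC x
          have h2 := hL (x t) (saIterate h α θ₀ x t)
          gcongr
          exact h2.trans (by gcongr)

lemma NoisyField.saNoise_bound (H : NoisyField ν h mean q a lam σ2) (α : ℝ) (θ₀ : E) (m t : ℕ) :
    ∃ C : ℝ, ∀ x : ℕ → X, ‖saNoise h mean α θ₀ x m t‖ ≤ C := by
  obtain ⟨L, hL0, hL⟩ := H.exists_bound
  choose C hC using H.saIterate_bound α θ₀
  have hmean : ∀ θ, ‖mean θ‖ ≤ ‖LinearMap.toContinuousLinearMap mean‖ * ‖θ‖ := fun θ =>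
    (LinearMap.toContinuousLinearMap mean).le_opNorm θ
  refine ⟨∑ i ∈ Finset.Ico m t,
    (L * (C i + 1) + ‖LinearMap.toContinuousLinearMap mean‖ * C i), fun x => ?_⟩
  refine (norm_sum_le _ _).trans (Finset.sum_le_sum fun i _ => (norm_sub_le _ _).trans ?_)
  refine add_le_add ((hL _ _).trans ?_) ((hmean _).trans ?_)
  · gcongr; exact hC i x
  · gcongr; exact hC i x

variable {ρ : Measure Ω} {ξ : ℕ → Ω → X}

/-- The pair (iterate, accumulated noise) at time `t` depends on the samples before time `t`
only, hence is independent of the sample at time `t`. -/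
lemma NoisyField.aemeasurable_and_indepFun (H : NoisyField ν h mean q a lam σ2) (α : ℝ) (θ₀ : E)
    (m : ℕ) (hξ : ∀ t, HasLaw (ξ t) ν ρ) (hind : iIndepFun ξ ρ) (t : ℕ) :
    AEMeasurable (fun ω => (saIterate h α θ₀ (fun i => ξ i ω) t,
        saNoise h mean α θ₀ (fun i => ξ i ω) m t)) ρ ∧
      IndepFun (fun ω => (saIterate h α θ₀ (fun i => ξ i ω) t,
        saNoise h mean α θ₀ (fun i => ξ i ω) m t)) (ξ t) ρ := by
  have hmean : Measurable mean := mean.continuous_of_finiteDimensional.measurable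
  refine aemeasurable_and_indepFun_of_recursion
    (z := fun t ω => (saIterate h α θ₀ (fun i => ξ i ω) t,
        saNoise h mean α θ₀ (fun i => ξ i ω) m t))
    (step := fun t z x => (z.1 - α • h x z.1,
      z.2 + if m ≤ t then h x z.1 - mean z.1 else 0)) (z₀ := (θ₀, 0)) ?_ ?_ ?_
    (fun t => (hξ t).aemeasurable) hind t
  · intro t
    have h1 : Measurable fun p : (E × E) × X => h p.2 p.1.1 :=
      H.meas.comp (measurable_snd.prodMk (measurable_fst.comp measurable_fst))
    have h2 : Measurable fun p : (E × E) × X => p.1.1 := measurable_fst.comp measurable_fst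
    have h3 : Measurable fun p : (E × E) × X => p.1.2 := measurable_snd.comp measurable_fst
    refine Measurable.prodMk (h2.sub (h1.const_smul α)) (h3.add ?_)
    split_ifs
    · exact h1.sub (hmean.comp h2)
    · exact measurable_const
  · intro ω; simp [saIterate, saNoise]
  · intro t ω
    refine Prod.ext rfl ?_
    simp only [saNoise]
    split_ifs with hm
    · rw [Finset.sum_Ico_succ_top hm]
    · rw [Finset.Ico_eq_empty (by omega), Finset.Ico_eq_empty (by omega)]; simp

lemma NoisyField.integrable_iterate [IsProbabilityMeasure ρ] (H : NoisyField ν h mean q a lam σ2)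
    (α : ℝ) (θ₀ : E) (m : ℕ) (hξ : ∀ t, HasLaw (ξ t) ν ρ) (hind : iIndepFun ξ ρ) (t : ℕ)
    {g : E × E → ℝ} (hg : Continuous g) :
    Integrable (fun ω => g (saIterate h α θ₀ (fun i => ξ i ω) t,
        saNoise h mean α θ₀ (fun i => ξ i ω) m t)) ρ := by
  obtain ⟨C₁, hC₁⟩ := H.saIterate_bound α θ₀ t
  obtain ⟨C₂, hC₂⟩ := H.saNoise_bound α θ₀ m t
  obtain ⟨C, hC⟩ := ((isCompact_closedBall (0 : E) C₁).prod
    (isCompact_closedBall (0 : E) C₂)).exists_bound_of_continuousOn hg.continuousOn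
  refine Integrable.of_bound (hg.measurable.comp_aemeasurable
    (H.aemeasurable_and_indepFun α θ₀ m hξ hind t).1).aestronglyMeasurable C
    (Filter.Eventually.of_forall fun ω => hC _ ?_)
  exact ⟨by simpa using hC₁ _, by simpa using hC₂ _⟩

lemma NoisyField.integrable_q_average [IsProbabilityMeasure ρ]
    (H : NoisyField ν h mean q a lam σ2) (α : ℝ) (θ₀ : E) (hξ : ∀ t, HasLaw (ξ t) ν ρ)
    (hind : iIndepFun ξ ρ) (s : Finset ℕ) (c : ℝ) :
    Integrable (fun ω => q (c • ∑ t ∈ s, saIterate h α θ₀ (fun i => ξ i ω) t)) ρ := by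
  choose C hC using H.saIterate_bound α θ₀
  obtain ⟨M, hM⟩ := (isCompact_closedBall (0 : E) (|c| * ∑ t ∈ s, C t)).exists_bound_of_continuousOn
    H.continuous_q.continuousOn
  have hm : AEMeasurable (fun ω => c • ∑ t ∈ s, saIterate h α θ₀ (fun i => ξ i ω) t) ρ :=
    (Finset.aemeasurable_fun_sum s fun t _ =>
      (H.aemeasurable_and_indepFun α θ₀ 0 hξ hind t).1.fst).const_smul c
  refine Integrable.of_bound (H.continuous_q.measurable.comp_aemeasurable hm).aestronglyMeasurable M
    (Filter.Eventually.of_forall fun ω => hM _ ?_)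
  rw [mem_closedBall_zero_iff, norm_smul, Real.norm_eq_abs]
  gcongr
  exact (norm_sum_le _ _).trans (Finset.sum_le_sum fun t _ => hC t _)

/-- Conditioning on the past: a bound on the conditional expectation of a function of the next
state of the recursion integrates to a bound on its expectation. -/
lemma NoisyField.integral_succ_le [IsProbabilityMeasure ν] [IsProbabilityMeasure ρ]
    (H : NoisyField ν h mean q a lam σ2)
    (α : ℝ) (θ₀ : E) (m : ℕ) (hξ : ∀ t, HasLaw (ξ t) ν ρ) (hind : iIndepFun ξ ρ) (t : ℕ)
    {f : (E × E) × X → ℝ} (hf : Measurable f) (hint : Integrable (fun ω =>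
      f ((saIterate h α θ₀ (fun i => ξ i ω) t, saNoise h mean α θ₀ (fun i => ξ i ω) m t), ξ t ω)) ρ)
    (hf0 : ∀ z x, 0 ≤ f (z, x))
    {g : E × E → ℝ} (hg : Continuous g) (hfg : ∀ z, ∫ x, f (z, x) ∂ν ≤ g z) :
    ∫ ω, f ((saIterate h α θ₀ (fun i => ξ i ω) t,
        saNoise h mean α θ₀ (fun i => ξ i ω) m t), ξ t ω) ∂ρ
      ≤ ∫ ω, g (saIterate h α θ₀ (fun i => ξ i ω) t,
        saNoise h mean α θ₀ (fun i => ξ i ω) m t) ∂ρ := by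
  obtain ⟨h1, h2⟩ := H.aemeasurable_and_indepFun α θ₀ m hξ hind t
  rw [integral_comp_of_indepFun h1 (hξ t) h2 hf hint]
  exact integral_mono_of_nonneg (Filter.Eventually.of_forall fun ω => integral_nonneg (hf0 _))
    (H.integrable_iterate α θ₀ m hξ hind t hg) (Filter.Eventually.of_forall fun ω => hfg _)

section Moments

variable [IsProbabilityMeasure ν] [IsProbabilityMeasure ρ]
  (H : NoisyField ν h mean q a lam σ2) {α : ℝ} (θ₀ : E)
  (hξ : ∀ t, HasLaw (ξ t) ν ρ) (hind : iIndepFun ξ ρ)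
include H hξ hind

lemma NoisyField.integral_norm_sq_succ_le (hα : 0 ≤ α) (haα : 8 * α ≤ a) (hlam : 0 ≤ lam)
    (t : ℕ) :
    ∫ ω, ‖saIterate h α θ₀ (fun i => ξ i ω) (t + 1)‖ ^ 2 ∂ρ
      ≤ ∫ ω, ‖saIterate h α θ₀ (fun i => ξ i ω) t‖ ^ 2 ∂ρ
        - α * a * ∫ ω, q (saIterate h α θ₀ (fun i => ξ i ω) t) ∂ρ + 2 * α ^ 2 * σ2 := by
  have hq := H.continuous_q
  have hm : Measurable fun p : (E × E) × X => h p.2 p.1.1 :=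
    H.meas.comp (measurable_snd.prodMk (measurable_fst.comp measurable_fst))
  have key := H.integral_succ_le α θ₀ 0 hξ hind t
    (f := fun p => ‖p.1.1 - α • h p.2 p.1.1‖ ^ 2)
    (((measurable_fst.comp measurable_fst).sub (hm.const_smul α)).norm.pow_const 2)
    (H.integrable_iterate α θ₀ 0 hξ hind (t + 1) (g := fun z => ‖z.1‖ ^ 2) (by fun_prop))
    (fun _ _ => by positivity)
    (g := fun z => ‖z.1‖ ^ 2 + -(α * a) * q z.1 + (2 * α ^ 2) * σ2) (by fun_prop)
    (fun z => (H.integral_step_le hα haα hlam z.1).trans (by linarith))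
  have i1 := H.integrable_iterate α θ₀ 0 hξ hind t (g := fun z => ‖z.1‖ ^ 2) (by fun_prop)
  have i2 := H.integrable_iterate α θ₀ 0 hξ hind t (g := fun z => q z.1) (by fun_prop)
  refine key.trans (le_of_eq ?_)
  rw [integral_linear_comb i1 i2 (integrable_const σ2)]
  simp only [integral_const, probReal_univ, one_smul]
  ring

/-- Orthogonality of martingale differences. -/
lemma NoisyField.integral_noise_sq_le (m n : ℕ) (hmn : m ≤ n) :
    ∫ ω, ‖saNoise h mean α θ₀ (fun i => ξ i ω) m n‖ ^ 2 ∂ρ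
      ≤ 8 * ∑ t ∈ Finset.Ico m n, ∫ ω, q (saIterate h α θ₀ (fun i => ξ i ω) t) ∂ρ
        + 2 * (n - m : ℝ) * σ2 := by
  induction n, hmn using Nat.le_induction with
  | base => simp [saNoise]
  | succ t hmt ih =>
    have hq := H.continuous_q
    have hmean : Measurable mean := mean.continuous_of_finiteDimensional.measurable
    have hm : Measurable fun p : (E × E) × X => h p.2 p.1.1 :=
      H.meas.comp (measurable_snd.prodMk (measurable_fst.comp measurable_fst))
    have hn : ∀ x, saNoise h mean α θ₀ x m (t + 1) = saNoise h mean α θ₀ x m t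
        + (h (x t) (saIterate h α θ₀ x t) - mean (saIterate h α θ₀ x t)) := by
      intro x
      simp only [saNoise, Finset.sum_Ico_succ_top hmt]
    have i0 := H.integrable_iterate α θ₀ m hξ hind (t + 1) (g := fun z => ‖z.2‖ ^ 2) (by fun_prop)
    simp only [hn] at i0 ⊢
    have key := H.integral_succ_le α θ₀ m hξ hind t
      (f := fun p => ‖p.1.2 + (h p.2 p.1.1 - mean p.1.1)‖ ^ 2)
      (((measurable_snd.comp measurable_fst).add (hm.sub (hmean.comp
        (measurable_fst.comp measurable_fst)))).norm.pow_const 2) i0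
      (fun _ _ => by positivity)
      (g := fun z => ‖z.2‖ ^ 2 + 8 * q z.1 + 2 * σ2) (by fun_prop)
      (fun z => (H.integral_noise_le z.1 z.2).trans (by linarith))
    have i1 := H.integrable_iterate α θ₀ m hξ hind t (g := fun z => ‖z.2‖ ^ 2) (by fun_prop)
    have i2 := H.integrable_iterate α θ₀ m hξ hind t (g := fun z => q z.1) (by fun_prop)
    rw [integral_linear_comb i1 i2 (integrable_const σ2)] at key
    simp only [integral_const, probReal_univ, one_smul] at key
    rw [Finset.sum_Ico_succ_top hmt]
    push_cast
    linarith

/-- Geometric decay of the second moment of the iterates down to the noise floor. The rate is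
written as a square, `1 - α a lam ≤ (1 - α a lam / 2)²`. -/
lemma NoisyField.integral_norm_sq_le (hα : 0 < α) (haα : 8 * α ≤ a) (hlam : 0 < lam)
    (hlam1 : lam ≤ 1) (ha1 : a ≤ 1) (hσ : 0 ≤ σ2) (t : ℕ) :
    ∫ ω, ‖saIterate h α θ₀ (fun i => ξ i ω) t‖ ^ 2 ∂ρ
      ≤ ((1 - 1 / 2 * α * a * lam) ^ t) ^ 2 * ‖θ₀‖ ^ 2 + 2 * α * σ2 / (a * lam) := by
  have ha : 0 < a := by linarith
  have hal : 0 < a * lam := mul_pos ha hlam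
  have hal1 : a * lam ≤ 1 := mul_le_one₀ ha1 hlam.le hlam1
  have hp0 : 0 < α * (a * lam) := by positivity
  have hp1 : α * (a * lam) ≤ 1 := mul_le_one₀ (by linarith) hal.le hal1
  induction t with
  | zero =>
    have : 0 ≤ 2 * α * σ2 / (a * lam) := by positivity
    simpa [saIterate] using this
  | succ t ih =>
    have h1 := H.integral_norm_sq_succ_le θ₀ hξ hind hα.le haα hlam.le t
    have i1 := H.integrable_iterate α θ₀ 0 hξ hind t (g := fun z => lam * ‖z.1‖ ^ 2)
      (by fun_prop)
    have i2 := H.integrable_iterate α θ₀ 0 hξ hind t (g := fun z => q z.1)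
      (H.continuous_q.comp continuous_fst)
    have h2 : lam * ∫ ω, ‖saIterate h α θ₀ (fun i => ξ i ω) t‖ ^ 2 ∂ρ
        ≤ ∫ ω, q (saIterate h α θ₀ (fun i => ξ i ω) t) ∂ρ := by
      rw [← integral_const_mul]
      exact integral_mono i1 i2 fun ω => H.le_q _
    set u := ∫ ω, ‖saIterate h α θ₀ (fun i => ξ i ω) t‖ ^ 2 ∂ρ
    set w := ∫ ω, q (saIterate h α θ₀ (fun i => ξ i ω) t) ∂ρ
    set R := (1 - 1 / 2 * α * a * lam) ^ t with hR
    have h3 : α * a * (lam * u) ≤ α * a * w := by gcongr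
    have h4 : (1 - α * (a * lam)) * u
        ≤ (1 - α * (a * lam)) * (R ^ 2 * ‖θ₀‖ ^ 2 + 2 * α * σ2 / (a * lam)) := by
      gcongr
    have h5 : (1 - α * (a * lam)) * (R ^ 2 * ‖θ₀‖ ^ 2)
        ≤ (1 - 1 / 2 * α * a * lam) ^ 2 * (R ^ 2 * ‖θ₀‖ ^ 2) := by
      gcongr
      nlinarith [sq_nonneg (α * (a * lam))]
    have h6 : α * (a * lam) * (2 * α * σ2 / (a * lam)) = 2 * α ^ 2 * σ2 := by
      field_simp
    rw [pow_succ (1 - 1 / 2 * α * a * lam) t, ← hR, mul_pow]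
    nlinarith

/-- Telescoping the one-step inequality controls the accumulated `q` without the factor `lam`. -/
lemma NoisyField.sum_integral_q_le (hα : 0 < α) (haα : 8 * α ≤ a) (hlam : 0 < lam)
    (m n : ℕ) (hmn : m ≤ n) :
    α * a * ∑ t ∈ Finset.Ico m n, ∫ ω, q (saIterate h α θ₀ (fun i => ξ i ω) t) ∂ρ
        + ∫ ω, ‖saIterate h α θ₀ (fun i => ξ i ω) n‖ ^ 2 ∂ρ
      ≤ ∫ ω, ‖saIterate h α θ₀ (fun i => ξ i ω) m‖ ^ 2 ∂ρ + 2 * (n - m : ℝ) * α ^ 2 * σ2 := by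
  induction n, hmn using Nat.le_induction with
  | base => simp
  | succ t hmt ih =>
    have h1 := H.integral_norm_sq_succ_le θ₀ hξ hind hα.le haα hlam.le t
    rw [Finset.sum_Ico_succ_top hmt]
    push_cast
    linarith

/-- Error of the tail average over `[m, n)`: the monotone mean field is inverted on the telescoped
recursion, which leaves the two boundary iterates and the martingale of accumulated noise. -/
theorem NoisyField.integral_q_average_le (hα : 0 < α) (haα : 8 * α ≤ a) (hlam : 0 < lam)
    (hlam1 : lam ≤ 1) (ha1 : a ≤ 1) (hσ : 0 ≤ σ2) (m n : ℕ) (hmn : m < n) :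
    ∫ ω, q ((n - m : ℝ)⁻¹ • ∑ t ∈ Finset.Ico m n, saIterate h α θ₀ (fun i => ξ i ω) t) ∂ρ
      ≤ 3 / (α ^ 2 * a ^ 2 * lam * (n - m : ℝ) ^ 2)
        * (3 * (((1 - 1 / 2 * α * a * lam) ^ m) ^ 2 * ‖θ₀‖ ^ 2 + 2 * α * σ2 / (a * lam))
          + 4 * (n - m : ℝ) * α ^ 2 * σ2) := by
  have ha : 0 < a := by linarith
  have hal1 : a * lam ≤ 1 := mul_le_one₀ ha1 hlam.le hlam1
  have hp0 : 0 < α * a * lam := by positivity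
  have hp1 : α * a * lam ≤ 1 := by
    rw [mul_assoc]; exact mul_le_one₀ (by linarith) (by positivity) hal1
  set N : ℝ := (n - m : ℝ) with hN
  have hN0 : 0 < N := by
    have : (m : ℝ) < n := by exact_mod_cast hmn
    linarith
  set B : ℝ := ((1 - 1 / 2 * α * a * lam) ^ m) ^ 2 * ‖θ₀‖ ^ 2 + 2 * α * σ2 / (a * lam) with hB
  have hum := H.integral_norm_sq_le θ₀ hξ hind hα haα hlam hlam1 ha1 hσ m
  have hun : ∫ ω, ‖saIterate h α θ₀ (fun i => ξ i ω) n‖ ^ 2 ∂ρ ≤ B := by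
    refine (H.integral_norm_sq_le θ₀ hξ hind hα haα hlam hlam1 ha1 hσ n).trans ?_
    have h0 : 0 ≤ (1 - 1 / 2 * α * a * lam) := by linarith
    have : (1 - 1 / 2 * α * a * lam) ^ n ≤ (1 - 1 / 2 * α * a * lam) ^ m :=
      pow_le_pow_of_le_one h0 (by linarith) hmn.le
    rw [hB]
    gcongr
  have hsum := H.sum_integral_q_le θ₀ hξ hind hα haα hlam m n hmn.le
  have hnoise := H.integral_noise_sq_le θ₀ hξ hind (α := α) m n hmn.le
  rw [← hB] at hum
  rw [← hN] at hsum hnoise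
  have hpos : 0 ≤ ∫ ω, ‖saIterate h α θ₀ (fun i => ξ i ω) n‖ ^ 2 ∂ρ :=
    integral_nonneg fun _ => by positivity
  set Q := ∑ t ∈ Finset.Ico m n, ∫ ω, q (saIterate h α θ₀ (fun i => ξ i ω) t) ∂ρ
  have hQ0 : 0 ≤ Q := Finset.sum_nonneg fun t _ => integral_nonneg fun ω =>
    le_trans (by positivity) (H.le_q _)
  have hG : α ^ 2 * ∫ ω, ‖saNoise h mean α θ₀ (fun i => ξ i ω) m n‖ ^ 2 ∂ρ
      ≤ B + 4 * N * α ^ 2 * σ2 := by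
    have h1 : α * (8 * α) * Q ≤ α * a * Q := by gcongr
    have h2 := mul_le_mul_of_nonneg_left hnoise (sq_nonneg α)
    nlinarith
  have hpt : ∀ ω, q (N⁻¹ • ∑ t ∈ Finset.Ico m n, saIterate h α θ₀ (fun i => ξ i ω) t)
      ≤ 3 / (α ^ 2 * a ^ 2 * lam * N ^ 2) * (‖saIterate h α θ₀ (fun i => ξ i ω) m‖ ^ 2
        + ‖saIterate h α θ₀ (fun i => ξ i ω) n‖ ^ 2
        + α ^ 2 * ‖saNoise h mean α θ₀ (fun i => ξ i ω) m n‖ ^ 2) := by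
    intro ω
    have h1 := H.q_le_norm_mean ha hlam
      (N⁻¹ • ∑ t ∈ Finset.Ico m n, saIterate h α θ₀ (fun i => ξ i ω) t)
    have h2 := smul_sum_mean_saIterate h mean α θ₀ (fun i => ξ i ω) hmn.le
    set v := mean (∑ t ∈ Finset.Ico m n, saIterate h α θ₀ (fun i => ξ i ω) t) with hv
    set p₁ := saIterate h α θ₀ (fun i => ξ i ω) m
    set p₂ := saIterate h α θ₀ (fun i => ξ i ω) n
    set p₃ := saNoise h mean α θ₀ (fun i => ξ i ω) m n
    rw [map_smul, ← hv, norm_smul, mul_pow, Real.norm_eq_abs, sq_abs] at h1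
    have h3 : α ^ 2 * ‖v‖ ^ 2 ≤ 3 * (‖p₁‖ ^ 2 + ‖p₂‖ ^ 2 + α ^ 2 * ‖p₃‖ ^ 2) := by
      have e1 : α ^ 2 * ‖v‖ ^ 2 = ‖α • v‖ ^ 2 := by
        rw [norm_smul, mul_pow, Real.norm_eq_abs, sq_abs]
      have e2 : ‖p₁ - p₂ - α • p₃‖ ≤ ‖p₁‖ + ‖p₂‖ + α * ‖p₃‖ := by
        refine (norm_sub_le _ _).trans (add_le_add (norm_sub_le _ _) ?_)
        rw [norm_smul, Real.norm_eq_abs, abs_of_pos hα]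
      have e3 : ‖p₁ - p₂ - α • p₃‖ ^ 2 ≤ (‖p₁‖ + ‖p₂‖ + α * ‖p₃‖) ^ 2 := by gcongr
      rw [e1, h2]
      nlinarith [sq_nonneg (‖p₁‖ - ‖p₂‖), sq_nonneg (‖p₁‖ - α * ‖p₃‖),
        sq_nonneg (‖p₂‖ - α * ‖p₃‖)]
    rw [div_mul_eq_mul_div, le_div_iff₀ (by positivity)]
    calc q (N⁻¹ • ∑ t ∈ Finset.Ico m n, saIterate h α θ₀ (fun i => ξ i ω) t)
          * (α ^ 2 * a ^ 2 * lam * N ^ 2)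
        = (α ^ 2 * N ^ 2) * (a ^ 2 * lam * q (N⁻¹ • ∑ t ∈ Finset.Ico m n,
            saIterate h α θ₀ (fun i => ξ i ω) t)) := by ring
      _ ≤ (α ^ 2 * N ^ 2) * ((N⁻¹) ^ 2 * ‖v‖ ^ 2) := by gcongr
      _ = α ^ 2 * ‖v‖ ^ 2 := by field_simp
      _ ≤ _ := h3
  have i1 := H.integrable_iterate α θ₀ m hξ hind m (g := fun z => ‖z.1‖ ^ 2) (by fun_prop)
  have i2 := H.integrable_iterate α θ₀ m hξ hind n (g := fun z => ‖z.1‖ ^ 2) (by fun_prop)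
  have i3 := H.integrable_iterate α θ₀ m hξ hind n (g := fun z => ‖z.2‖ ^ 2) (by fun_prop)
  calc ∫ ω, q (N⁻¹ • ∑ t ∈ Finset.Ico m n, saIterate h α θ₀ (fun i => ξ i ω) t) ∂ρ
      ≤ ∫ ω, 3 / (α ^ 2 * a ^ 2 * lam * N ^ 2) * (‖saIterate h α θ₀ (fun i => ξ i ω) m‖ ^ 2
        + ‖saIterate h α θ₀ (fun i => ξ i ω) n‖ ^ 2
        + α ^ 2 * ‖saNoise h mean α θ₀ (fun i => ξ i ω) m n‖ ^ 2) ∂ρ := by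
        have i4 : Integrable (fun ω => ‖saIterate h α θ₀ (fun i => ξ i ω) m‖ ^ 2
          + ‖saIterate h α θ₀ (fun i => ξ i ω) n‖ ^ 2
          + α ^ 2 * ‖saNoise h mean α θ₀ (fun i => ξ i ω) m n‖ ^ 2) ρ :=
          (i1.add i2).add (i3.const_mul _)
        exact
        integral_mono_of_nonneg
          (Filter.Eventually.of_forall fun ω => le_trans (by positivity) (H.le_q _))
          (i4.const_mul _) (Filter.Eventually.of_forall hpt)
    _ = 3 / (α ^ 2 * a ^ 2 * lam * N ^ 2) *
        (∫ ω, ‖saIterate h α θ₀ (fun i => ξ i ω) m‖ ^ 2 ∂ρ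
        + ∫ ω, ‖saIterate h α θ₀ (fun i => ξ i ω) n‖ ^ 2 ∂ρ
        + α ^ 2 * ∫ ω, ‖saNoise h mean α θ₀ (fun i => ξ i ω) m n‖ ^ 2 ∂ρ) := by
        have := integral_linear_comb i1 i2 i3 1 (α ^ 2)
        simp only [one_mul] at this
        rw [integral_const_mul, this]
    _ ≤ _ := by
        refine mul_le_mul_of_nonneg_left ?_ (by positivity)
        linarith

end Moments

end StochasticApproximation

/-! ### The law of one sample -/

section SampleLaw

variable {S A : Type*} [MeasurableSpace S] [MeasurableSpace A]
  (P : Kernel (S × A) (ℝ × S)) [IsMarkovKernel P] (π : Kernel S A) [IsMarkovKernel π]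
  (μ : Measure S) [IsProbabilityMeasure μ]

instance isMarkovKernel_rewardStep : IsMarkovKernel (rewardStep P π) := by
  unfold rewardStep; infer_instance

instance isProbabilityMeasure_sampleLaw : IsProbabilityMeasure (sampleLaw P π μ) := by
  unfold sampleLaw; infer_instance

omit [IsMarkovKernel P] in
lemma lintegral_rewardStep (s : S) {f : ℝ × S → ℝ≥0∞} (hf : Measurable f) :
    ∫⁻ y, f y ∂(rewardStep P π s) = ∫⁻ a, ∫⁻ y, f y ∂(P (s, a)) ∂(π s) := by
  rw [rewardStep, Kernel.lintegral_comp _ _ _ hf,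
    Kernel.lintegral_id_prod hf.lintegral_kernel]

/-- Forgetting the action, a sample consists of a state `s ∼ μ` and of a reward and next state
drawn from `rewardStep P π s`. -/
lemma map_sampleLaw : (sampleLaw P π μ).map (fun x => (x.1.1, x.2)) = μ ⊗ₘ rewardStep P π := by
  have hm : Measurable fun x : (S × A) × (ℝ × S) => (x.1.1, x.2) := by fun_prop
  refine Measure.ext_of_lintegral _ fun f hf => ?_
  have hf' : Measurable fun x : (S × A) × (ℝ × S) => f (x.1.1, x.2) := hf.comp hm
  rw [lintegral_map hf hm, sampleLaw, Measure.lintegral_compProd hf',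
    Measure.lintegral_compProd hf'.lintegral_kernel_prod_right', Measure.lintegral_compProd hf]
  refine lintegral_congr fun s => ?_
  exact (lintegral_rewardStep P π s (f := fun y => f (s, y))
    (hf.comp measurable_prodMk_left)).symm

lemma ae_rewardStep_reward_mem (hP : ∀ z : S × A, ∀ᵐ y ∂(P z), y.1 ∈ Icc (0 : ℝ) 1) (s : S) :
    ∀ᵐ y ∂(rewardStep P π s), y.1 ∈ Icc (0 : ℝ) 1 := by
  have hm : MeasurableSet {y : ℝ × S | y.1 ∈ Icc (0 : ℝ) 1} := measurable_fst measurableSet_Icc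
  rw [ae_iff]
  change rewardStep P π s {y | y.1 ∈ Icc (0 : ℝ) 1}ᶜ = 0
  rw [← lintegral_indicator_one hm.compl,
    lintegral_rewardStep P π s (measurable_one.indicator hm.compl)]
  have : ∀ a, ∫⁻ y, ({y : ℝ × S | y.1 ∈ Icc (0 : ℝ) 1}ᶜ).indicator 1 y ∂(P (s, a)) = 0 := by
    intro a
    rw [lintegral_indicator_one hm.compl]
    exact ae_iff.1 (hP (s, a))
  rw [lintegral_congr this, lintegral_zero]

omit [IsMarkovKernel π] [IsProbabilityMeasure μ] in
lemma ae_sampleLaw_reward_mem (hP : ∀ z : S × A, ∀ᵐ y ∂(P z), y.1 ∈ Icc (0 : ℝ) 1) :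
    ∀ᵐ x ∂(sampleLaw P π μ), x.2.1 ∈ Icc (0 : ℝ) 1 := by
  unfold sampleLaw
  have hm : MeasurableSet {x : (S × A) × (ℝ × S) | x.2.1 ∈ Icc (0 : ℝ) 1} :=
    (measurable_fst.comp measurable_snd) measurableSet_Icc
  exact (Measure.ae_compProd_iff hm).2 (Filter.Eventually.of_forall hP)

lemma map_state_sampleLaw : (sampleLaw P π μ).map (fun x => x.1.1) = μ := by
  have h : (fun x : (S × A) × (ℝ × S) => x.1.1) = Prod.fst ∘ fun x => (x.1.1, x.2) := rfl
  rw [h, ← Measure.map_map measurable_fst (by fun_prop), map_sampleLaw]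
  exact Measure.fst_compProd μ (rewardStep P π)

lemma map_nextState_sampleLaw (hμ : Kernel.Invariant (rewardStep P π).snd μ) :
    (sampleLaw P π μ).map (fun x => x.2.2) = μ := by
  have h : (fun x : (S × A) × (ℝ × S) => x.2.2)
      = Prod.snd ∘ Prod.snd ∘ fun x => (x.1.1, x.2) := rfl
  rw [h, ← Measure.map_map measurable_snd (by fun_prop),
    ← Measure.map_map measurable_snd (by fun_prop), map_sampleLaw]
  have h2 : (μ ⊗ₘ rewardStep P π).map Prod.snd = (rewardStep P π) ∘ₘ μ :=
    Measure.snd_compProd μ (rewardStep P π)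
  rw [h2, Measure.map_comp _ _ measurable_snd, ← Kernel.snd_eq]
  exact hμ

lemma integral_sampleLaw_state {f : S → ℝ} (hf : Measurable f) :
    ∫ x, f x.1.1 ∂(sampleLaw P π μ) = ∫ s, f s ∂μ := by
  have h := integral_map (μ := sampleLaw P π μ) (φ := fun x => x.1.1) (by fun_prop)
    hf.aestronglyMeasurable
  rw [map_state_sampleLaw] at h
  exact h.symm

lemma integral_sampleLaw_nextState (hμ : Kernel.Invariant (rewardStep P π).snd μ) {f : S → ℝ}
    (hf : Measurable f) :
    ∫ x, f x.2.2 ∂(sampleLaw P π μ) = ∫ s, f s ∂μ := by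
  have h := integral_map (μ := sampleLaw P π μ) (φ := fun x => x.2.2) (by fun_prop)
    (f := f) hf.aestronglyMeasurable
  rw [map_nextState_sampleLaw P π μ hμ] at h
  exact h.symm

lemma integral_sampleLaw {f : S × (ℝ × S) → ℝ} (hf : Measurable f)
    (hint : Integrable (fun x => f (x.1.1, x.2)) (sampleLaw P π μ)) :
    ∫ x, f (x.1.1, x.2) ∂(sampleLaw P π μ) = ∫ s, ∫ y, f (s, y) ∂(rewardStep P π s) ∂μ := by
  have hm : Measurable fun x : (S × A) × (ℝ × S) => (x.1.1, x.2) := by fun_prop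
  have h := integral_map (μ := sampleLaw P π μ) hm.aemeasurable hf.aestronglyMeasurable
  have hi : Integrable f (μ ⊗ₘ rewardStep P π) := by
    rw [← map_sampleLaw]
    exact (integrable_map_measure hf.aestronglyMeasurable hm.aemeasurable).2 hint
  rw [map_sampleLaw, Measure.integral_compProd hi] at h
  exact h.symm

end SampleLaw

/-! ### Bounds and measurability of the residual -/

section Residual

variable {S : Type*} {d K : ℕ} {γ : ℝ} {φ : S → EuclideanSpace ℝ (Fin d)}

lemma abs_feature_le (hφ : ∀ s, ‖φ s‖ ≤ 1) (s : S) (i : Fin d) : |φ s i| ≤ 1 := by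
  have h := PiLp.norm_apply_le (φ s) i
  rw [Real.norm_eq_abs] at h
  exact h.trans (hφ s)

lemma abs_vecMul_le (hφ : ∀ s, ‖φ s‖ ≤ 1) (s : S) (Θ : Matrix (Fin d) (Fin K) ℝ) (k : Fin K) :
    |((φ s).ofLp ᵥ* Θ) k| ≤ ∑ i, |Θ i k| := by
  simp only [Matrix.vecMul, dotProduct]
  refine (Finset.abs_sum_le_sum_abs (fun i => φ s i * Θ i k) Finset.univ).trans
    (Finset.sum_le_sum fun i _ => ?_)
  rw [abs_mul]
  exact mul_le_of_le_one_left (abs_nonneg _) (abs_feature_le hφ s i)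

lemma projCdf_mem (γ : ℝ) (K : ℕ) (r : ℝ) (j k : ℕ) : projCdf γ K r j k ∈ Icc (0 : ℝ) 1 :=
  ⟨ramp_nonneg _, ramp_le_one _⟩

lemma abs_bellmanMat_le (γ : ℝ) (r : ℝ) (k j : Fin K) : |bellmanMat γ K r k j| ≤ 1 := by
  have h1 := projCdf_mem γ K r j k
  have h2 := projCdf_mem γ K r (j + 1) k
  simp only [bellmanMat, Matrix.of_apply]
  exact abs_le.2 ⟨by linarith [h1.1, h2.2], by linarith [h1.2, h2.1]⟩

lemma abs_bellmanOffset_le_one (γ : ℝ) (r : ℝ) (k : Fin K) : |bellmanOffset γ K r k| ≤ 1 := by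
  have hk : ((k : ℕ) : ℝ) + 1 ≤ K := by exact_mod_cast k.2
  have hk0 : (0 : ℝ) ≤ (k : ℕ) := Nat.cast_nonneg _
  have h0 : 0 ≤ ∑ j ∈ Finset.range (K + 1), projCdf γ K r j k :=
    Finset.sum_nonneg fun j _ => (projCdf_mem γ K r j k).1
  have h1 : ∑ j ∈ Finset.range (K + 1), projCdf γ K r j k ≤ K + 1 := by
    calc ∑ j ∈ Finset.range (K + 1), projCdf γ K r j k
        ≤ ∑ j ∈ Finset.range (K + 1), (1 : ℝ) :=
          Finset.sum_le_sum fun j _ => (projCdf_mem γ K r j k).2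
      _ = K + 1 := by simp
  unfold bellmanOffset
  rw [abs_mul, abs_of_nonneg (by positivity), inv_mul_le_iff₀ (by positivity), mul_one]
  exact abs_le.2 ⟨by linarith, by linarith⟩

/-- A crude bound on the residual that holds for all rewards, including those outside `[0, 1]`. -/
lemma abs_residual_le (hφ : ∀ s, ‖φ s‖ ≤ 1) (s : S) (y : ℝ × S) (Θ : Matrix (Fin d) (Fin K) ℝ)
    (k : Fin K) : |residual γ φ s y Θ k| ≤ 2 * ∑ j, ∑ i, |Θ i j| + 1 := by
  have h1 : |((φ s).ofLp ᵥ* Θ) k| ≤ ∑ j, ∑ i, |Θ i j| :=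
    (abs_vecMul_le hφ s Θ k).trans (Finset.single_le_sum (f := fun j => ∑ i, |Θ i j|)
      (fun j _ => Finset.sum_nonneg fun i _ => abs_nonneg _) (Finset.mem_univ k))
  have h2 : |(bellmanMat γ K y.1 *ᵥ ((φ y.2).ofLp ᵥ* Θ)) k| ≤ ∑ j, ∑ i, |Θ i j| := by
    rw [Matrix.mulVec, dotProduct]
    refine (Finset.abs_sum_le_sum_abs
      (fun j => bellmanMat γ K y.1 k j * ((φ y.2).ofLp ᵥ* Θ) j) Finset.univ).trans
      (Finset.sum_le_sum fun j _ => ?_)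
    rw [abs_mul]
    exact (mul_le_of_le_one_left (abs_nonneg _) (abs_bellmanMat_le γ y.1 k j)).trans
      (abs_vecMul_le hφ y.2 Θ j)
  have h3 := abs_bellmanOffset_le_one γ y.1 k
  simp only [residual, Pi.sub_apply]
  rw [abs_le] at *
  constructor <;> linarith

variable [MeasurableSpace S]

lemma measurable_feature (hφ : Measurable φ) (i : Fin d) : Measurable fun s => φ s i := by
  fun_prop

lemma measurable_residual (hφ : Measurable φ) {X : Type*} [MeasurableSpace X] {s : X → S}
    {y : X → ℝ × S} {Θ : X → Matrix (Fin d) (Fin K) ℝ} (hs : Measurable s) (hy : Measurable y)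
    (hΘ : ∀ i j, Measurable fun x => Θ x i j) (k : Fin K) :
    Measurable fun x => residual γ φ (s x) (y x) (Θ x) k := by
  have h1 : ∀ i, Measurable fun x => φ (s x) i := fun i => (measurable_feature hφ i).comp hs
  have h2 : ∀ i, Measurable fun x => φ (y x).2 i := fun i =>
    (measurable_feature hφ i).comp (measurable_snd.comp hy)
  have h3 : ∀ j k, Measurable fun x => projCdf γ K (y x).1 j k := by
    intro j k
    simp only [projCdf, scaledPt]
    exact continuous_ramp.measurable.comp (measurable_const.sub
      (((measurable_fst.comp hy).mul_const _).add_const _))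
  simp only [residual, Pi.sub_apply, Matrix.vecMul, Matrix.mulVec, dotProduct, bellmanMat,
    bellmanOffset, Matrix.of_apply]
  refine ((Finset.measurable_sum _ fun i _ => (h1 i).mul (hΘ i k)).sub
    (Finset.measurable_sum _ fun j _ => ((h3 _ _).sub (h3 _ _)).mul
      (Finset.measurable_sum _ fun i _ => (h2 i).mul (hΘ i j)))).sub ?_
  exact ((Finset.measurable_sum _ fun j _ => h3 _ _).sub_const _).const_mul _

lemma measurable_vecMul (hφ : Measurable φ) (Θ : Matrix (Fin d) (Fin K) ℝ) (k : Fin K) :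
    Measurable fun s => ((φ s).ofLp ᵥ* Θ) k := by
  simp only [Matrix.vecMul, dotProduct]
  exact Finset.measurable_sum _ fun i _ => (measurable_feature hφ i).mul_const _

end Residual

/-! ### CDFs of the parametrized families and of their Bellman images -/

section Cdf

variable {S : Type*} {d K : ℕ} {γ : ℝ} {φ : S → EuclideanSpace ℝ (Fin d)}

lemma sum_range_pmfVal (Θ : Matrix (Fin d) (Fin K) ℝ) (s : S) (k : ℕ) :
    ∑ j ∈ Finset.range (k + 1), pmfVal φ Θ s j = cdfVal φ Θ s k := by
  rw [Finset.sum_range_succ']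
  simp only [pmfVal]
  rw [Finset.sum_range_sub (fun j => cdfVal φ Θ s j)]
  ring

lemma etaOf_apply (Θ : Matrix (Fin d) (Fin K) ℝ) (s : S) {B : Set ℝ} (hB : MeasurableSet B) :
    etaOf γ φ Θ s B
      = ∑ k ∈ Finset.range (K + 1), pmfVal φ Θ s k * B.indicator 1 (supportPt γ K k) := by
  simp only [etaOf]
  rw [FunLike.coe_sum, Finset.sum_apply]
  refine Finset.sum_congr rfl fun k _ => ?_
  by_cases h : supportPt γ K k ∈ B
  · simp [h, VectorMeasure.dirac_apply_of_mem hB h]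
  · simp [h]

lemma map_etaOf_apply (Θ : Matrix (Fin d) (Fin K) ℝ) (s : S) (r : ℝ) {B : Set ℝ}
    (hB : MeasurableSet B) :
    (etaOf γ φ Θ s).map (fun x => r + γ * x) B = ∑ k ∈ Finset.range (K + 1),
      pmfVal φ Θ s k * B.indicator 1 (r + γ * supportPt γ K k) := by
  have hm : Measurable fun x : ℝ => r + γ * x := by fun_prop
  rw [VectorMeasure.map_apply _ hm hB, etaOf_apply _ _ (hm hB)]
  rfl

/-- On the cell `[x_k, x_{k+1})` the CDF of `η_θ(s)` is constant, equal to `F_k(s; θ)`. -/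
lemma cdf_etaOf (hγ : γ ∈ Ioo (0 : ℝ) 1) (Θ : Matrix (Fin d) (Fin K) ℝ) (s : S) (k : Fin K)
    {x : ℝ} (hx : x ∈ Ico (supportPt γ K k) (supportPt γ K (k + 1))) :
    cdf (etaOf γ φ Θ s) x = cdfVal φ Θ s k := by
  have hg := gap_pos hγ k.pos
  rw [cdf, etaOf_apply _ _ measurableSet_Icc, ← sum_range_pmfVal]
  have : ∀ j, pmfVal φ Θ s j * (Icc 0 x).indicator 1 (supportPt γ K j)
      = if j < k + 1 then pmfVal φ Θ s j else 0 := by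
    intro j
    by_cases hj : j < (k : ℕ) + 1
    · have h1 : supportPt γ K j ≤ supportPt γ K k := by
        have : (j : ℝ) ≤ (k : ℕ) := by exact_mod_cast Nat.lt_succ_iff.1 hj
        unfold supportPt; gcongr
      have h2 : 0 ≤ supportPt γ K j := by unfold supportPt; positivity
      rw [indicator_of_mem (show supportPt γ K j ∈ Icc 0 x from ⟨h2, h1.trans hx.1⟩), if_pos hj]
      simp
    · have h1 : supportPt γ K (k + 1) ≤ supportPt γ K j := by
        have : (((k : ℕ) + 1 : ℕ) : ℝ) ≤ j := by exact_mod_cast not_lt.1 hj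
        unfold supportPt; gcongr
      rw [indicator_of_notMem (fun h => absurd h.2 (not_le.2 (hx.2.trans_le h1))), if_neg hj]
      simp
  simp only [this]
  rw [← Finset.sum_filter]
  congr 1
  ext j
  have := k.2
  simp only [Finset.mem_filter, Finset.mem_range]
  omega

/-- The residual is the CDF at `s` minus the projected CDF of the push-forward of `η_θ(s')`. -/
lemma cdfVal_sub_sum (Θ : Matrix (Fin d) (Fin K) ℝ) (s : S) (y : ℝ × S) (k : Fin K) :
    cdfVal φ Θ s k - ∑ j ∈ Finset.range (K + 1), pmfVal φ Θ y.2 j * projCdf γ K y.1 j k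
      = residual γ φ s y Θ k := by
  set lin : ℕ → ℝ := fun j => if h : j < K then ((φ y.2).ofLp ᵥ* Θ) ⟨j, h⟩ else 0 with hlin
  set c : ℕ → ℝ := fun j => projCdf γ K y.1 j k with hc
  have hK1 : (K : ℝ) + 1 ≠ 0 := by positivity
  have hF : ∀ j, j ≤ K → cdfVal φ Θ y.2 j = lin j + ((j : ℝ) + 1) / ((K : ℝ) + 1) := by
    intro j hj
    rcases hj.eq_or_lt with rfl | hj
    · simp [cdfVal, hlin, div_self hK1]
    · simp [cdfVal, hlin, hj]
  have hsum : ∑ j ∈ Finset.range (K + 1), pmfVal φ Θ y.2 j * c j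
      = ∑ j ∈ Finset.range K, lin j * (c j - c (j + 1))
        + ((K : ℝ) + 1)⁻¹ * ∑ j ∈ Finset.range (K + 1), c j := by
    have habel := sum_diff_mul lin c K
    have hK0 : lin K = 0 := by simp [hlin]
    rw [hK0, zero_mul, add_zero] at habel
    rw [← habel, Finset.sum_range_succ', Finset.sum_range_succ' (fun j => c j), mul_add,
      Finset.mul_sum]
    have h0 : pmfVal φ Θ y.2 0 * c 0 = lin 0 * c 0 + ((K : ℝ) + 1)⁻¹ * c 0 := by
      simp only [pmfVal]
      rw [hF 0 (Nat.zero_le _)]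
      push_cast; ring
    have hs : ∑ j ∈ Finset.range K, pmfVal φ Θ y.2 (j + 1) * c (j + 1)
        = ∑ j ∈ Finset.range K, (lin (j + 1) - lin j) * c (j + 1)
          + ∑ j ∈ Finset.range K, ((K : ℝ) + 1)⁻¹ * c (j + 1) := by
      rw [← Finset.sum_add_distrib]
      refine Finset.sum_congr rfl fun j hj => ?_
      have hj := Finset.mem_range.1 hj
      simp only [pmfVal]
      rw [hF j hj.le, hF (j + 1) hj]
      push_cast; ring
    rw [h0, hs]
    ring
  have hlinsum : ∑ j ∈ Finset.range K, lin j * (c j - c (j + 1))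
      = (bellmanMat γ K y.1 *ᵥ ((φ y.2).ofLp ᵥ* Θ)) k := by
    rw [← Fin.sum_univ_eq_sum_range (fun j => lin j * (c j - c (j + 1))) K]
    simp only [Matrix.mulVec, dotProduct]
    refine Finset.sum_congr rfl fun j _ => ?_
    simp [hlin, hc, bellmanMat, mul_comm, Matrix.vecMul, dotProduct]
  have hFk : cdfVal φ Θ s k
      = ((φ s).ofLp ᵥ* Θ) k + (((k : ℕ) : ℝ) + 1) / ((K : ℝ) + 1) := by
    simp [cdfVal, k.2]
  change cdfVal φ Θ s k - ∑ j ∈ Finset.range (K + 1), pmfVal φ Θ y.2 j * c j = _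
  rw [hsum, hlinsum, hFk]
  simp only [residual, Pi.sub_apply, bellmanOffset]
  ring

lemma exists_pmfVal_bound (hφ : ∀ s, ‖φ s‖ ≤ 1) (Θ : Matrix (Fin d) (Fin K) ℝ) :
    ∃ M : ℝ, ∀ s k, |pmfVal φ Θ s k| ≤ M := by
  have hF : ∀ s k, |cdfVal φ Θ s k| ≤ ∑ j, ∑ i, |Θ i j| + 1 := by
    intro s k
    have h0 : 0 ≤ ∑ j, ∑ i, |Θ i j| :=
      Finset.sum_nonneg fun j _ => Finset.sum_nonneg fun i _ => abs_nonneg _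
    unfold cdfVal
    split_ifs with h
    · have h1 : |((φ s).ofLp ᵥ* Θ) ⟨k, h⟩| ≤ ∑ j, ∑ i, |Θ i j| :=
        (abs_vecMul_le hφ s Θ _).trans (Finset.single_le_sum (f := fun j => ∑ i, |Θ i j|)
          (fun j _ => Finset.sum_nonneg fun i _ => abs_nonneg _) (Finset.mem_univ _))
      have h2 : ((k : ℝ) + 1) / ((K : ℝ) + 1) ≤ 1 := by
        rw [div_le_one (by positivity)]
        have : (k : ℝ) < K := by exact_mod_cast h
        linarith
      refine (abs_add_le _ _).trans (add_le_add h1 ?_)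
      rwa [abs_of_nonneg (by positivity)]
    · simpa using h0
  refine ⟨2 * (∑ j, ∑ i, |Θ i j| + 1), fun s k => ?_⟩
  have hpos : 0 ≤ ∑ j, ∑ i, |Θ i j| + 1 := (abs_nonneg _).trans (hF s 0)
  cases k with
  | zero => simp only [pmfVal]; linarith [hF s 0]
  | succ k =>
    simp only [pmfVal]
    refine (abs_sub _ _).trans ?_
    linarith [hF s k, hF s (k + 1)]

variable [MeasurableSpace S]

lemma measurable_cdfVal (hφ : Measurable φ) (Θ : Matrix (Fin d) (Fin K) ℝ) (k : ℕ) :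
    Measurable fun s => cdfVal φ Θ s k := by
  unfold cdfVal
  split_ifs with h
  · exact (measurable_vecMul hφ Θ _).add_const _
  · exact measurable_const

lemma measurable_pmfVal (hφ : Measurable φ) (Θ : Matrix (Fin d) (Fin K) ℝ) (k : ℕ) :
    Measurable fun s => pmfVal φ Θ s k := by
  cases k with
  | zero => exact measurable_cdfVal hφ Θ 0
  | succ k => exact (measurable_cdfVal hφ Θ (k + 1)).sub (measurable_cdfVal hφ Θ k)

end Cdf

/-! ### Decomposition of the Cramér distance over the cells -/

section Cells

lemma supportPt_last {γ : ℝ} {K : ℕ} (hK : 0 < K) : supportPt γ K K = (1 - γ)⁻¹ := by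
  have : (K : ℝ) ≠ 0 := by positivity
  unfold supportPt gap
  rw [mul_inv, mul_inv_cancel_left₀ this]

lemma supportPt_succ (γ : ℝ) (K k : ℕ) : supportPt γ K (k + 1) = supportPt γ K k + gap γ K := by
  unfold supportPt; push_cast; ring

lemma lintegral_Icc_eq_sum_cells {γ : ℝ} {K : ℕ} (hγ : γ ∈ Ioo (0 : ℝ) 1) (hK : 0 < K)
    (f : ℝ → ℝ≥0∞) :
    ∫⁻ x in Icc 0 (1 - γ)⁻¹, f x
      = ∑ k : Fin K, ∫⁻ x in Ico (supportPt γ K k) (supportPt γ K (k + 1)), f x := by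
  have hg := gap_pos hγ hK
  rw [← setLIntegral_congr Ico_ae_eq_Icc, ← supportPt_last hK,
    Fin.sum_univ_eq_sum_range
      (fun k => ∫⁻ x in Ico (supportPt γ K k) (supportPt γ K (k + 1)), f x) K]
  have : ∀ n : ℕ, ∫⁻ x in Ico 0 (supportPt γ K n), f x
      = ∑ k ∈ Finset.range n, ∫⁻ x in Ico (supportPt γ K k) (supportPt γ K (k + 1)), f x := by
    intro n
    induction n with
    | zero => simp [supportPt]
    | succ n ih =>
      have h0 : 0 ≤ supportPt γ K n := by unfold supportPt; positivity
      have h1 : supportPt γ K n ≤ supportPt γ K (n + 1) := by rw [supportPt_succ]; linarith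
      rw [Finset.sum_range_succ, ← ih, ← Ico_union_Ico_eq_Ico h0 h1,
        lintegral_union measurableSet_Ico]
      exact Set.disjoint_left.2 fun x hx hx' => absurd hx.2 (not_lt.2 hx'.1)
  exact this K

lemma enorm_sq_eq_ofReal (x : ℝ) : ‖x‖ₑ ^ 2 = ENNReal.ofReal (x ^ 2) := by
  rw [← ofReal_norm, ← ENNReal.ofReal_pow (norm_nonneg x), Real.norm_eq_abs, sq_abs]

/-- Bias-variance decomposition: the squared distance of a function to the constant `e` on a cell,
split at its average `c`. -/
lemma lintegral_cell_sub_sq {a b : ℝ} (hab : a < b) {g : ℝ → ℝ} {M : ℝ}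
    (hg : AEStronglyMeasurable g (volume.restrict (Ico a b))) (hM : ∀ x, |g x| ≤ M) {c : ℝ}
    (hc : ∫ x in Ico a b, g x = (b - a) * c) (e : ℝ) :
    ∫⁻ x in Ico a b, ‖g x - e‖ₑ ^ 2
      = (∫⁻ x in Ico a b, ‖g x - c‖ₑ ^ 2) + ENNReal.ofReal ((b - a) * (e - c) ^ 2) := by
  have hba : 0 ≤ b - a := by linarith
  have hi : Integrable g (volume.restrict (Ico a b)) :=
    Integrable.of_bound hg M (Filter.Eventually.of_forall hM)
  have hsq : ∀ t : ℝ, Integrable (fun x => (g x - t) ^ 2) (volume.restrict (Ico a b)) := by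
    intro t
    refine Integrable.of_bound ((hg.sub aestronglyMeasurable_const).pow 2) ((M + |t|) ^ 2)
      (Filter.Eventually.of_forall fun x => ?_)
    rw [Real.norm_eq_abs, abs_pow]
    have h1 : |g x - t| ≤ M + |t| := (abs_sub _ _).trans (by linarith [hM x])
    gcongr
  simp only [enorm_sq_eq_ofReal]
  rw [← ofReal_integral_eq_lintegral_ofReal (hsq e) (Filter.Eventually.of_forall fun x => sq_nonneg _),
    ← ofReal_integral_eq_lintegral_ofReal (hsq c) (Filter.Eventually.of_forall fun x => sq_nonneg _),
    ← ENNReal.ofReal_add (integral_nonneg fun x => sq_nonneg _)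
      (mul_nonneg hba (sq_nonneg _))]
  congr 1
  have he : ∀ x, (g x - e) ^ 2
      = (g x - c) ^ 2 + 2 * (c - e) * g x + (1 : ℝ) * ((e - c) ^ 2 - 2 * (c - e) * c) := by
    intro x; ring
  simp only [he]
  rw [integral_linear_comb (hsq c) hi (integrable_const _), hc]
  simp only [integral_const, smul_eq_mul, measureReal_restrict_apply_univ, Real.volume_real_Ico_of_le hab.le]
  ring

end Cells

/-! ### The projected Bellman equation as a linear equation -/

section FixedPoint

variable {S A : Type*} [MeasurableSpace S] [MeasurableSpace A] {d K : ℕ} {γ : ℝ}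
  {φ : S → EuclideanSpace ℝ (Fin d)}
  {P : Kernel (S × A) (ℝ × S)} [IsMarkovKernel P] {π : Kernel S A} [IsMarkovKernel π]

/-- The CDF at `x` of the push-forward of `η_θ(s')` under `z ↦ r + γ z`. -/
def pushCdf (γ : ℝ) (φ : S → EuclideanSpace ℝ (Fin d)) (Θ : Matrix (Fin d) (Fin K) ℝ)
    (y : ℝ × S) (x : ℝ) : ℝ :=
  ∑ k ∈ Finset.range (K + 1),
    pmfVal φ Θ y.2 k * (Icc 0 x).indicator 1 (y.1 + γ * supportPt γ K k)

omit [IsMarkovKernel P] [IsMarkovKernel π] in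
lemma cdf_bellmanImage {Θ : Matrix (Fin d) (Fin K) ℝ} {ζ : S → SignedMeasure ℝ}
    (hζ : IsBellmanImage γ P π (etaOf γ φ Θ) ζ) (s : S) (x : ℝ) :
    cdf (ζ s) x = ∫ y, pushCdf γ φ Θ y x ∂(rewardStep P π s) := by
  rw [cdf, (hζ s _ measurableSet_Icc).2]
  simp only [map_etaOf_apply _ _ _ measurableSet_Icc]
  rfl

lemma measurable_pushCdf (hφ : Measurable φ) (Θ : Matrix (Fin d) (Fin K) ℝ) {X : Type*}
    [MeasurableSpace X] {y : X → ℝ × S} {x : X → ℝ} (hy : Measurable y) (hx : Measurable x) :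
    Measurable fun p => pushCdf γ φ Θ (y p) (x p) := by
  unfold pushCdf
  refine Finset.measurable_sum _ fun k _ => ?_
  have h1 : Measurable fun p => pmfVal φ Θ (y p).2 k :=
    (measurable_pmfVal hφ Θ k).comp (measurable_snd.comp hy)
  have h2 : MeasurableSet {p | (y p).1 + γ * supportPt γ K k ∈ Icc 0 (x p)} := by
    have h3 : Measurable fun p => (y p).1 + γ * supportPt γ K k := by fun_prop
    exact (measurableSet_le measurable_const h3).inter (measurableSet_le h3 hx)
  exact h1.mul ((measurable_const (a := (1 : ℝ))).indicator h2)

omit [MeasurableSpace S] in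
lemma exists_pushCdf_bound (hφ : ∀ s, ‖φ s‖ ≤ 1) (Θ : Matrix (Fin d) (Fin K) ℝ) :
    ∃ M : ℝ, ∀ y x, |pushCdf γ φ Θ y x| ≤ M := by
  obtain ⟨M, hM⟩ := exists_pmfVal_bound (K := K) hφ Θ
  refine ⟨∑ k ∈ Finset.range (K + 1), M, fun y x => ?_⟩
  unfold pushCdf
  refine (Finset.abs_sum_le_sum_abs _ _).trans (Finset.sum_le_sum fun k _ => ?_)
  rw [abs_mul]
  refine (mul_le_of_le_one_right (abs_nonneg _) ?_).trans (hM y.2 k)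
  by_cases h : y.1 + γ * supportPt γ K k ∈ Icc 0 x <;> simp [h]

lemma integral_cell_indicator {a b z : ℝ} (hab : a < b) (hz : 0 ≤ z) :
    ∫ x in Ico a b, (Icc 0 x).indicator (1 : ℝ → ℝ) z = (b - a) * ramp ((b - z) / (b - a)) := by
  have hba : 0 < b - a := by linarith
  have h1 : ∀ x, (Icc 0 x).indicator (1 : ℝ → ℝ) z = (Ici z).indicator (fun _ => (1 : ℝ)) x := by
    intro x
    by_cases h : z ≤ x <;> simp [hz, h, indicator]
  simp only [h1]
  rw [setIntegral_indicator measurableSet_Ici]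
  have h2 : Ico a b ∩ Ici z = Ico (max a z) b := by
    ext x; simp only [mem_inter_iff, mem_Ico, mem_Ici, max_le_iff]; tauto
  rw [h2, integral_const, smul_eq_mul, mul_one, measureReal_restrict_apply_univ,
    Real.volume_real_Ico]
  have h3 : ramp ((b - z) / (b - a)) = max 0 (min (b - a) (b - z)) / (b - a) := by
    unfold ramp
    rw [← max_div_div_right hba.le, zero_div, ← min_div_div_right hba.le, div_self hba.ne']
  rw [h3, mul_div_cancel₀ _ hba.ne']
  grind

omit [MeasurableSpace S] in
/-- Averaging the push-forward CDF over a cell evaluates the categorical projection. -/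
lemma integral_cell_pushCdf (hγ : γ ∈ Ioo (0 : ℝ) 1) (Θ : Matrix (Fin d) (Fin K) ℝ)
    {y : ℝ × S} (hy : y.1 ∈ Icc (0 : ℝ) 1) (s : S) (k : Fin K) :
    ∫ x in Ico (supportPt γ K k) (supportPt γ K (k + 1)), pushCdf γ φ Θ y x
      = gap γ K * (cdfVal φ Θ s k - residual γ φ s y Θ k) := by
  have hK : 0 < K := k.pos
  have hg := gap_pos hγ hK
  have hlt : supportPt γ K k < supportPt γ K (k + 1) := by rw [supportPt_succ]; linarith
  have hz : ∀ j, 0 ≤ y.1 + γ * supportPt γ K j := by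
    intro j
    have := hy.1; have := hγ.1
    have : 0 ≤ supportPt γ K j := by unfold supportPt; positivity
    positivity
  have hterm : ∀ j, ∫ x in Ico (supportPt γ K k) (supportPt γ K (k + 1)),
      (Icc 0 x).indicator (1 : ℝ → ℝ) (y.1 + γ * supportPt γ K j)
        = gap γ K * projCdf γ K y.1 j k := by
    intro j
    rw [integral_cell_indicator hlt (hz j)]
    have h1 : supportPt γ K (k + 1) - supportPt γ K k = gap γ K := by rw [supportPt_succ]; ring
    rw [h1, sub_div, shift_div_gap hγ hK, projCdf]
    congr 3
    unfold supportPt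
    rw [mul_div_cancel_right₀ _ hg.ne']
    push_cast; ring
  rw [← cdfVal_sub_sum, sub_sub_cancel, Finset.mul_sum]
  unfold pushCdf
  rw [integral_finsetSum]
  · refine Finset.sum_congr rfl fun j _ => ?_
    rw [integral_const_mul, hterm]
    ring
  · intro j _
    refine Integrable.const_mul ?_ _
    have hm : Measurable fun x : ℝ =>
        (Icc 0 x).indicator (1 : ℝ → ℝ) (y.1 + γ * supportPt γ K j) := by
      have : MeasurableSet {x : ℝ | y.1 + γ * supportPt γ K j ∈ Icc 0 x} :=
        (MeasurableSet.const (0 ≤ y.1 + γ * supportPt γ K j)).inter measurableSet_Ici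
      exact (measurable_const (a := (1 : ℝ))).indicator this
    refine Integrable.of_bound hm.aestronglyMeasurable 1 (Filter.Eventually.of_forall fun x => ?_)
    by_cases h : y.1 + γ * supportPt γ K j ∈ Icc 0 x <;> simp [h]

/-- The expectation of the residual at `s` over the reward and the next state. -/
def meanResidual (γ : ℝ) (P : Kernel (S × A) (ℝ × S)) (π : Kernel S A)
    (φ : S → EuclideanSpace ℝ (Fin d)) (Θ : Matrix (Fin d) (Fin K) ℝ) (s : S) (k : Fin K) : ℝ :=
  ∫ y, residual γ φ s y Θ k ∂(rewardStep P π s)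

lemma integrable_residual (hφm : Measurable φ) (hφ : ∀ s, ‖φ s‖ ≤ 1)
    (Θ : Matrix (Fin d) (Fin K) ℝ) (s : S) (k : Fin K) :
    Integrable (fun y => residual γ φ s y Θ k) (rewardStep P π s) :=
  Integrable.of_bound (measurable_residual (s := fun _ => s) (y := fun y => y) (Θ := fun _ => Θ)
    hφm measurable_const measurable_id (fun _ _ => measurable_const) k).aestronglyMeasurable
    (2 * ∑ j, ∑ i, |Θ i j| + 1)
    (Filter.Eventually.of_forall fun y => (Real.norm_eq_abs _).trans_le
      (abs_residual_le hφ s y Θ k))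

lemma abs_meanResidual_le (hφ : ∀ s, ‖φ s‖ ≤ 1) (Θ : Matrix (Fin d) (Fin K) ℝ) (s : S)
    (k : Fin K) : |meanResidual γ P π φ Θ s k| ≤ 2 * ∑ j, ∑ i, |Θ i j| + 1 := by
  have h := norm_integral_le_of_norm_le_const (μ := rewardStep P π s)
    (f := fun y => residual γ φ s y Θ k)
    (Filter.Eventually.of_forall fun y => (Real.norm_eq_abs _).trans_le
      (abs_residual_le hφ s y Θ k))
  simpa [meanResidual] using h

lemma measurable_meanResidual (hφm : Measurable φ) (Θ : Matrix (Fin d) (Fin K) ℝ) (k : Fin K) :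
    Measurable fun s => meanResidual γ P π φ Θ s k := by
  have h : Measurable fun p : S × (ℝ × S) => residual γ φ p.1 p.2 Θ k :=
    measurable_residual (Θ := fun _ => Θ) hφm measurable_fst measurable_snd
      (fun _ _ => measurable_const) k
  unfold meanResidual
  exact (h.stronglyMeasurable.integral_kernel_prod_right' (κ := rewardStep P π)).measurable

/-- The squared Cramér distance to a Bellman image splits into a term that does not depend on
`θ'` and a squared Euclidean distance of CDF vectors. -/
lemma cramer_sq_bellmanImage (hγ : γ ∈ Ioo (0 : ℝ) 1) (hK : 0 < K)
    (hP : ∀ z : S × A, ∀ᵐ y ∂(P z), y.1 ∈ Icc (0 : ℝ) 1)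
    (hφm : Measurable φ) (hφ : ∀ s, ‖φ s‖ ≤ 1)
    {Θ : Matrix (Fin d) (Fin K) ℝ} {ζ : S → SignedMeasure ℝ}
    (hζ : IsBellmanImage γ P π (etaOf γ φ Θ) ζ) :
    ∃ (R : S → ℝ≥0∞) (C : ℝ≥0∞), C ≠ ∞ ∧ (∀ s, R s ≤ C) ∧
      ∀ (s : S) (Θ' : Matrix (Fin d) (Fin K) ℝ), cramer γ (ζ s) (etaOf γ φ Θ' s) ^ 2 = R s
        + ENNReal.ofReal (gap γ K *
          ∑ k, (((φ s).ofLp ᵥ* (Θ' - Θ)) k + meanResidual γ P π φ Θ s k) ^ 2) := by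
  have hg := gap_pos hγ hK
  obtain ⟨M, hM⟩ := exists_pushCdf_bound (γ := γ) hφ Θ
  have hmeas : Measurable fun p : ℝ × (ℝ × S) => pushCdf γ φ Θ p.2 p.1 :=
    measurable_pushCdf hφm Θ measurable_snd measurable_fst
  have hZM : ∀ s x, |cdf (ζ s) x| ≤ M := by
    intro s x
    have h := norm_integral_le_of_norm_le_const (μ := rewardStep P π s)
      (f := fun y => pushCdf γ φ Θ y x) (Filter.Eventually.of_forall fun y => hM y x)
    rw [cdf_bellmanImage hζ]
    simpa using h
  have hZm : ∀ s, Measurable (cdf (ζ s)) := by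
    intro s
    have := (hmeas.stronglyMeasurable.integral_prod_right' (ν := rewardStep P π s)).measurable
    have he : cdf (ζ s) = fun x => ∫ y, pushCdf γ φ Θ y x ∂(rewardStep P π s) :=
      funext fun x => cdf_bellmanImage hζ s x
    rw [he]; exact this
  have hlt : ∀ k : Fin K, supportPt γ K k < supportPt γ K (k + 1) := fun k => by
    rw [supportPt_succ]; linarith
  have hlen : ∀ k : Fin K, supportPt γ K (k + 1) - supportPt γ K k = gap γ K := fun k => by
    rw [supportPt_succ]; ring
  have havg : ∀ s (k : Fin K), ∫ x in Ico (supportPt γ K k) (supportPt γ K (k + 1)), cdf (ζ s) x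
      = (supportPt γ K (k + 1) - supportPt γ K k)
        * (cdfVal φ Θ s k - meanResidual γ P π φ Θ s k) := by
    intro s k
    simp only [cdf_bellmanImage hζ]
    rw [integral_integral_swap, hlen]
    · have h1 : ∀ᵐ y ∂(rewardStep P π s),
          ∫ x in Ico (supportPt γ K k) (supportPt γ K (k + 1)), pushCdf γ φ Θ y x
            = gap γ K * (cdfVal φ Θ s k - residual γ φ s y Θ k) := by
        filter_upwards [ae_rewardStep_reward_mem P π hP s] with y hy
        exact integral_cell_pushCdf hγ Θ hy s k
      rw [integral_congr_ae h1, integral_const_mul,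
        integral_sub (integrable_const _) (integrable_residual hφm hφ Θ s k)]
      simp [meanResidual]
    · refine Integrable.of_bound hmeas.aestronglyMeasurable M
        (Filter.Eventually.of_forall fun p => hM _ _)
  have hsplit : ∀ s (k : Fin K) (e : ℝ), _ := fun s k e =>
    lintegral_cell_sub_sq (hlt k) (hZm s).aestronglyMeasurable (hZM s) (havg s k) e
  refine ⟨fun s => ∑ k : Fin K, ∫⁻ x in Ico (supportPt γ K k) (supportPt γ K (k + 1)),
      ‖cdf (ζ s) x - (cdfVal φ Θ s k - meanResidual γ P π φ Θ s k)‖ₑ ^ 2,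
    ∑ k : Fin K, ENNReal.ofReal (M ^ 2) * ENNReal.ofReal (gap γ K), ?_, ?_, ?_⟩
  · exact (ENNReal.sum_lt_top.2 fun k _ =>
      ENNReal.mul_lt_top ENNReal.ofReal_lt_top ENNReal.ofReal_lt_top).ne
  · intro s
    refine Finset.sum_le_sum fun k _ => ?_
    calc ∫⁻ x in Ico (supportPt γ K k) (supportPt γ K (k + 1)),
          ‖cdf (ζ s) x - (cdfVal φ Θ s k - meanResidual γ P π φ Θ s k)‖ₑ ^ 2
        ≤ ∫⁻ x in Ico (supportPt γ K k) (supportPt γ K (k + 1)), ‖cdf (ζ s) x - 0‖ₑ ^ 2 := by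
          rw [hsplit s k 0]; exact le_self_add
      _ ≤ ∫⁻ x in Ico (supportPt γ K k) (supportPt γ K (k + 1)), ENNReal.ofReal (M ^ 2) := by
          refine lintegral_mono fun x => ?_
          simp only [sub_zero]
          rw [enorm_sq_eq_ofReal]
          refine ENNReal.ofReal_le_ofReal ?_
          rw [← sq_abs]
          have := hZM s x
          gcongr
      _ = _ := by
          rw [setLIntegral_const, Real.volume_Ico, hlen]
  · intro s Θ'
    have h1 : cramer γ (ζ s) (etaOf γ φ Θ' s) ^ 2
        = ∫⁻ x in Icc 0 (1 - γ)⁻¹, ‖cdf (ζ s) x - cdf (etaOf γ φ Θ' s) x‖ₑ ^ 2 := by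
      rw [cramer, ← ENNReal.rpow_natCast, ← ENNReal.rpow_mul]
      norm_num
    rw [h1, lintegral_Icc_eq_sum_cells hγ hK, Finset.mul_sum, ENNReal.ofReal_sum_of_nonneg
      (fun k _ => mul_nonneg hg.le (sq_nonneg _)), ← Finset.sum_add_distrib]
    refine Finset.sum_congr rfl fun k _ => ?_
    have h2 : ∫⁻ x in Ico (supportPt γ K k) (supportPt γ K (k + 1)),
        ‖cdf (ζ s) x - cdf (etaOf γ φ Θ' s) x‖ₑ ^ 2
        = ∫⁻ x in Ico (supportPt γ K k) (supportPt γ K (k + 1)),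
          ‖cdf (ζ s) x - cdfVal φ Θ' s k‖ₑ ^ 2 :=
      setLIntegral_congr_fun measurableSet_Ico fun x hx => by
        simp only [cdf_etaOf hγ Θ' s k hx]
    rw [h2, hsplit s k, hlen]
    congr 3
    have h3 : cdfVal φ Θ' s k = cdfVal φ Θ s k + ((φ s).ofLp ᵥ* (Θ' - Θ)) k := by
      simp only [cdfVal, k.2, dif_pos, Matrix.vecMul_sub, Pi.sub_apply]
      ring
    rw [h3]; ring

/-- The Bellman image exists: its component of atom `k` is the image under `(r, s') ↦ r + γ x_k` of
the signed measure with density `p_k(s'; Θ)`. -/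
lemma exists_isBellmanImage (hφm : Measurable φ) (hφ : ∀ s, ‖φ s‖ ≤ 1)
    (Θ : Matrix (Fin d) (Fin K) ℝ) : ∃ ζ, IsBellmanImage γ P π (etaOf γ φ Θ) ζ := by
  obtain ⟨M, hM⟩ := exists_pmfVal_bound (K := K) hφ Θ
  have hm : ∀ k, Measurable fun y : ℝ × S => y.1 + γ * supportPt γ K k := fun k => by fun_prop
  have hp : ∀ s k, Integrable (fun y : ℝ × S => pmfVal φ Θ y.2 k) (rewardStep P π s) :=
    fun s k => Integrable.of_bound
      ((measurable_pmfVal hφm Θ k).comp measurable_snd).aestronglyMeasurable M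
      (Filter.Eventually.of_forall fun y => hM _ _)
  have he : ∀ (B : Set ℝ) k (y : ℝ × S),
      pmfVal φ Θ y.2 k * B.indicator 1 (y.1 + γ * supportPt γ K k)
      = ((fun y : ℝ × S => y.1 + γ * supportPt γ K k) ⁻¹' B).indicator
          (fun y : ℝ × S => pmfVal φ Θ y.2 k) y := by
    intro B k y
    by_cases h : y.1 + γ * supportPt γ K k ∈ B <;> simp [indicator, h]
  refine ⟨fun s => ∑ k ∈ Finset.range (K + 1), VectorMeasure.map
    ((rewardStep P π s).withDensityᵥ fun y => pmfVal φ Θ y.2 k)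
    (fun y => y.1 + γ * supportPt γ K k), fun s B hB => ?_⟩
  have hi : ∀ k ∈ Finset.range (K + 1), Integrable (fun y : ℝ × S =>
      pmfVal φ Θ y.2 k * B.indicator 1 (y.1 + γ * supportPt γ K k)) (rewardStep P π s) := by
    intro k _
    simp only [he]
    exact (hp s k).indicator (hm k hB)
  simp only [map_etaOf_apply _ _ _ hB]
  refine ⟨integrable_finsetSum _ hi, ?_⟩
  rw [FunLike.coe_sum, Finset.sum_apply, integral_finsetSum _ hi]
  refine Finset.sum_congr rfl fun k _ => ?_
  rw [VectorMeasure.map_apply _ (hm k) hB, withDensityᵥ_apply (hp s k) (hm k hB)]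
  simp only [he]
  rw [integral_indicator (hm k hB)]

end FixedPoint

section Optimality

variable {S A : Type*} [MeasurableSpace S] [MeasurableSpace A] {d K : ℕ} {γ : ℝ}
  {φ : S → EuclideanSpace ℝ (Fin d)}
  {P : Kernel (S × A) (ℝ × S)} [IsMarkovKernel P] {π : Kernel S A} [IsMarkovKernel π]
  {μ : Measure S} [IsProbabilityMeasure μ]

lemma integrable_sum_mul_of_bounded {X : Type*} [MeasurableSpace X] {ν : Measure X}
    [IsFiniteMeasure ν] {f g : X → Fin K → ℝ} {M N : ℝ} (hf : ∀ k, Measurable fun x => f x k)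
    (hg : ∀ k, Measurable fun x => g x k) (hfM : ∀ x k, |f x k| ≤ M) (hgN : ∀ x k, |g x k| ≤ N) :
    Integrable (fun x => ∑ k, f x k * g x k) ν := by
  refine integrable_finsetSum _ fun k _ => Integrable.of_bound
    ((hf k).mul (hg k)).aestronglyMeasurable (M * N) (Filter.Eventually.of_forall fun x => ?_)
  rw [Real.norm_eq_abs, abs_mul]
  have h1 := hfM x k
  have h2 := hgN x k
  have h3 : 0 ≤ M := (abs_nonneg _).trans h1
  gcongr

omit [MeasurableSpace S] in
lemma exists_vecMul_bound (hφ : ∀ s, ‖φ s‖ ≤ 1) (Θ : Matrix (Fin d) (Fin K) ℝ) :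
    ∃ M : ℝ, ∀ s k, |((φ s).ofLp ᵥ* Θ) k| ≤ M :=
  ⟨∑ j, ∑ i, |Θ i j|, fun s k => (abs_vecMul_le hφ s Θ k).trans
    (Finset.single_le_sum (f := fun j => ∑ i, |Θ i j|)
      (fun _ _ => Finset.sum_nonneg fun _ _ => abs_nonneg _) (Finset.mem_univ k))⟩

lemma eq_zero_of_forall_quadratic_nonneg {l n : ℝ} (hn : 0 ≤ n)
    (h : ∀ t : ℝ, 0 ≤ 2 * (t * l) + t ^ 2 * n) : l = 0 := by
  have h1 := h (-l / (n + 1))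
  have hpos : 0 < n + 1 := by linarith
  have h2 : 2 * (-l / (n + 1) * l) + (-l / (n + 1)) ^ 2 * n = -(l ^ 2 * (n + 2)) / (n + 1) ^ 2 := by
    field_simp; ring
  rw [h2, le_div_iff₀ (by positivity)] at h1
  have h3 : l ^ 2 ≤ 0 := by nlinarith [sq_nonneg l]
  exact pow_eq_zero_iff (two_ne_zero) |>.1 (le_antisymm h3 (sq_nonneg l))

/-- First-order optimality: the projected Bellman equation says that the mean residual is
orthogonal to all linear functions of the features. -/
lemma isProjectedFixedPoint_iff (hγ : γ ∈ Ioo (0 : ℝ) 1) (hK : 0 < K)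
    (hP : ∀ z : S × A, ∀ᵐ y ∂(P z), y.1 ∈ Icc (0 : ℝ) 1)
    (hφm : Measurable φ) (hφ : ∀ s, ‖φ s‖ ≤ 1) (Θ : Matrix (Fin d) (Fin K) ℝ) :
    IsProjectedFixedPoint γ P π μ φ Θ ↔ ∀ Ξ : Matrix (Fin d) (Fin K) ℝ,
      ∫ s, ∑ k, ((φ s).ofLp ᵥ* Ξ) k * meanResidual γ P π φ Θ s k ∂μ = 0 := by
  have hg := gap_pos hγ hK
  set m : S → Fin K → ℝ := meanResidual γ P π φ Θ with hm
  have hmm : ∀ k, Measurable fun s => m s k := measurable_meanResidual hφm Θ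
  have hmb : ∀ s k, |m s k| ≤ _ := abs_meanResidual_le (P := P) (π := π) (γ := γ) hφ Θ
  have iρ : Integrable (fun s => ∑ k, m s k * m s k) μ :=
    integrable_sum_mul_of_bounded hmm hmm hmb hmb
  have iL : ∀ Ξ : Matrix (Fin d) (Fin K) ℝ,
      Integrable (fun s => ∑ k, ((φ s).ofLp ᵥ* Ξ) k * m s k) μ := fun Ξ => by
    obtain ⟨M, hM⟩ := exists_vecMul_bound hφ Ξ
    exact integrable_sum_mul_of_bounded (measurable_vecMul hφm Ξ) hmm hM hmb
  have iN : ∀ Ξ : Matrix (Fin d) (Fin K) ℝ,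
      Integrable (fun s => ∑ k, ((φ s).ofLp ᵥ* Ξ) k * ((φ s).ofLp ᵥ* Ξ) k) μ := fun Ξ => by
    obtain ⟨M, hM⟩ := exists_vecMul_bound hφ Ξ
    exact integrable_sum_mul_of_bounded (measurable_vecMul hφm Ξ) (measurable_vecMul hφm Ξ) hM hM
  have hexp : ∀ (Ξ : Matrix (Fin d) (Fin K) ℝ) s, ∑ k, (((φ s).ofLp ᵥ* Ξ) k + m s k) ^ 2
      = ∑ k, m s k * m s k + 2 * ∑ k, ((φ s).ofLp ᵥ* Ξ) k * m s k
        + 1 * ∑ k, ((φ s).ofLp ᵥ* Ξ) k * ((φ s).ofLp ᵥ* Ξ) k := by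
    intro Ξ s
    rw [Finset.mul_sum, Finset.mul_sum, ← Finset.sum_add_distrib, ← Finset.sum_add_distrib]
    exact Finset.sum_congr rfl fun k _ => by ring
  have iQ : ∀ Ξ : Matrix (Fin d) (Fin K) ℝ,
      Integrable (fun s => ∑ k, (((φ s).ofLp ᵥ* Ξ) k + m s k) ^ 2) μ := fun Ξ => by
    simp only [hexp]
    exact (iρ.add ((iL Ξ).const_mul 2)).add ((iN Ξ).const_mul 1)
  have hQ : ∀ Ξ : Matrix (Fin d) (Fin K) ℝ, ∫ s, ∑ k, (((φ s).ofLp ᵥ* Ξ) k + m s k) ^ 2 ∂μ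
      = ∫ s, ∑ k, m s k * m s k ∂μ + 2 * ∫ s, ∑ k, ((φ s).ofLp ᵥ* Ξ) k * m s k ∂μ
        + 1 * ∫ s, ∑ k, ((φ s).ofLp ᵥ* Ξ) k * ((φ s).ofLp ᵥ* Ξ) k ∂μ := fun Ξ => by
    simp only [hexp]
    exact integral_linear_comb iρ (iL Ξ) (iN Ξ) 2 1
  have hN0 : ∀ Ξ : Matrix (Fin d) (Fin K) ℝ,
      0 ≤ ∫ s, ∑ k, ((φ s).ofLp ᵥ* Ξ) k * ((φ s).ofLp ᵥ* Ξ) k ∂μ := fun Ξ =>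
    integral_nonneg fun s => Finset.sum_nonneg fun k _ => mul_self_nonneg _
  -- Comparing distances to a Bellman image amounts to comparing two quadratic functions.
  have hcmp : ∀ ζ, IsBellmanImage γ P π (etaOf γ φ Θ) ζ → ∀ Θ' : Matrix (Fin d) (Fin K) ℝ,
      cramerw γ μ ζ (etaOf γ φ Θ) ≤ cramerw γ μ ζ (etaOf γ φ Θ')
        ↔ 0 ≤ 2 * ∫ s, ∑ k, ((φ s).ofLp ᵥ* (Θ' - Θ)) k * m s k ∂μ
          + ∫ s, ∑ k, ((φ s).ofLp ᵥ* (Θ' - Θ)) k * ((φ s).ofLp ᵥ* (Θ' - Θ)) k ∂μ := by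
    intro ζ hζ Θ'
    obtain ⟨R, C, hC, hRC, hdec⟩ := cramer_sq_bellmanImage hγ hK hP hφm hφ hζ
    have hRfin : ∫⁻ s, R s ∂μ ≠ ∞ := by
      refine ((lintegral_mono hRC).trans_lt ?_).ne
      simpa using lt_top_iff_ne_top.2 hC
    have hJ : ∀ Θ'' : Matrix (Fin d) (Fin K) ℝ,
        ∫⁻ s, cramer γ (ζ s) (etaOf γ φ Θ'' s) ^ 2 ∂μ = ∫⁻ s, R s ∂μ
          + ENNReal.ofReal (gap γ K *
            ∫ s, ∑ k, (((φ s).ofLp ᵥ* (Θ'' - Θ)) k + m s k) ^ 2 ∂μ) := by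
      intro Θ''
      simp only [hdec]
      rw [lintegral_add_right, ← integral_const_mul, ofReal_integral_eq_lintegral_ofReal
        ((iQ _).const_mul _)]
      · exact Filter.Eventually.of_forall fun s =>
          mul_nonneg hg.le (Finset.sum_nonneg fun k _ => sq_nonneg _)
      · exact ((Finset.measurable_sum _ fun k _ =>
          ((measurable_vecMul hφm _ k).add (hmm k)).pow_const 2).const_mul _).ennreal_ofReal
    have hQnn : ∀ Ξ : Matrix (Fin d) (Fin K) ℝ,
        0 ≤ ∫ s, ∑ k, (((φ s).ofLp ᵥ* Ξ) k + m s k) ^ 2 ∂μ := fun Ξ =>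
      integral_nonneg fun s => Finset.sum_nonneg fun k _ => sq_nonneg _
    unfold cramerw
    rw [ENNReal.rpow_le_rpow_iff (by norm_num), hJ, hJ, ENNReal.add_le_add_iff_left hRfin,
      ENNReal.ofReal_le_ofReal_iff (mul_nonneg hg.le (hQnn _)), mul_le_mul_iff_right₀ hg,
      hQ, hQ, sub_self]
    simp only [Matrix.vecMul_zero, Pi.zero_apply, zero_mul, Finset.sum_const_zero, integral_zero]
    constructor <;> intro h <;> linarith
  constructor
  · rintro ⟨ζ, hζ, hmin⟩ Ξ
    refine eq_zero_of_forall_quadratic_nonneg (hN0 Ξ) fun t => ?_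
    have h := (hcmp ζ hζ (Θ + t • Ξ)).1 (hmin _)
    simp only [add_sub_cancel_left, Matrix.vecMul_smul, Pi.smul_apply, smul_eq_mul] at h
    have e1 : ∀ s, ∑ k, t * ((φ s).ofLp ᵥ* Ξ) k * m s k
        = t * ∑ k, ((φ s).ofLp ᵥ* Ξ) k * m s k := fun s => by
      rw [Finset.mul_sum]; exact Finset.sum_congr rfl fun k _ => by ring
    have e2 : ∀ s, ∑ k, t * ((φ s).ofLp ᵥ* Ξ) k * (t * ((φ s).ofLp ᵥ* Ξ) k)
        = t ^ 2 * ∑ k, ((φ s).ofLp ᵥ* Ξ) k * ((φ s).ofLp ᵥ* Ξ) k := fun s => by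
      rw [Finset.mul_sum]; exact Finset.sum_congr rfl fun k _ => by ring
    simpa only [e1, e2, integral_const_mul] using h
  · intro hL
    obtain ⟨ζ, hζ⟩ := exists_isBellmanImage (P := P) (π := π) (γ := γ) hφm hφ Θ
    refine ⟨ζ, hζ, fun Θ' => (hcmp ζ hζ Θ').2 ?_⟩
    rw [hL, mul_zero, zero_add]
    exact hN0 _

lemma integral_sum_mul_meanResidual (hφm : Measurable φ) (hφ : ∀ s, ‖φ s‖ ≤ 1)
    (Θ Ξ : Matrix (Fin d) (Fin K) ℝ) :
    ∫ s, ∑ k, ((φ s).ofLp ᵥ* Ξ) k * meanResidual γ P π φ Θ s k ∂μ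
      = ∫ x, ∑ k, ((φ x.1.1).ofLp ᵥ* Ξ) k * residual γ φ x.1.1 x.2 Θ k ∂(sampleLaw P π μ) := by
  obtain ⟨M, hM⟩ := exists_vecMul_bound hφ Ξ
  have h1 : ∀ k, Measurable fun p : S × (ℝ × S) => ((φ p.1).ofLp ᵥ* Ξ) k := fun k =>
    (measurable_vecMul hφm Ξ k).comp measurable_fst
  have h2 : ∀ k, Measurable fun p : S × (ℝ × S) => residual γ φ p.1 p.2 Θ k := fun k =>
    measurable_residual (Θ := fun _ => Θ) hφm measurable_fst measurable_snd
      (fun _ _ => measurable_const) k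
  have hproj : Measurable fun x : (S × A) × (ℝ × S) => (x.1.1, x.2) := by fun_prop
  have key := integral_sampleLaw P π μ
    (f := fun p => ∑ k, ((φ p.1).ofLp ᵥ* Ξ) k * residual γ φ p.1 p.2 Θ k)
    (Finset.measurable_sum _ fun k _ => (h1 k).mul (h2 k))
    (integrable_sum_mul_of_bounded (fun k => (h1 k).comp hproj) (fun k => (h2 k).comp hproj)
      (fun x k => hM _ k) (fun x k => abs_residual_le hφ _ _ Θ k))
  rw [key]
  refine integral_congr_ae (Filter.Eventually.of_forall fun s => ?_)
  simp only
  rw [integral_finsetSum _ fun k _ => (integrable_residual hφm hφ Θ s k).const_mul _]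
  simp only [integral_const_mul, meanResidual]

end Optimality

/-! ### The parameter space as a Euclidean space -/

section Vectorization

variable {d K : ℕ}

/-- Vectorization `Θ ↦ θ = vec(Θ)`, onto `ℝ^{dK}` with the Euclidean norm. -/
def vecE : Matrix (Fin d) (Fin K) ℝ ≃ₗ[ℝ] EuclideanSpace ℝ (Fin K × Fin d) where
  toFun Θ := WithLp.toLp 2 Θ.vec
  invFun θ := Matrix.of fun i k => θ (k, i)
  map_add' _ _ := rfl
  map_smul' _ _ := rfl
  left_inv _ := rfl
  right_inv _ := rfl

lemma vecE_apply (Θ : Matrix (Fin d) (Fin K) ℝ) (p : Fin K × Fin d) : vecE Θ p = Θ p.2 p.1 := rfl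

lemma vecE_symm_apply (θ : EuclideanSpace ℝ (Fin K × Fin d)) (i : Fin d) (k : Fin K) :
    vecE.symm θ i k = θ (k, i) := rfl

lemma inner_vecE_vecMulVec (Ξ : Matrix (Fin d) (Fin K) ℝ) (u : Fin d → ℝ) (v : Fin K → ℝ) :
    inner ℝ (vecE Ξ) (vecE (Matrix.vecMulVec u v)) = ∑ k, (u ᵥ* Ξ) k * v k := by
  simp only [PiLp.inner_apply, Fintype.sum_prod_type, vecE_apply, Matrix.vecMulVec_apply,
    Matrix.vecMul, dotProduct, Finset.sum_mul]
  refine Finset.sum_congr rfl fun k _ => Finset.sum_congr rfl fun i _ => ?_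
  simp [mul_comm, mul_left_comm]

lemma norm_vecE_vecMulVec_sq_le {u : EuclideanSpace ℝ (Fin d)} (hu : ‖u‖ ≤ 1) (v : Fin K → ℝ) :
    ‖vecE (Matrix.vecMulVec u.ofLp v)‖ ^ 2 ≤ ∑ k, v k ^ 2 := by
  have h1 : ‖vecE (Matrix.vecMulVec u.ofLp v)‖ ^ 2 = ∑ k, v k ^ 2 * ‖u‖ ^ 2 := by
    rw [EuclideanSpace.real_norm_sq_eq, EuclideanSpace.real_norm_sq_eq, Fintype.sum_prod_type]
    refine Finset.sum_congr rfl fun k _ => ?_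
    rw [Finset.mul_sum]
    refine Finset.sum_congr rfl fun i _ => ?_
    simp only [vecE_apply, Matrix.vecMulVec_apply]
    ring
  rw [h1]
  refine Finset.sum_le_sum fun k _ => mul_le_of_le_one_right (sq_nonneg _) ?_
  exact pow_le_one₀ (norm_nonneg _) hu

lemma sum_sq_vecMul_le {u : EuclideanSpace ℝ (Fin d)} (hu : ‖u‖ ≤ 1)
    (θ : EuclideanSpace ℝ (Fin K × Fin d)) :
    ∑ k, (u.ofLp ᵥ* vecE.symm θ) k ^ 2 ≤ ‖θ‖ ^ 2 := by
  rw [EuclideanSpace.real_norm_sq_eq, Fintype.sum_prod_type]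
  refine Finset.sum_le_sum fun k _ => ?_
  have h := Finset.sum_mul_sq_le_sq_mul_sq Finset.univ (fun i => u i) (fun i => θ (k, i))
  have hu2 : ∑ i, u i ^ 2 ≤ 1 := by
    rw [← EuclideanSpace.real_norm_sq_eq]; exact pow_le_one₀ (norm_nonneg _) hu
  exact h.trans (mul_le_of_le_one_left (Finset.sum_nonneg fun i _ => sq_nonneg _) hu2)

lemma sum_abs_vecE_symm_le (θ : EuclideanSpace ℝ (Fin K × Fin d)) :
    ∑ j, ∑ i, |vecE.symm θ i j| ≤ (K * d : ℕ) * ‖θ‖ := by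
  have h : ∀ (j : Fin K) (i : Fin d), |vecE.symm θ i j| ≤ ‖θ‖ := fun j i => by
    rw [vecE_symm_apply, ← Real.norm_eq_abs]; exact PiLp.norm_apply_le θ (j, i)
  calc ∑ j, ∑ i, |vecE.symm θ i j| ≤ ∑ _j : Fin K, ∑ _i : Fin d, ‖θ‖ :=
        Finset.sum_le_sum fun j _ => Finset.sum_le_sum fun i _ => h j i
    _ = (K * d : ℕ) * ‖θ‖ := by simp; ring

/-- The smallest eigenvalue bounds the Rayleigh quotient from below. -/
lemma iInf_eigenvalues_mul_le {B : Matrix (Fin d) (Fin d) ℝ} (hB : B.IsHermitian)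
    (u : Fin d → ℝ) : (⨅ i, hB.eigenvalues i) * ∑ i, u i ^ 2 ≤ u ⬝ᵥ (B *ᵥ u) := by
  set b := hB.eigenvectorBasis with hb
  set w : EuclideanSpace ℝ (Fin d) := WithLp.toLp 2 u with hw
  have h1 : ∑ i, u i ^ 2 = ∑ i, inner ℝ (b i) w ^ 2 := by
    have h := b.sum_sq_norm_inner_right w
    rw [EuclideanSpace.real_norm_sq_eq] at h
    simpa [hw] using h.symm
  have hsymm : ∀ x y : Fin d → ℝ, x ⬝ᵥ (B *ᵥ y) = (B *ᵥ x) ⬝ᵥ y := by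
    intro x y
    have hBt : Bᵀ = B := by rw [← Matrix.conjTranspose_eq_transpose_of_trivial]; exact hB
    rw [Matrix.dotProduct_mulVec, ← Matrix.mulVec_transpose, hBt]
  have h2 : u ⬝ᵥ (B *ᵥ u) = ∑ i, hB.eigenvalues i * inner ℝ (b i) w ^ 2 := by
    have h3 : u ⬝ᵥ (B *ᵥ u) = inner ℝ w (WithLp.toLp 2 (B *ᵥ u) : EuclideanSpace ℝ (Fin d)) := by
      rw [hw, EuclideanSpace.inner_toLp_toLp, dotProduct_comm]; rfl
    rw [h3, ← b.sum_inner_mul_inner]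
    refine Finset.sum_congr rfl fun i _ => ?_
    have h4 : inner ℝ (b i) (WithLp.toLp 2 (B *ᵥ u) : EuclideanSpace ℝ (Fin d))
        = hB.eigenvalues i * inner ℝ (b i) w := by
      have h5 : ∀ (x : EuclideanSpace ℝ (Fin d)) (y : Fin d → ℝ),
          inner ℝ x (WithLp.toLp 2 y : EuclideanSpace ℝ (Fin d)) = x.ofLp ⬝ᵥ y := by
        intro x y
        rw [dotProduct_comm]; rfl
      rw [h5, hsymm, hB.mulVec_eigenvectorBasis, smul_dotProduct, hw, h5, smul_eq_mul]
    rw [h4, real_inner_comm]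
    ring
  rw [h1, h2, Finset.mul_sum]
  refine Finset.sum_le_sum fun i _ => mul_le_mul_of_nonneg_right ?_ (sq_nonneg _)
  exact ciInf_le (Set.finite_range _).bddBelow i

end Vectorization

/-! ### The seminorm of the feature covariance -/

section FeatureNorm

variable {S : Type*} [MeasurableSpace S] {d K : ℕ} {φ : S → EuclideanSpace ℝ (Fin d)}
  {μ : Measure S}

/-- The quadratic form `E_{s ∼ μ} ‖φ(s)ᵀΘ‖² = θᵀ (I_K ⊗ Σ_φ) θ`. -/
def featSq (μ : Measure S) (φ : S → EuclideanSpace ℝ (Fin d))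
    (θ : EuclideanSpace ℝ (Fin K × Fin d)) : ℝ :=
  ∫ s, ∑ k, ((φ s).ofLp ᵥ* vecE.symm θ) k ^ 2 ∂μ

lemma featSq_nonneg (μ : Measure S) (φ : S → EuclideanSpace ℝ (Fin d))
    (θ : EuclideanSpace ℝ (Fin K × Fin d)) : 0 ≤ featSq μ φ θ :=
  integral_nonneg fun _ => Finset.sum_nonneg fun _ _ => sq_nonneg _

lemma measurable_sum_sq_vecMul (hφm : Measurable φ) (Θ : Matrix (Fin d) (Fin K) ℝ) :
    Measurable fun s => ∑ k, ((φ s).ofLp ᵥ* Θ) k ^ 2 :=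
  Finset.measurable_sum _ fun k _ => (measurable_vecMul hφm Θ k).pow_const 2

variable [IsProbabilityMeasure μ]

lemma integrable_sum_sq_vecMul (hφm : Measurable φ) (hφ : ∀ s, ‖φ s‖ ≤ 1)
    (Θ : Matrix (Fin d) (Fin K) ℝ) : Integrable (fun s => ∑ k, ((φ s).ofLp ᵥ* Θ) k ^ 2) μ := by
  refine Integrable.of_bound (measurable_sum_sq_vecMul hφm Θ).aestronglyMeasurable
    (‖vecE Θ‖ ^ 2) (Filter.Eventually.of_forall fun s => ?_)
  rw [Real.norm_eq_abs, abs_of_nonneg (Finset.sum_nonneg fun _ _ => sq_nonneg _)]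
  simpa using sum_sq_vecMul_le (hφ s) (vecE Θ)

lemma featSq_le (hφm : Measurable φ) (hφ : ∀ s, ‖φ s‖ ≤ 1)
    (θ : EuclideanSpace ℝ (Fin K × Fin d)) : featSq μ φ θ ≤ ‖θ‖ ^ 2 := by
  have h := integral_mono (integrable_sum_sq_vecMul (μ := μ) hφm hφ (vecE.symm θ))
    (integrable_const (‖θ‖ ^ 2)) fun s => sum_sq_vecMul_le (hφ s) θ
  simpa [featSq] using h

lemma featSq_eq_sum (hφm : Measurable φ) (hφ : ∀ s, ‖φ s‖ ≤ 1)
    (θ : EuclideanSpace ℝ (Fin K × Fin d)) :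
    featSq μ φ θ = ∑ k, (fun i => θ (k, i)) ⬝ᵥ (featCov μ φ *ᵥ fun i => θ (k, i)) := by
  have hij : ∀ i j, Integrable (fun s => φ s i * φ s j) μ := fun i j =>
    Integrable.of_bound ((measurable_feature hφm i).mul
      (measurable_feature hφm j)).aestronglyMeasurable 1 (Filter.Eventually.of_forall fun s => by
        rw [Real.norm_eq_abs, abs_mul]
        exact mul_le_one₀ (abs_feature_le hφ s i) (abs_nonneg _) (abs_feature_le hφ s j))
  have he : ∀ (k : Fin K) s, ((φ s).ofLp ᵥ* vecE.symm θ) k ^ 2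
      = ∑ i, ∑ j, (θ (k, i) * θ (k, j)) * (φ s i * φ s j) := by
    intro k s
    rw [sq, Matrix.vecMul, dotProduct, Finset.sum_mul_sum]
    refine Finset.sum_congr rfl fun i _ => Finset.sum_congr rfl fun j _ => ?_
    simp only [vecE_symm_apply]
    ring
  unfold featSq
  simp only [he]
  rw [integral_finsetSum _ fun k _ => integrable_finsetSum _ fun i _ =>
    integrable_finsetSum _ fun j _ => (hij i j).const_mul _]
  refine Finset.sum_congr rfl fun k _ => ?_
  rw [integral_finsetSum _ fun i _ => integrable_finsetSum _ fun j _ => (hij i j).const_mul _]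
  simp only [dotProduct, Matrix.mulVec]
  refine Finset.sum_congr rfl fun i _ => ?_
  rw [integral_finsetSum _ fun j _ => (hij i j).const_mul _, Finset.mul_sum]
  refine Finset.sum_congr rfl fun j _ => ?_
  rw [integral_const_mul]
  simp only [featCov, Matrix.of_apply]
  ring

lemma lambdaMin_mul_le (hφm : Measurable φ) (hφ : ∀ s, ‖φ s‖ ≤ 1)
    (θ : EuclideanSpace ℝ (Fin K × Fin d)) :
    lambdaMin μ φ * ‖θ‖ ^ 2 ≤ featSq μ φ θ := by
  rw [featSq_eq_sum hφm hφ, EuclideanSpace.real_norm_sq_eq, Fintype.sum_prod_type,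
    Finset.mul_sum]
  exact Finset.sum_le_sum fun k _ => iInf_eigenvalues_mul_le _ _

lemma lambdaMin_le_one (hφm : Measurable φ) (hφ : ∀ s, ‖φ s‖ ≤ 1) (hlam : 0 < lambdaMin μ φ) :
    lambdaMin μ φ ≤ 1 := by
  -- For `d = 0` the infimum over the empty set of eigenvalues is `0`.
  have hd : 0 < d := by
    rcases Nat.eq_zero_or_pos d with rfl | h
    · simp [lambdaMin] at hlam
    · exact h
  set θ : EuclideanSpace ℝ (Fin 1 × Fin d) := EuclideanSpace.single (0, ⟨0, hd⟩) 1 with hθ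
  have h1 : ‖θ‖ = 1 := by simp [hθ]
  have h2 := (lambdaMin_mul_le (μ := μ) hφm hφ θ).trans (featSq_le hφm hφ θ)
  simpa [h1] using h2

lemma matNorm_kronecker_featCov (hφm : Measurable φ) (hφ : ∀ s, ‖φ s‖ ≤ 1)
    (Θ : Matrix (Fin d) (Fin K) ℝ) :
    matNorm ((1 : Matrix (Fin K) (Fin K) ℝ) ⊗ₖ featCov μ φ) Θ.vec
      = Real.sqrt (featSq μ φ (vecE Θ)) := by
  unfold matNorm
  congr 1
  rw [featSq_eq_sum hφm hφ, Matrix.kronecker_mulVec_vec, Matrix.transpose_one, Matrix.mul_one,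
    dotProduct, Fintype.sum_prod_type]
  rfl

lemma continuous_featSq (hφm : Measurable φ) (hφ : ∀ s, ‖φ s‖ ≤ 1) :
    Continuous (featSq (K := K) μ φ) := by
  have h : featSq (K := K) μ φ
      = fun θ => ∑ k, (fun i => θ (k, i)) ⬝ᵥ (featCov μ φ *ᵥ fun i => θ (k, i)) :=
    funext fun θ => featSq_eq_sum hφm hφ θ
  rw [h]
  simp only [dotProduct, Matrix.mulVec]
  fun_prop

end FeatureNorm

/-! ### The temporal-difference field -/

section TdField

variable {S A : Type*} {d K : ℕ} {γ : ℝ} {φ : S → EuclideanSpace ℝ (Fin d)}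

/-- The negative increment direction `φ(s) ⊗ residual` of one update, as a vector. -/
def tdField (γ : ℝ) (φ : S → EuclideanSpace ℝ (Fin d)) (Θ : Matrix (Fin d) (Fin K) ℝ)
    (x : (S × A) × (ℝ × S)) : EuclideanSpace ℝ (Fin K × Fin d) :=
  vecE (Matrix.vecMulVec (φ x.1.1).ofLp (residual γ φ x.1.1 x.2 Θ))

/-- The linear part of `tdField`. -/
def tdLinear (γ : ℝ) (φ : S → EuclideanSpace ℝ (Fin d)) (Δ : Matrix (Fin d) (Fin K) ℝ)
    (x : (S × A) × (ℝ × S)) : EuclideanSpace ℝ (Fin K × Fin d) :=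
  vecE (Matrix.vecMulVec (φ x.1.1).ofLp
    ((φ x.1.1).ofLp ᵥ* Δ - bellmanMat γ K x.2.1 *ᵥ ((φ x.2.2).ofLp ᵥ* Δ)))

lemma tdField_add (Θ Δ : Matrix (Fin d) (Fin K) ℝ) (x : (S × A) × (ℝ × S)) :
    tdField γ φ (Θ + Δ) x = tdField γ φ Θ x + tdLinear γ φ Δ x := by
  unfold tdField tdLinear
  rw [residual_add, Matrix.vecMulVec_add, map_add]

lemma tdLinear_add (Δ Δ' : Matrix (Fin d) (Fin K) ℝ) (x : (S × A) × (ℝ × S)) :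
    tdLinear γ φ (Δ + Δ') x = tdLinear γ φ Δ x + tdLinear γ φ Δ' x := by
  unfold tdLinear
  rw [← map_add, ← Matrix.vecMulVec_add, Matrix.vecMul_add, Matrix.vecMul_add, Matrix.mulVec_add]
  congr 2
  abel

lemma tdLinear_smul (c : ℝ) (Δ : Matrix (Fin d) (Fin K) ℝ) (x : (S × A) × (ℝ × S)) :
    tdLinear γ φ (c • Δ) x = c • tdLinear γ φ Δ x := by
  unfold tdLinear
  rw [← map_smul, ← Matrix.vecMulVec_smul, Matrix.vecMul_smul, Matrix.vecMul_smul,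
    Matrix.mulVec_smul, smul_sub]

lemma norm_tdField_le (hφ : ∀ s, ‖φ s‖ ≤ 1) (Θ : Matrix (Fin d) (Fin K) ℝ)
    (x : (S × A) × (ℝ × S)) :
    ‖tdField γ φ Θ x‖ ≤ Real.sqrt K * (2 * ∑ j, ∑ i, |Θ i j| + 1) := by
  have hB : 0 ≤ 2 * ∑ j, ∑ i, |Θ i j| + 1 := by positivity
  refine le_of_sq_le_sq ?_ (by positivity)
  calc ‖tdField γ φ Θ x‖ ^ 2 ≤ ∑ k, residual γ φ x.1.1 x.2 Θ k ^ 2 :=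
        norm_vecE_vecMulVec_sq_le (hφ _) _
    _ ≤ ∑ _k : Fin K, (2 * ∑ j, ∑ i, |Θ i j| + 1) ^ 2 := by
        refine Finset.sum_le_sum fun k _ => ?_
        rw [← sq_abs]
        have := abs_residual_le (γ := γ) hφ x.1.1 x.2 Θ k
        gcongr
    _ = (Real.sqrt K * (2 * ∑ j, ∑ i, |Θ i j| + 1)) ^ 2 := by
        rw [mul_pow, Real.sq_sqrt (Nat.cast_nonneg K)]
        simp

lemma sum_sq_linear_residual_le (hγ : γ ∈ Ioo (0 : ℝ) 1) {r : ℝ} (hr : r ∈ Icc (0 : ℝ) 1)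
    (u v : Fin K → ℝ) : ∑ k, (u - bellmanMat γ K r *ᵥ v) k ^ 2
      ≤ 2 * (∑ k, u k ^ 2 + ∑ k, v k ^ 2) := by
  have h1 := sum_sq_bellmanMat_mulVec_le hγ hr v
  have h2 : γ * ∑ k, v k ^ 2 ≤ 1 * ∑ k, v k ^ 2 := by gcongr; exact hγ.2.le
  have h3 : ∑ k, (u - bellmanMat γ K r *ᵥ v) k ^ 2
      ≤ ∑ k, (2 * u k ^ 2 + 2 * (bellmanMat γ K r *ᵥ v) k ^ 2) := by
    refine Finset.sum_le_sum fun k _ => ?_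
    simp only [Pi.sub_apply]
    nlinarith [sq_nonneg (u k + (bellmanMat γ K r *ᵥ v) k)]
  rw [Finset.sum_add_distrib, ← Finset.mul_sum, ← Finset.mul_sum] at h3
  linarith

/-- Young's inequality and the contraction `√γ` of the Bellman backup. -/
lemma sum_mul_linear_residual_ge (hγ : γ ∈ Ioo (0 : ℝ) 1) {r : ℝ} (hr : r ∈ Icc (0 : ℝ) 1)
    (u v : Fin K → ℝ) : (1 - Real.sqrt γ / 2) * ∑ k, u k ^ 2 - Real.sqrt γ / 2 * ∑ k, v k ^ 2
      ≤ ∑ k, u k * (u - bellmanMat γ K r *ᵥ v) k := by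
  have hs : 0 < Real.sqrt γ := Real.sqrt_pos.2 hγ.1
  have hss : Real.sqrt γ * Real.sqrt γ = γ := Real.mul_self_sqrt hγ.1.le
  have h1 := sum_sq_bellmanMat_mulVec_le hγ hr v
  set w := bellmanMat γ K r *ᵥ v
  have h2 : ∑ k, ((1 - Real.sqrt γ / 2) * u k ^ 2 - (Real.sqrt γ)⁻¹ / 2 * w k ^ 2)
      ≤ ∑ k, u k * (u - w) k := by
    refine Finset.sum_le_sum fun k _ => ?_
    simp only [Pi.sub_apply]
    have h3 : u k * w k ≤ Real.sqrt γ / 2 * u k ^ 2 + (Real.sqrt γ)⁻¹ / 2 * w k ^ 2 := by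
      have h4 : 0 ≤ (Real.sqrt γ)⁻¹ / 2 * (Real.sqrt γ * u k - w k) ^ 2 := by positivity
      have h5 : (Real.sqrt γ)⁻¹ / 2 * (Real.sqrt γ * u k - w k) ^ 2
          = Real.sqrt γ / 2 * u k ^ 2 + (Real.sqrt γ)⁻¹ / 2 * w k ^ 2 - u k * w k := by
        field_simp; ring
      linarith
    nlinarith
  rw [Finset.sum_sub_distrib, ← Finset.mul_sum, ← Finset.mul_sum] at h2
  have h6 : (Real.sqrt γ)⁻¹ / 2 * ∑ k, w k ^ 2 ≤ Real.sqrt γ / 2 * ∑ k, v k ^ 2 := by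
    calc (Real.sqrt γ)⁻¹ / 2 * ∑ k, w k ^ 2 ≤ (Real.sqrt γ)⁻¹ / 2 * (γ * ∑ k, v k ^ 2) := by gcongr
      _ = (Real.sqrt γ)⁻¹ / 2 * (Real.sqrt γ * Real.sqrt γ * ∑ k, v k ^ 2) := by rw [hss]
      _ = Real.sqrt γ / 2 * ∑ k, v k ^ 2 := by field_simp
  linarith

/-- The noise level: the offset contributes `K (1 - γ)²`, without a power of `(1 - γ)⁻¹`. -/
lemma sum_sq_residual_le (hγ : γ ∈ Ioo (0 : ℝ) 1) {y : ℝ × S} (hy : y.1 ∈ Icc (0 : ℝ) 1) (s : S)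
    (Θ : Matrix (Fin d) (Fin K) ℝ) : ∑ k, residual γ φ s y Θ k ^ 2
      ≤ 3 * (∑ k, ((φ s).ofLp ᵥ* Θ) k ^ 2 + ∑ k, ((φ y.2).ofLp ᵥ* Θ) k ^ 2
        + K * (1 - γ) ^ 2) := by
  set u := (φ s).ofLp ᵥ* Θ
  set v := (φ y.2).ofLp ᵥ* Θ
  set w := bellmanMat γ K y.1 *ᵥ v
  have h1 : ∑ k, w k ^ 2 ≤ γ * ∑ k, v k ^ 2 := sum_sq_bellmanMat_mulVec_le hγ hy v
  have h2 : γ * ∑ k, v k ^ 2 ≤ 1 * ∑ k, v k ^ 2 := by gcongr; exact hγ.2.le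
  have h3 : ∑ k, residual γ φ s y Θ k ^ 2
      ≤ ∑ k, (3 * u k ^ 2 + 3 * w k ^ 2 + 3 * (1 - γ) ^ 2) := by
    refine Finset.sum_le_sum fun k _ => ?_
    have h4 : bellmanOffset γ K y.1 k ^ 2 ≤ (1 - γ) ^ 2 := by
      rw [← sq_abs]
      have := abs_bellmanOffset_le hγ hy k
      gcongr
    have h5 : residual γ φ s y Θ k = u k - w k - bellmanOffset γ K y.1 k := rfl
    rw [h5]
    set b := bellmanOffset γ K y.1 k
    nlinarith [sq_nonneg (u k + w k), sq_nonneg (u k + b), sq_nonneg (w k - b)]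
  have h6 : ∑ k, (3 * u k ^ 2 + 3 * w k ^ 2 + 3 * (1 - γ) ^ 2)
      = 3 * ∑ k, u k ^ 2 + 3 * ∑ k, w k ^ 2 + K * (3 * (1 - γ) ^ 2) := by
    simp [Finset.sum_add_distrib, Finset.mul_sum]
  linarith

variable [MeasurableSpace S] [MeasurableSpace A]

lemma measurable_tdField (hφ : Measurable φ) {X : Type*} [MeasurableSpace X]
    {x : X → (S × A) × (ℝ × S)} {Θ : X → Matrix (Fin d) (Fin K) ℝ} (hx : Measurable x)
    (hΘ : ∀ i j, Measurable fun p => Θ p i j) :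
    Measurable fun p => tdField γ φ (Θ p) (x p) := by
  refine (WithLp.measurable_toLp 2 (Fin K × Fin d → ℝ)).comp (measurable_pi_lambda _ fun kp => ?_)
  have hs : Measurable fun p => (x p).1.1 := measurable_fst.comp (measurable_fst.comp hx)
  exact ((measurable_feature hφ kp.2).comp hs).mul
    (measurable_residual hφ hs (measurable_snd.comp hx) hΘ kp.1)

variable {P : Kernel (S × A) (ℝ × S)} [IsMarkovKernel P] {π : Kernel S A} [IsMarkovKernel π]
  {μ : Measure S} [IsProbabilityMeasure μ]

lemma integrable_tdField (hφm : Measurable φ) (hφ : ∀ s, ‖φ s‖ ≤ 1)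
    (Θ : Matrix (Fin d) (Fin K) ℝ) : Integrable (tdField γ φ Θ) (sampleLaw P π μ) :=
  Integrable.of_bound (measurable_tdField (Θ := fun _ => Θ) (x := fun x => x) hφm measurable_id
    fun _ _ => measurable_const).aestronglyMeasurable (Real.sqrt K * (2 * ∑ j, ∑ i, |Θ i j| + 1))
    (Filter.Eventually.of_forall fun x => norm_tdField_le hφ Θ x)

lemma integrable_tdLinear (hφm : Measurable φ) (hφ : ∀ s, ‖φ s‖ ≤ 1)
    (Δ : Matrix (Fin d) (Fin K) ℝ) : Integrable (tdLinear γ φ Δ) (sampleLaw P π μ) := by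
  have h : tdLinear (A := A) γ φ Δ = fun x => tdField γ φ (0 + Δ) x - tdField γ φ 0 x := by
    funext x; rw [tdField_add, add_sub_cancel_left]
  rw [h]
  exact (integrable_tdField hφm hφ _).sub (integrable_tdField hφm hφ _)

/-- The expectation of the linear part of the temporal-difference field, as a linear map. -/
def meanTd (γ : ℝ) (P : Kernel (S × A) (ℝ × S)) [IsMarkovKernel P] (π : Kernel S A)
    [IsMarkovKernel π] (μ : Measure S) [IsProbabilityMeasure μ] (hφm : Measurable φ)
    (hφ : ∀ s, ‖φ s‖ ≤ 1) :
    EuclideanSpace ℝ (Fin K × Fin d) →ₗ[ℝ] EuclideanSpace ℝ (Fin K × Fin d) where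
  toFun θ := ∫ x, tdLinear γ φ (vecE.symm θ) x ∂(sampleLaw P π μ)
  map_add' θ θ' := by
    simp only [map_add, tdLinear_add]
    exact integral_add (integrable_tdLinear hφm hφ _) (integrable_tdLinear hφm hφ _)
  map_smul' c θ := by
    simp only [map_smul, tdLinear_smul, RingHom.id_apply]
    exact integral_smul _ _

lemma integral_tdField_add (hφm : Measurable φ) (hφ : ∀ s, ‖φ s‖ ≤ 1)
    (Θ : Matrix (Fin d) (Fin K) ℝ) (θ : EuclideanSpace ℝ (Fin K × Fin d)) :
    ∫ x, tdField γ φ (Θ + vecE.symm θ) x ∂(sampleLaw P π μ)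
      = ∫ x, tdField γ φ Θ x ∂(sampleLaw P π μ) + meanTd γ P π μ hφm hφ θ := by
  simp only [tdField_add]
  exact integral_add (integrable_tdField hφm hφ _) (integrable_tdLinear hφm hφ _)

/-- Stationarity: the feature seminorm is the same at the current and at the next state. -/
lemma integral_state_nextState (hμ : Kernel.Invariant (rewardStep P π).snd μ)
    (hφm : Measurable φ) (hφ : ∀ s, ‖φ s‖ ≤ 1) (θ : EuclideanSpace ℝ (Fin K × Fin d)) (a b c : ℝ) :
    Integrable (fun x : (S × A) × (ℝ × S) => a * ∑ k, ((φ x.1.1).ofLp ᵥ* vecE.symm θ) k ^ 2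
        + b * ∑ k, ((φ x.2.2).ofLp ᵥ* vecE.symm θ) k ^ 2 + c) (sampleLaw P π μ) ∧
      ∫ x, (a * ∑ k, ((φ x.1.1).ofLp ᵥ* vecE.symm θ) k ^ 2
        + b * ∑ k, ((φ x.2.2).ofLp ᵥ* vecE.symm θ) k ^ 2 + c) ∂(sampleLaw P π μ)
      = (a + b) * featSq μ φ θ + c := by
  have hm := measurable_sum_sq_vecMul hφm (vecE.symm θ)
  have hi := integrable_sum_sq_vecMul (μ := μ) hφm hφ (vecE.symm θ)
  have h1 : Integrable (fun x : (S × A) × (ℝ × S) =>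
      ∑ k, ((φ x.1.1).ofLp ᵥ* vecE.symm θ) k ^ 2) (sampleLaw P π μ) := by
    have hmap := map_state_sampleLaw P π μ
    rw [← hmap] at hi
    exact (integrable_map_measure hm.aestronglyMeasurable (by fun_prop)).1 hi
  have h2 : Integrable (fun x : (S × A) × (ℝ × S) =>
      ∑ k, ((φ x.2.2).ofLp ᵥ* vecE.symm θ) k ^ 2) (sampleLaw P π μ) := by
    have hmap := map_nextState_sampleLaw P π μ hμ
    rw [← hmap] at hi
    exact (integrable_map_measure hm.aestronglyMeasurable (by fun_prop)).1 hi
  have e1 := integral_sampleLaw_state P π μ hm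
  have e2 := integral_sampleLaw_nextState P π μ hμ hm
  have h3 := (h1.const_mul a).add (h2.const_mul b)
  refine ⟨h3.add (integrable_const c), ?_⟩
  have h4 := integral_linear_comb (integrable_const (μ := sampleLaw P π μ) c) h1 h2 a b
  have h5 : ∀ x : (S × A) × (ℝ × S), a * ∑ k, ((φ x.1.1).ofLp ᵥ* vecE.symm θ) k ^ 2
        + b * ∑ k, ((φ x.2.2).ofLp ᵥ* vecE.symm θ) k ^ 2 + c
      = c + a * ∑ k, ((φ x.1.1).ofLp ᵥ* vecE.symm θ) k ^ 2
        + b * ∑ k, ((φ x.2.2).ofLp ᵥ* vecE.symm θ) k ^ 2 := fun x => by ring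
  simp only [h5]
  rw [h4, e1, e2]
  simp only [integral_const, probReal_univ, one_smul, featSq]
  ring

/-- Monotonicity of the mean temporal-difference field. -/
lemma featSq_le_inner_meanTd (hγ : γ ∈ Ioo (0 : ℝ) 1)
    (hP : ∀ z : S × A, ∀ᵐ y ∂(P z), y.1 ∈ Icc (0 : ℝ) 1)
    (hμ : Kernel.Invariant (rewardStep P π).snd μ) (hφm : Measurable φ) (hφ : ∀ s, ‖φ s‖ ≤ 1)
    (θ : EuclideanSpace ℝ (Fin K × Fin d)) :
    (1 - Real.sqrt γ) * featSq μ φ θ ≤ inner ℝ θ (meanTd γ P π μ hφm hφ θ) := by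
  have hi := integrable_tdLinear (P := P) (π := π) (μ := μ) (γ := γ) hφm hφ (vecE.symm θ)
  have h1 : inner ℝ θ (meanTd γ P π μ hφm hφ θ)
      = ∫ x, inner ℝ θ (tdLinear γ φ (vecE.symm θ) x) ∂(sampleLaw P π μ) :=
    (integral_inner hi θ).symm
  obtain ⟨h2, h3⟩ := integral_state_nextState (P := P) (π := π) (μ := μ) hμ hφm hφ θ
    (1 - Real.sqrt γ / 2) (-(Real.sqrt γ / 2)) 0
  have h4 : (1 - Real.sqrt γ) * featSq μ φ θ
      = (1 - Real.sqrt γ / 2 + -(Real.sqrt γ / 2)) * featSq μ φ θ + 0 := by ring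
  rw [h1, h4, ← h3]
  refine integral_mono_ae h2 (hi.const_inner θ) ?_
  filter_upwards [ae_sampleLaw_reward_mem P π μ hP] with x hx
  have h5 := sum_mul_linear_residual_ge hγ hx ((φ x.1.1).ofLp ᵥ* vecE.symm θ)
    ((φ x.2.2).ofLp ᵥ* vecE.symm θ)
  have h6 := inner_vecE_vecMulVec (vecE.symm θ) (φ x.1.1).ofLp
    ((φ x.1.1).ofLp ᵥ* vecE.symm θ - bellmanMat γ K x.2.1 *ᵥ ((φ x.2.2).ofLp ᵥ* vecE.symm θ))
  rw [LinearEquiv.apply_symm_apply] at h6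
  unfold tdLinear
  rw [h6]
  linarith

lemma injective_meanTd (hγ : γ ∈ Ioo (0 : ℝ) 1)
    (hP : ∀ z : S × A, ∀ᵐ y ∂(P z), y.1 ∈ Icc (0 : ℝ) 1)
    (hμ : Kernel.Invariant (rewardStep P π).snd μ) (hφm : Measurable φ) (hφ : ∀ s, ‖φ s‖ ≤ 1)
    (hlam : 0 < lambdaMin μ φ) :
    Function.Injective (meanTd (K := K) γ P π μ hφm hφ) := by
  rw [← LinearMap.ker_eq_bot, LinearMap.ker_eq_bot']
  intro θ hθ
  have h1 := featSq_le_inner_meanTd (K := K) hγ hP hμ hφm hφ θ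
  rw [hθ, inner_zero_right] at h1
  have hs : 0 < 1 - Real.sqrt γ := by
    have : Real.sqrt γ < 1 := (Real.sqrt_lt' one_pos).2 (by simpa using hγ.2)
    linarith
  have h2 := lambdaMin_mul_le (μ := μ) hφm hφ θ
  have h3 : featSq μ φ θ ≤ 0 := by
    by_contra h
    exact absurd h1 (not_le.2 (mul_pos hs (not_le.1 h)))
  have h4 : ‖θ‖ ^ 2 ≤ 0 := by
    by_contra h
    exact absurd (h2.trans h3) (not_le.2 (mul_pos hlam (not_le.1 h)))
  exact norm_eq_zero.1 (pow_eq_zero_iff two_ne_zero |>.1 (le_antisymm h4 (sq_nonneg _)))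

/-- The projected Bellman equation as the zero of the mean temporal-difference field. -/
lemma isProjectedFixedPoint_iff_integral_tdField (hγ : γ ∈ Ioo (0 : ℝ) 1) (hK : 0 < K)
    (hP : ∀ z : S × A, ∀ᵐ y ∂(P z), y.1 ∈ Icc (0 : ℝ) 1)
    (hφm : Measurable φ) (hφ : ∀ s, ‖φ s‖ ≤ 1) (Θ : Matrix (Fin d) (Fin K) ℝ) :
    IsProjectedFixedPoint γ P π μ φ Θ ↔ ∫ x, tdField γ φ Θ x ∂(sampleLaw P π μ) = 0 := by
  have h : ∀ Ξ : Matrix (Fin d) (Fin K) ℝ,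
      ∫ s, ∑ k, ((φ s).ofLp ᵥ* Ξ) k * meanResidual γ P π φ Θ s k ∂μ
        = inner ℝ (vecE Ξ) (∫ x, tdField γ φ Θ x ∂(sampleLaw P π μ)) := by
    intro Ξ
    rw [integral_sum_mul_meanResidual hφm hφ, ← integral_inner (integrable_tdField hφm hφ Θ)]
    simp only [tdField, inner_vecE_vecMulVec]
  rw [isProjectedFixedPoint_iff hγ hK hP hφm hφ]
  simp only [h]
  constructor
  · intro h0
    have := h0 (vecE.symm (∫ x, tdField γ φ Θ x ∂(sampleLaw P π μ)))
    rwa [LinearEquiv.apply_symm_apply, inner_self_eq_zero] at this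
  · intro h0 Ξ
    rw [h0, inner_zero_right]

lemma existsUnique_isProjectedFixedPoint (hγ : γ ∈ Ioo (0 : ℝ) 1) (hK : 0 < K)
    (hP : ∀ z : S × A, ∀ᵐ y ∂(P z), y.1 ∈ Icc (0 : ℝ) 1)
    (hμ : Kernel.Invariant (rewardStep P π).snd μ) (hφm : Measurable φ) (hφ : ∀ s, ‖φ s‖ ≤ 1)
    (hlam : 0 < lambdaMin μ φ) :
    ∃! Θ : Matrix (Fin d) (Fin K) ℝ, IsProjectedFixedPoint γ P π μ φ Θ := by
  have hinj := injective_meanTd (K := K) hγ hP hμ hφm hφ hlam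
  obtain ⟨θ, hθ⟩ := LinearMap.injective_iff_surjective.1 hinj
    (-∫ x, tdField γ φ 0 x ∂(sampleLaw P π μ))
  have hval : ∀ Θ : Matrix (Fin d) (Fin K) ℝ, ∫ x, tdField γ φ Θ x ∂(sampleLaw P π μ)
      = ∫ x, tdField γ φ 0 x ∂(sampleLaw P π μ) + meanTd γ P π μ hφm hφ (vecE Θ) := by
    intro Θ
    have h := integral_tdField_add (P := P) (π := π) (μ := μ) (γ := γ) hφm hφ 0 (vecE Θ)
    rwa [LinearEquiv.symm_apply_apply, zero_add] at h
  simp only [isProjectedFixedPoint_iff_integral_tdField hγ hK hP hφm hφ]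
  refine ⟨vecE.symm θ, ?_, fun Θ hΘ => ?_⟩
  · beta_reduce
    rw [hval, LinearEquiv.apply_symm_apply, hθ, add_neg_cancel]
  · beta_reduce at hΘ
    rw [hval, add_eq_zero_iff_neg_eq, ← hθ] at hΘ
    rw [hinj hΘ, LinearEquiv.symm_apply_apply]

/-- Linear-CTD centred at the solution `Θs` is stochastic approximation for a noisy field with
contraction constant `1 - √γ`. -/
lemma noisyField_tdField (hγ : γ ∈ Ioo (0 : ℝ) 1)
    (hP : ∀ z : S × A, ∀ᵐ y ∂(P z), y.1 ∈ Icc (0 : ℝ) 1)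
    (hμ : Kernel.Invariant (rewardStep P π).snd μ) (hφm : Measurable φ) (hφ : ∀ s, ‖φ s‖ ≤ 1)
    {Θs : Matrix (Fin d) (Fin K) ℝ} (hΘs : ∫ x, tdField γ φ Θs x ∂(sampleLaw P π μ) = 0) :
    NoisyField (sampleLaw P π μ) (fun x θ => tdField γ φ (Θs + vecE.symm θ) x)
      (meanTd γ P π μ hφm hφ) (featSq μ φ) (1 - Real.sqrt γ) (lambdaMin μ φ)
      (6 * featSq μ φ (vecE Θs) + 3 * (K * (1 - γ) ^ 2)) where
  meas := by
    have h : ∀ i j, Measurable fun p : ((S × A) × (ℝ × S)) × EuclideanSpace ℝ (Fin K × Fin d) =>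
        (Θs + vecE.symm p.2) i j := by
      intro i j
      simp only [Matrix.add_apply, vecE_symm_apply]
      fun_prop
    exact measurable_tdField (x := fun p : ((S × A) × (ℝ × S)) ×
      EuclideanSpace ℝ (Fin K × Fin d) => p.1) (Θ := fun p => Θs + vecE.symm p.2) hφm
      measurable_fst h
  bound := by
    refine ⟨Real.sqrt K * (2 * (K * d : ℕ) + (2 * ∑ j, ∑ i, |Θs i j| + 1)), fun x θ => ?_⟩
    refine (norm_tdField_le hφ _ x).trans ?_
    rw [mul_assoc]
    refine mul_le_mul_of_nonneg_left ?_ (Real.sqrt_nonneg _)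
    have h1 : ∑ j, ∑ i, |(Θs + vecE.symm θ) i j|
        ≤ ∑ j, ∑ i, |Θs i j| + ∑ j, ∑ i, |vecE.symm θ i j| := by
      rw [← Finset.sum_add_distrib]
      refine Finset.sum_le_sum fun j _ => ?_
      rw [← Finset.sum_add_distrib]
      exact Finset.sum_le_sum fun i _ => abs_add_le _ _
    have h2 := sum_abs_vecE_symm_le θ
    have h3 : 0 ≤ ∑ j, ∑ i, |Θs i j| := by positivity
    have h4 : 0 ≤ ‖θ‖ := norm_nonneg θ
    have h5 : (0 : ℝ) ≤ (K * d : ℕ) := Nat.cast_nonneg _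
    nlinarith [mul_nonneg h3 h4]
  mean_eq θ := by rw [integral_tdField_add hφm hφ, hΘs, zero_add]
  continuous_q := continuous_featSq hφm hφ
  q_le := featSq_le hφm hφ
  le_q := lambdaMin_mul_le hφm hφ
  drift θ := by
    rw [integral_inner (integrable_tdField hφm hφ _), integral_tdField_add hφm hφ, hΘs, zero_add]
    exact featSq_le_inner_meanTd hγ hP hμ hφm hφ θ
  second_moment θ := by
    obtain ⟨i1, e1⟩ := integral_state_nextState (P := P) (π := π) (μ := μ) hμ hφm hφ θ 4 4 0
    obtain ⟨i2, e2⟩ := integral_state_nextState (P := P) (π := π) (μ := μ) hμ hφm hφ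
      (vecE Θs) 6 6 (6 * (K * (1 - γ) ^ 2))
    rw [LinearEquiv.symm_apply_apply] at i2 e2
    have h1 : 8 * featSq μ φ θ + 2 * (6 * featSq μ φ (vecE Θs) + 3 * (K * (1 - γ) ^ 2))
        = ((4 + 4) * featSq μ φ θ + 0)
          + ((6 + 6) * featSq μ φ (vecE Θs) + 6 * (K * (1 - γ) ^ 2)) := by ring
    rw [h1, ← e1, ← e2, ← integral_add i1 i2]
    refine integral_mono_of_nonneg (Filter.Eventually.of_forall fun x => sq_nonneg _)
      (i1.add i2) ?_
    filter_upwards [ae_sampleLaw_reward_mem P π μ hP] with x hx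
    have h2 := norm_vecE_vecMulVec_sq_le (hφ x.1.1) (residual γ φ x.1.1 x.2 (Θs + vecE.symm θ))
    have h3 := sum_sq_linear_residual_le hγ hx ((φ x.1.1).ofLp ᵥ* vecE.symm θ)
      ((φ x.2.2).ofLp ᵥ* vecE.symm θ)
    have h4 := sum_sq_residual_le (φ := φ) hγ hx x.1.1 Θs
    have h5 : ∑ k, residual γ φ x.1.1 x.2 (Θs + vecE.symm θ) k ^ 2
        ≤ ∑ k, (2 * residual γ φ x.1.1 x.2 Θs k ^ 2 + 2 * ((φ x.1.1).ofLp ᵥ* vecE.symm θ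
          - bellmanMat γ K x.2.1 *ᵥ ((φ x.2.2).ofLp ᵥ* vecE.symm θ)) k ^ 2) := by
      refine Finset.sum_le_sum fun k _ => ?_
      rw [residual_add, Pi.add_apply]
      exact add_sq_le.trans_eq (mul_add _ _ _)
    rw [Finset.sum_add_distrib, ← Finset.mul_sum, ← Finset.mul_sum] at h5
    change ‖vecE (Matrix.vecMulVec (φ x.1.1).ofLp _)‖ ^ 2 ≤ _
    linarith

end TdField

/-! ### From the parameter error to the Wasserstein error -/

section Wasserstein

variable {S : Type*} [MeasurableSpace S] {d K : ℕ} {γ : ℝ} {φ : S → EuclideanSpace ℝ (Fin d)}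
  {μ : Measure S}

omit [MeasurableSpace S] in
lemma W1_etaOf (hγ : γ ∈ Ioo (0 : ℝ) 1) (hK : 0 < K) (Θ Θ' : Matrix (Fin d) (Fin K) ℝ) (s : S) :
    W1 γ (etaOf γ φ Θ s) (etaOf γ φ Θ' s)
      = ENNReal.ofReal (gap γ K * ∑ k, |((φ s).ofLp ᵥ* (Θ' - Θ)) k|) := by
  have hg := gap_pos hγ hK
  rw [W1, lintegral_Icc_eq_sum_cells hγ hK, Finset.mul_sum, ENNReal.ofReal_sum_of_nonneg
    (fun k _ => mul_nonneg hg.le (abs_nonneg _))]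
  refine Finset.sum_congr rfl fun k _ => ?_
  have h1 : ∫⁻ x in Ico (supportPt γ K k) (supportPt γ K (k + 1)),
      ‖cdf (etaOf γ φ Θ s) x - cdf (etaOf γ φ Θ' s) x‖ₑ
      = ∫⁻ _x in Ico (supportPt γ K k) (supportPt γ K (k + 1)),
        ENNReal.ofReal |((φ s).ofLp ᵥ* (Θ' - Θ)) k| :=
    setLIntegral_congr_fun measurableSet_Ico fun x hx => by
      simp only [cdf_etaOf hγ _ s k hx]
      rw [← ofReal_norm, Real.norm_eq_abs, abs_sub_comm]
      congr 2
      simp only [cdfVal, k.2, dif_pos, Matrix.vecMul_sub, Pi.sub_apply]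
      ring
  rw [h1, setLIntegral_const, Real.volume_Ico, supportPt_succ, add_sub_cancel_left, mul_comm,
    ENNReal.ofReal_mul hg.le]

/-- `W₁` is dominated by the Cramér distance, by the Cauchy–Schwarz inequality over the cells. -/
lemma W1w_sq_le [IsProbabilityMeasure μ] (hγ : γ ∈ Ioo (0 : ℝ) 1) (hK : 0 < K)
    (hφm : Measurable φ) (hφ : ∀ s, ‖φ s‖ ≤ 1) (Θ Θ' : Matrix (Fin d) (Fin K) ℝ) :
    W1w γ μ (etaOf γ φ Θ) (etaOf γ φ Θ') ^ 2
      ≤ ENNReal.ofReal ((K * (1 - γ) ^ 2)⁻¹ * featSq μ φ (vecE (Θ' - Θ))) := by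
  have h1γ : 0 < 1 - γ := by linarith [hγ.2]
  have hKr : (0 : ℝ) < K := by exact_mod_cast hK
  have hc : 0 ≤ ((K : ℝ) * (1 - γ) ^ 2)⁻¹ := by positivity
  have h1 : W1w γ μ (etaOf γ φ Θ) (etaOf γ φ Θ') ^ 2
      = ∫⁻ s, W1 γ (etaOf γ φ Θ s) (etaOf γ φ Θ' s) ^ 2 ∂μ := by
    rw [W1w, ← ENNReal.rpow_natCast, ← ENNReal.rpow_mul]
    norm_num
  have hi := integrable_sum_sq_vecMul (μ := μ) hφm hφ (Θ' - Θ)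
  rw [h1, featSq, LinearEquiv.symm_apply_apply, ← integral_const_mul,
    ofReal_integral_eq_lintegral_ofReal (hi.const_mul _) (Filter.Eventually.of_forall fun s =>
      mul_nonneg hc (Finset.sum_nonneg fun k _ => sq_nonneg _))]
  refine lintegral_mono fun s => ?_
  simp only
  rw [W1_etaOf hγ hK, ← ENNReal.ofReal_pow (mul_nonneg (gap_pos hγ hK).le
    (Finset.sum_nonneg fun k _ => abs_nonneg _))]
  refine ENNReal.ofReal_le_ofReal ?_
  have hcs := sq_sum_le_card_mul_sum_sq (s := (Finset.univ : Finset (Fin K)))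
    (f := fun k => |((φ s).ofLp ᵥ* (Θ' - Θ)) k|)
  simp only [sq_abs, Finset.card_univ, Fintype.card_fin] at hcs
  rw [mul_pow]
  calc gap γ K ^ 2 * (∑ k, |((φ s).ofLp ᵥ* (Θ' - Θ)) k|) ^ 2
      ≤ gap γ K ^ 2 * (K * ∑ k, ((φ s).ofLp ᵥ* (Θ' - Θ)) k ^ 2) := by gcongr
    _ = _ := by
        unfold gap
        field_simp

end Wasserstein

/-! ### The error of the tail average -/

section Iterates

variable {S A : Type*} {d K : ℕ} {γ : ℝ} {φ : S → EuclideanSpace ℝ (Fin d)}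

/-- Linear-CTD, centred at `Θs` and vectorized, is the recursion `saIterate`. -/
lemma vecE_iterate_sub (hγ : γ ∈ Ioo (0 : ℝ) 1) (α : ℝ) {x : ℕ → (S × A) × (ℝ × S)}
    (hx : ∀ t, (x t).2.1 ∈ Icc (0 : ℝ) 1) (Θs Θ₀ : Matrix (Fin d) (Fin K) ℝ) (t : ℕ) :
    vecE (iterate γ α φ x Θ₀ t - Θs)
      = saIterate (fun x θ => tdField γ φ (Θs + vecE.symm θ) x) α (vecE (Θ₀ - Θs)) x t := by
  induction t with
  | zero => rfl
  | succ t ih =>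
    have h1 : vecE (iterate γ α φ x Θ₀ (t + 1) - Θs) = vecE (iterate γ α φ x Θ₀ t - Θs)
        - α • tdField γ φ (iterate γ α φ x Θ₀ t) (x t) := by
      rw [iterate, update_eq hγ α φ (x t) (hx t), tdField, ← map_smul, ← map_sub, sub_right_comm]
    rw [h1, saIterate, ← ih, LinearEquiv.symm_apply_apply, add_sub_cancel]

lemma vecE_tailAverage_sub (hγ : γ ∈ Ioo (0 : ℝ) 1) (α : ℝ) {x : ℕ → (S × A) × (ℝ × S)}
    (hx : ∀ t, (x t).2.1 ∈ Icc (0 : ℝ) 1) (Θs Θ₀ : Matrix (Fin d) (Fin K) ℝ) (m : ℕ) :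
    vecE (tailAverage γ α φ x Θ₀ (m + m) - Θs)
      = (((m + m + 1 : ℕ) : ℝ) - m)⁻¹ • ∑ t ∈ Finset.Ico m (m + m + 1),
        saIterate (fun x θ => tdField γ φ (Θs + vecE.symm θ) x) α (vecE (Θ₀ - Θs)) x t := by
  have hN : ((m + m + 1 : ℕ) : ℝ) - m = m + 1 := by push_cast; ring
  have hN' : ((m + m : ℕ) : ℝ) / 2 + 1 = m + 1 := by push_cast; ring
  have hm : (m + m) / 2 = m := by omega
  have hpos : (m : ℝ) + 1 ≠ 0 := by positivity
  have hIcc : Finset.Icc m (m + m) = Finset.Ico m (m + m + 1) := by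
    ext i; simp only [Finset.mem_Icc, Finset.mem_Ico]; omega
  have hcard : (Finset.Ico m (m + m + 1)).card = m + 1 := by rw [Nat.card_Ico]; omega
  simp only [← vecE_iterate_sub hγ α hx Θs Θ₀]
  rw [tailAverage, hN, hN', hm, hIcc, ← map_sum, ← map_smul, Finset.sum_sub_distrib,
    Finset.sum_const, hcard, smul_sub, ← Nat.cast_smul_eq_nsmul ℝ, smul_smul]
  push_cast
  rw [inv_mul_cancel₀ hpos, one_smul]

end Iterates

/-- The bound on the squared error as the square of a sum of three terms. With `a ≥ g / 2` and
`N ≥ T / 2` the squares of the three terms appear with the coefficients `576`, `3456` and `144`,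
all at most `60²`. -/
lemma le_sq_of_average_bound {Q α a g lam N T B V R : ℝ} (hα : 0 < α) (hg : 0 < g)
    (hga : g / 2 ≤ a) (hlam : 0 < lam) (hT : 0 < T) (hTN : T / 2 ≤ N) (hB : 0 ≤ B) (hV : 0 ≤ V)
    (hR : 0 ≤ R)
    (hQ : Q ≤ 3 / (α ^ 2 * a ^ 2 * lam * N ^ 2)
      * (3 * (R ^ 2 * V ^ 2 + 2 * α * (6 * B ^ 2) / (a * lam)) + 4 * N * α ^ 2 * (6 * B ^ 2))) :
    Q ≤ (60 * (B / (Real.sqrt T * g * Real.sqrt lam)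
      + B / (T * Real.sqrt α * g ^ (3 / 2 : ℝ) * lam) + R / (T * α * g * Real.sqrt lam) * V)) ^ 2 := by
  have ha : 0 < a := by linarith
  have hN : 0 < N := by linarith
  set t₁ := B / (Real.sqrt T * g * Real.sqrt lam) with ht₁
  set t₂ := B / (T * Real.sqrt α * g ^ (3 / 2 : ℝ) * lam) with ht₂
  set t₃ := R / (T * α * g * Real.sqrt lam) * V with ht₃
  have e₁ : t₁ ^ 2 = B ^ 2 / (T * g ^ 2 * lam) := by
    rw [ht₁, div_pow, mul_pow, mul_pow, Real.sq_sqrt hT.le, Real.sq_sqrt hlam.le]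
  have e₂ : t₂ ^ 2 = B ^ 2 / (T ^ 2 * α * g ^ 3 * lam ^ 2) := by
    have hg3 : (g ^ (3 / 2 : ℝ)) ^ 2 = g ^ 3 := by
      rw [← Real.rpow_natCast, ← Real.rpow_mul hg.le, ← Real.rpow_natCast]; norm_num
    rw [ht₂, div_pow, mul_pow, mul_pow, mul_pow, Real.sq_sqrt hα.le, hg3]
  have e₃ : t₃ ^ 2 = R ^ 2 * V ^ 2 / (T ^ 2 * α ^ 2 * g ^ 2 * lam) := by
    rw [ht₃, mul_pow, div_pow, mul_pow, mul_pow, mul_pow, Real.sq_sqrt hlam.le]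
    ring
  have p₁ : 0 ≤ t₁ := by positivity
  have p₂ : 0 ≤ t₂ := by positivity
  have p₃ : 0 ≤ t₃ := by positivity
  have b₁ : 72 * B ^ 2 / (a ^ 2 * lam * N) ≤ 576 * t₁ ^ 2 := by
    rw [e₁]
    calc 72 * B ^ 2 / (a ^ 2 * lam * N)
        ≤ 72 * B ^ 2 / ((g / 2) ^ 2 * lam * (T / 2)) := by gcongr
      _ = 576 * (B ^ 2 / (T * g ^ 2 * lam)) := by field_simp; ring
  have b₂ : 108 * B ^ 2 / (α * a ^ 3 * lam ^ 2 * N ^ 2) ≤ 3456 * t₂ ^ 2 := by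
    rw [e₂]
    calc 108 * B ^ 2 / (α * a ^ 3 * lam ^ 2 * N ^ 2)
        ≤ 108 * B ^ 2 / (α * (g / 2) ^ 3 * lam ^ 2 * (T / 2) ^ 2) := by gcongr
      _ = 3456 * (B ^ 2 / (T ^ 2 * α * g ^ 3 * lam ^ 2)) := by field_simp; ring
  have b₃ : 9 * (R ^ 2 * V ^ 2) / (α ^ 2 * a ^ 2 * lam * N ^ 2) ≤ 144 * t₃ ^ 2 := by
    rw [e₃]
    calc 9 * (R ^ 2 * V ^ 2) / (α ^ 2 * a ^ 2 * lam * N ^ 2)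
        ≤ 9 * (R ^ 2 * V ^ 2) / (α ^ 2 * (g / 2) ^ 2 * lam * (T / 2) ^ 2) := by gcongr
      _ = 144 * (R ^ 2 * V ^ 2 / (T ^ 2 * α ^ 2 * g ^ 2 * lam)) := by field_simp; ring
  have hsum : 3 / (α ^ 2 * a ^ 2 * lam * N ^ 2)
      * (3 * (R ^ 2 * V ^ 2 + 2 * α * (6 * B ^ 2) / (a * lam)) + 4 * N * α ^ 2 * (6 * B ^ 2))
      = 9 * (R ^ 2 * V ^ 2) / (α ^ 2 * a ^ 2 * lam * N ^ 2)
        + 108 * B ^ 2 / (α * a ^ 3 * lam ^ 2 * N ^ 2) + 72 * B ^ 2 / (a ^ 2 * lam * N) := by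
    field_simp; ring
  rw [hsum] at hQ
  nlinarith [mul_nonneg p₁ p₂, mul_nonneg p₁ p₃, mul_nonneg p₂ p₃, sq_nonneg t₁, sq_nonneg t₂,
    sq_nonneg t₃]

end LinearCTD

end

open LinearCTD
theorem theorem1 :
    ∃ c : ℝ, 0 < c ∧
      ∀ (S A : Type*)
        [TopologicalSpace S] [PolishSpace S] [MeasurableSpace S] [BorelSpace S]
        [TopologicalSpace A] [PolishSpace A] [MeasurableSpace A] [BorelSpace A]
        (γ : ℝ) (_ : γ ∈ Ioo (0 : ℝ) 1)
        (P : Kernel (S × A) (ℝ × S)) [IsMarkovKernel P]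
        (_ : ∀ z : S × A, ∀ᵐ y ∂(P z), y.1 ∈ Icc (0 : ℝ) 1)
        (π : Kernel S A) [IsMarkovKernel π]
        (μ : Measure S) [IsProbabilityMeasure μ]
        (_ : Kernel.Invariant (rewardStep P π).snd μ)
        (d : ℕ) (φ : S → EuclideanSpace ℝ (Fin d)) (_ : Measurable φ) (_ : ∀ s, ‖φ s‖ ≤ 1)
        (_ : 0 < lambdaMin μ φ)
        (K : ℕ) (_ : (1 - γ)⁻¹ ≤ (K : ℝ)),
      (∃! Θ : Matrix (Fin d) (Fin K) ℝ, IsProjectedFixedPoint γ P π μ φ Θ) ∧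
      ∀ (Θs : Matrix (Fin d) (Fin K) ℝ) (_ : IsProjectedFixedPoint γ P π μ φ Θs)
        (α : ℝ) (_ : α ∈ Ioo (0 : ℝ) ((1 - Real.sqrt γ) / 76))
        (Ω : Type*) [MeasurableSpace Ω] (ρ : Measure Ω) [IsProbabilityMeasure ρ]
        (ξ : ℕ → Ω → (S × A) × (ℝ × S))
        (_ : ∀ t, HasLaw (ξ t) (sampleLaw P π μ) ρ) (_ : iIndepFun ξ ρ)
        (Θ₀ : Matrix (Fin d) (Fin K) ℝ)
        (T : ℕ) (_ : Even T) (_ : 0 < T),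
        (∫⁻ ω, W1w γ μ (etaOf γ φ Θs)
            (etaOf γ φ (tailAverage γ α φ (fun t => ξ t ω) Θ₀ T)) ^ 2 ∂ρ) ^ (1 / 2 : ℝ)
          ≤ ENNReal.ofReal (c *
            ((normV1 γ μ φ Θs + 1)
                / (Real.sqrt T * (1 - γ) * Real.sqrt (lambdaMin μ φ))
                * (1 + Real.sqrt (α / ((1 - γ) * lambdaMin μ φ)))
              + (normV1 γ μ φ Θs + 1)
                / (T * Real.sqrt α * (1 - γ) ^ (3 / 2 : ℝ) * lambdaMin μ φ)
              + (1 - 1 / 2 * α * (1 - Real.sqrt γ) * lambdaMin μ φ) ^ (T / 2)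
                / (T * Real.sqrt α * (1 - γ) * Real.sqrt (lambdaMin μ φ))
                * (1 / Real.sqrt α + 1 / Real.sqrt ((1 - γ) * lambdaMin μ φ))
                * normV2 γ (Θ₀ - Θs))) := by
  refine ⟨60, by norm_num, ?_⟩
  intro S A _ _ _ _ _ _ _ _ γ hγ P _ hP π _ μ _ hμ d φ hφm hφ hlam K hKγ
  have hg : 0 < 1 - γ := by linarith [hγ.2]
  have hKr : (0 : ℝ) < K := lt_of_lt_of_le (inv_pos.2 hg) hKγ
  have hK : 0 < K := by exact_mod_cast hKr
  refine ⟨existsUnique_isProjectedFixedPoint hγ hK hP hμ hφm hφ hlam, ?_⟩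
  intro Θs hΘs α hα Ω _ ρ _ ξ hξ hind Θ₀ T hT hT0
  obtain ⟨m, rfl⟩ := hT
  have hm : 0 < m := by omega
  have hα0 : 0 < α := hα.1
  have hs0 : 0 < Real.sqrt γ := Real.sqrt_pos.2 hγ.1
  have hs1 : Real.sqrt γ < 1 := (Real.sqrt_lt' one_pos).2 (by simpa using hγ.2)
  have hss : Real.sqrt γ * Real.sqrt γ = γ := Real.mul_self_sqrt hγ.1.le
  set a := 1 - Real.sqrt γ with ha
  set lam := lambdaMin μ φ with hlamdef
  have hga : (1 - γ) / 2 ≤ a := by nlinarith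
  have haα : 8 * α ≤ a := by linarith [hα.2]
  have ha1 : a ≤ 1 := by linarith
  have hlam1 : lam ≤ 1 := lambdaMin_le_one hφm hφ hlam
  have hQs := featSq_nonneg μ φ (vecE Θs)
  have H := noisyField_tdField hγ hP hμ hφm hφ
    ((isProjectedFixedPoint_iff_integral_tdField hγ hK hP hφm hφ Θs).1 hΘs)
  have hmain := H.integral_q_average_le (vecE (Θ₀ - Θs)) hξ hind hα0 haα hlam hlam1 ha1
    (by positivity) m (m + m + 1) (by omega)
  have hint := H.integrable_q_average α (vecE (Θ₀ - Θs)) hξ hind (Finset.Ico m (m + m + 1))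
    (((m + m + 1 : ℕ) : ℝ) - m)⁻¹
  set κ : ℝ := ((K : ℝ) * (1 - γ) ^ 2)⁻¹ with hκ
  have hκ0 : 0 < κ := by positivity
  -- The samples have rewards in `[0, 1]` almost surely, where the update has the closed form.
  have hrew : ∀ᵐ ω ∂ρ, ∀ t, (ξ t ω).2.1 ∈ Icc (0 : ℝ) 1 := by
    refine ae_all_iff.2 fun t => ?_
    have h := ae_sampleLaw_reward_mem P π μ hP
    rw [← (hξ t).map_eq] at h
    exact ae_of_ae_map (hξ t).aemeasurable h
  have hlint : ∫⁻ ω, W1w γ μ (etaOf γ φ Θs)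
      (etaOf γ φ (tailAverage γ α φ (fun t => ξ t ω) Θ₀ (m + m))) ^ 2 ∂ρ
      ≤ ENNReal.ofReal (κ * ∫ ω, featSq μ φ ((((m + m + 1 : ℕ) : ℝ) - m)⁻¹ •
        ∑ t ∈ Finset.Ico m (m + m + 1), saIterate (fun x θ => tdField γ φ (Θs + vecE.symm θ) x)
          α (vecE (Θ₀ - Θs)) (fun i => ξ i ω) t) ∂ρ) := by
    rw [← integral_const_mul, ofReal_integral_eq_lintegral_ofReal (hint.const_mul _)
      (Filter.Eventually.of_forall fun ω => mul_nonneg hκ0.le (featSq_nonneg _ _ _))]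
    refine lintegral_mono_ae ?_
    filter_upwards [hrew] with ω hω
    rw [← vecE_tailAverage_sub hγ α hω]
    exact W1w_sq_le hγ hK hφm hφ _ _
  have hV1 : normV1 γ μ φ Θs ^ 2 = κ * featSq μ φ (vecE Θs) := by
    rw [normV1, matNorm_kronecker_featCov hφm hφ, mul_pow, Real.sq_sqrt hQs, div_pow, mul_pow,
      Real.sq_sqrt hKr.le, one_pow, one_div]
  have hV2 : normV2 γ (Θ₀ - Θs) ^ 2 = κ * ‖vecE (Θ₀ - Θs)‖ ^ 2 := by
    rw [normV2, mul_pow, div_pow, mul_pow, Real.sq_sqrt hKr.le, one_pow, one_div]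
    rfl
  have hV1nn : 0 ≤ normV1 γ μ φ Θs := by
    unfold normV1 matNorm; positivity
  have hV2nn : 0 ≤ normV2 γ (Θ₀ - Θs) := by
    unfold normV2; positivity
  set V₁ := normV1 γ μ φ Θs
  set V₂ := normV2 γ (Θ₀ - Θs)
  have hσ : κ * (6 * featSq μ φ (vecE Θs) + 3 * (K * (1 - γ) ^ 2)) ≤ 6 * (V₁ + 1) ^ 2 := by
    have h1 : κ * (K * (1 - γ) ^ 2) = 1 := by rw [hκ]; exact inv_mul_cancel₀ (by positivity)
    nlinarith
  have hρ0 : 0 ≤ 1 - 1 / 2 * α * a * lam := by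
    have h1 : a * lam ≤ 1 := mul_le_one₀ ha1 hlam.le hlam1
    have h2 : α * (a * lam) ≤ 1 := mul_le_one₀ (by linarith) (by positivity) h1
    linarith
  set R := (1 - 1 / 2 * α * a * lam) ^ m with hR
  have hR0 : 0 ≤ R := pow_nonneg hρ0 m
  have hN : (((m + m + 1 : ℕ) : ℝ) - m) = m + 1 := by push_cast; ring
  have hTcast : ((m + m : ℕ) : ℝ) = 2 * m := by push_cast; ring
  have hmr : (0 : ℝ) < m := by exact_mod_cast hm
  have hbound := le_sq_of_average_bound (Q := κ * ∫ ω, featSq μ φ ((((m + m + 1 : ℕ) : ℝ) - m)⁻¹ •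
        ∑ t ∈ Finset.Ico m (m + m + 1), saIterate (fun x θ => tdField γ φ (Θs + vecE.symm θ) x)
          α (vecE (Θ₀ - Θs)) (fun i => ξ i ω) t) ∂ρ) (α := α) (a := a) (g := 1 - γ) (lam := lam)
    (N := ((m + m + 1 : ℕ) : ℝ) - m) (T := ((m + m : ℕ) : ℝ)) (B := V₁ + 1) (V := V₂) (R := R)
    hα0 hg hga hlam (by rw [hTcast]; positivity) (by rw [hN, hTcast]; linarith) (by positivity)
    hV2nn hR0 (by
      refine (mul_le_mul_of_nonneg_left hmain hκ0.le).trans ?_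
      rw [hV2]
      have ha0 : 0 < a := by linarith
      have hN0 : 0 < ((m + m + 1 : ℕ) : ℝ) - m := by rw [hN]; positivity
      set N := ((m + m + 1 : ℕ) : ℝ) - m
      set σ := 6 * featSq μ φ (vecE Θs) + 3 * (K * (1 - γ) ^ 2)
      calc κ * (3 / (α ^ 2 * a ^ 2 * lam * N ^ 2) * (3 * (R ^ 2 * ‖vecE (Θ₀ - Θs)‖ ^ 2
            + 2 * α * σ / (a * lam)) + 4 * N * α ^ 2 * σ))
          = 3 / (α ^ 2 * a ^ 2 * lam * N ^ 2) * (3 * (R ^ 2 * (κ * ‖vecE (Θ₀ - Θs)‖ ^ 2)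
            + 2 * α * (κ * σ) / (a * lam)) + 4 * N * α ^ 2 * (κ * σ)) := by ring
        _ ≤ _ := by gcongr)
  have hfin : κ * ∫ ω, featSq μ φ ((((m + m + 1 : ℕ) : ℝ) - m)⁻¹ •
        ∑ t ∈ Finset.Ico m (m + m + 1), saIterate (fun x θ => tdField γ φ (Θs + vecE.symm θ) x)
          α (vecE (Θ₀ - Θs)) (fun i => ξ i ω) t) ∂ρ ≤ _ := hbound
  refine (ENNReal.rpow_le_rpow (hlint.trans (ENNReal.ofReal_le_ofReal hfin))
    (by norm_num)).trans ?_
  have hT0' : (0 : ℝ) < ((m + m : ℕ) : ℝ) := by rw [hTcast]; positivity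
  rw [ENNReal.ofReal_rpow_of_nonneg (sq_nonneg _) (by norm_num), ← Real.sqrt_eq_rpow,
    Real.sqrt_sq (by positivity)]
  refine ENNReal.ofReal_le_ofReal ?_
  have hm2 : (m + m) / 2 = m := by omega
  rw [hm2, ← hR]
  have k1 : (V₁ + 1) / (Real.sqrt ((m + m : ℕ) : ℝ) * (1 - γ) * Real.sqrt lam)
      ≤ (V₁ + 1) / (Real.sqrt ((m + m : ℕ) : ℝ) * (1 - γ) * Real.sqrt lam)
        * (1 + Real.sqrt (α / ((1 - γ) * lam))) :=
    le_mul_of_one_le_right (by positivity) (by linarith [Real.sqrt_nonneg (α / ((1 - γ) * lam))])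
  have k3 : R / (((m + m : ℕ) : ℝ) * α * (1 - γ) * Real.sqrt lam) * V₂
      ≤ R / (((m + m : ℕ) : ℝ) * Real.sqrt α * (1 - γ) * Real.sqrt lam)
        * (1 / Real.sqrt α + 1 / Real.sqrt ((1 - γ) * lam)) * V₂ := by
    refine mul_le_mul_of_nonneg_right ?_ hV2nn
    have hsα : 0 < Real.sqrt α := Real.sqrt_pos.2 hα0
    have e : R / (((m + m : ℕ) : ℝ) * α * (1 - γ) * Real.sqrt lam)
        = R / (((m + m : ℕ) : ℝ) * Real.sqrt α * (1 - γ) * Real.sqrt lam) * (1 / Real.sqrt α) := by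
      rw [div_mul_div_comm, mul_one]
      congr 1
      nth_rewrite 1 [← Real.mul_self_sqrt hα0.le]
      ring
    rw [e]
    refine mul_le_mul_of_nonneg_left ?_ (by positivity)
    linarith [show 0 ≤ 1 / Real.sqrt ((1 - γ) * lam) by positivity]
  refine mul_le_mul_of_nonneg_left ?_ (by norm_num)
  exact add_le_add (add_le_add k1 le_rfl) k3
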